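/- **Theorem 1.** Let $a>0$, $\alpha>0$ and $\Omega=(-a,a)^2\subset\mathbb{R}^2$. Let $\gamma:\mathbb{R}\to\mathbb{R}$ be continuous and piecewise $C^1$ (that is, there are finitely many break points such that $\gamma$ is $C^1$, up to the end points, on every compact interval without break points in its interior), with $\gamma(x)=x$ for $|x|\ge a$ and $|\gamma(x)|\le a$ for $|x|<a$. Let $\Gamma=\{(x,\gamma(x)):x\in\mathbb{R}\}$ be its graph and $\mu$ the arc length measure on $\Gamma$. Let $A=(A_1,A_2)$ be a real vector potential on $\mathbb{R}^2$ such that $A\psi\in L^2(\mathbb{R}^2)^2$ for every $\psi$ in the Sobolev space $H^1(\mathbb{R}^2)$ (for instance, a bounded measurable $A$), and assume that the magnetic field $B=\operatorname{rot}A=\partial_xA_2-\partial_yA_1$ (in the sense of distributions) is a locally integrable function with $\operatorname{supp}B\subset\Omega$. Consider the quadratic form $$q[\psi]=\int_{\mathbb{R}^2}|(i\nabla+A)\psi|^2\,dx\,dy-\alpha\int_\Gamma|\psi|^2\,d\mu,\qquad \psi\in H^1(\mathbb{R}^2),$$ in $L^2(\mathbb{R}^2)$, where the values of $\psi$ on $\Gamma$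 are understood in the sense of traces. Then the operator $H=(i\nabla+A)^2-\alpha\delta_\Gamma$ associated with $q$ (that is, $\psi\in\operatorname{Dom}H$ and $H\psi=f$ if and only if $\psi\in H^1(\mathbb{R}^2)$ and $q(\varphi,\psi)=\langle\varphi,f\rangle$ for all $\varphi\in H^1(\mathbb{R}^2)$, where $q(\cdot,\cdot)$ is the sesquilinear form of $q$) is well defined and self-adjoint, and its essential spectrum, i.e. its spectrum without the isolated eigenvalues of finite multiplicity, is $$\sigma_{\mathrm{ess}}(H)=\left[-\tfrac14\alpha^2,\infty\right).$$ -/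

import Mathlib

open MeasureTheory Filter Topology Set
open scoped ContDiff ComplexConjugate

noncomputable section

namespace LeakyWire

/-! ### Spectrum of an unbounded operator -/

section Spectrum

variable {E : Type*} [NormedAddCommGroup E] [NormedSpace ℂ E]

/-- `z` is in the resolvent set of `T` iff `T - z : dom T → E` has an everywhere defined
bounded inverse `R`. -/
def resolventSet (T : E →ₗ.[ℂ] E) : Set ℂ :=
  {z | ∃ R : E →L[ℂ] E,
    (∀ f : E, ∃ h : R f ∈ T.domain, T ⟨R f, h⟩ - z • R f = f) ∧
    (∀ u : T.domain, R (T u - z • (u : E)) = u)}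

/-- The spectrum of an unbounded operator. -/
def spectrum (T : E →ₗ.[ℂ] E) : Set ℂ := (resolventSet T)ᶜ

/-- The kernel of `T - z`, as a subspace of the domain of `T`. -/
def eigenspace (T : E →ₗ.[ℂ] E) (z : ℂ) : Submodule ℂ T.domain :=
  LinearMap.ker (T.toFun - z • T.domain.subtype)

/-- The discrete spectrum: isolated points of the spectrum that are eigenvalues of finite
multiplicity. -/
def discreteSpectrum (T : E →ₗ.[ℂ] E) : Set ℂ :=
  {z | (∃ U ∈ 𝓝 z, U ∩ spectrum T = {z}) ∧ eigenspace T z ≠ ⊥ ∧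
    FiniteDimensional ℂ (eigenspace T z)}

/-- The essential spectrum: the spectrum without the discrete spectrum. -/
def essentialSpectrum (T : E →ₗ.[ℂ] E) : Set ℂ := spectrum T \ discreteSpectrum T

end Spectrum

/-! ### The Sobolev space `H¹(ℝ²)` -/

/-- The plane; its measure `volume` is the Lebesgue measure. The norm of `ℝ × ℝ` plays no role. -/
abbrev Plane : Type := ℝ × ℝ

/-- The Hilbert space `L²(ℝ², ℂ)`. -/
abbrev L2 : Type := Lp ℂ 2 (volume : Measure Plane)

/-- Smooth functions with compact support. -/
def IsTest {F : Type*} [NormedAddCommGroup F] [NormedSpace ℝ F] (φ : Plane → F) : Prop :=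
  ContDiff ℝ ∞ φ ∧ HasCompactSupport φ

/-- `g` is the weak derivative of `u` in the direction `e`. -/
def HasWeakDeriv (e : Plane) (u g : L2) : Prop :=
  ∀ φ : Plane → ℝ, IsTest φ → ∫ p, (fderiv ℝ φ p e) • u p = - ∫ p, φ p • g p

/-- The Sobolev space `H¹(ℝ²)`, as a subset of `L²(ℝ²)`. -/
def H1 : Set L2 :=
  {u | (∃ g : L2, HasWeakDeriv (1, 0) u g) ∧ ∃ g : L2, HasWeakDeriv (0, 1) u g}

open scoped Classical in
/-- The weak derivative in the direction `e` (`0` if there is none). -/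
def weakDeriv (e : Plane) (u : L2) : L2 :=
  if h : ∃ g : L2, HasWeakDeriv e u g then h.choose else 0

/-! ### The curve and traces on it -/

/-- `γ` is `C¹` up to the end points on every compact interval whose interior avoids a suitable
finite set of break points. -/
def IsPiecewiseC1 (γ : ℝ → ℝ) : Prop :=
  ∃ S : Finset ℝ, ∀ c d : ℝ, c < d → Disjoint (Ioo c d) (S : Set ℝ) →
    ContDiffOn ℝ 1 γ (Icc c d)

/-- The arc length measure of the graph of `γ`, as a measure on the plane: the image of
`√(1 + γ'(x)²) dx` under `x ↦ (x, γ x)`. -/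
def arcLength (γ : ℝ → ℝ) : Measure Plane :=
  ((volume : Measure ℝ).withDensity
    fun x => ENNReal.ofReal (Real.sqrt (1 + (deriv γ x) ^ 2))).map fun x => (x, γ x)

/-- `t` is the trace of `u ∈ H¹(ℝ²)` on the graph of `γ`: it is the `L²(Γ)`-limit of the
restrictions to `Γ` of test functions that converge to `u` in `H¹(ℝ²)`. -/
def IsTrace (γ : ℝ → ℝ) (u : L2) (t : Lp ℂ 2 (arcLength γ)) : Prop :=
  ∃ φ : ℕ → Plane → ℂ, (∀ n, IsTest (φ n)) ∧
    Tendsto (fun n => eLpNorm (fun p => φ n p - u p) 2 volume) atTop (𝓝 0) ∧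
    (∀ e ∈ ({(1, 0), (0, 1)} : Set Plane), Tendsto
      (fun n => eLpNorm (fun p => fderiv ℝ (φ n) p e - weakDeriv e u p) 2 volume)
      atTop (𝓝 0)) ∧
    Tendsto (fun n => eLpNorm (fun p => φ n p - t p) 2 (arcLength γ)) atTop (𝓝 0)

open scoped Classical in
/-- The trace of `u` on the graph of `γ` (`0` if there is none). -/
def trace (γ : ℝ → ℝ) (u : L2) : Lp ℂ 2 (arcLength γ) :=
  if h : ∃ t, IsTrace γ u t then h.choose else 0

/-! ### The magnetic form and its operator -/

/-- The form `ψ ↦ ∫ |(i∇ + A)ψ|²` makes sense on `H¹(ℝ²)`: `Aψ` is square integrable for every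
`ψ ∈ H¹(ℝ²)`. -/
def MapsH1ToL2 (A : Plane → ℝ × ℝ) : Prop :=
  ∀ u ∈ H1, MemLp (fun p => ((A p).1 : ℂ) * u p) 2 volume ∧
    MemLp (fun p => ((A p).2 : ℂ) * u p) 2 volume

/-- `B = rot A = ∂₁A₂ - ∂₂A₁` in the sense of distributions. -/
def IsRot (A : Plane → ℝ × ℝ) (B : Plane → ℝ) : Prop :=
  ∀ φ : Plane → ℝ, IsTest φ →
    ∫ p, ((A p).1 * fderiv ℝ φ p (0, 1) - (A p).2 * fderiv ℝ φ p (1, 0)) = ∫ p, B p * φ p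

/-- First component of `(i∇ + A)u`. -/
def magX (A : Plane → ℝ × ℝ) (u : L2) (p : Plane) : ℂ :=
  Complex.I * weakDeriv (1, 0) u p + ((A p).1 : ℂ) * u p

/-- Second component of `(i∇ + A)u`. -/
def magY (A : Plane → ℝ × ℝ) (u : L2) (p : Plane) : ℂ :=
  Complex.I * weakDeriv (0, 1) u p + ((A p).2 : ℂ) * u p

/-- The sesquilinear form (conjugate linear in `φ`) with the quadratic form
`q[ψ] = ∫ |(i∇ + A)ψ|² - α ∫_Γ |ψ|² dμ`. -/
def form (A : Plane → ℝ × ℝ) (α : ℝ) (γ : ℝ → ℝ) (φ ψ : L2) : ℂ :=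
  (∫ p, (conj (magX A φ p) * magX A ψ p + conj (magY A φ p) * magY A ψ p)) -
    (α : ℂ) * ∫ p, conj (trace γ φ p) * trace γ ψ p ∂(arcLength γ)

/-- `H` is the operator associated with the form on the form domain `H¹(ℝ²)`: `ψ ∈ dom H` and
`Hψ = f` iff `ψ ∈ H¹(ℝ²)` and `q(φ, ψ) = ⟨φ, f⟩` for all `φ ∈ H¹(ℝ²)`. -/
def IsAssociated (A : Plane → ℝ × ℝ) (α : ℝ) (γ : ℝ → ℝ) (H : L2 →ₗ.[ℂ] L2) : Prop :=
  ∀ ψ f : L2, (ψ, f) ∈ H.graph ↔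
    ψ ∈ H1 ∧ ∀ φ ∈ H1, form A α γ φ ψ = inner ℂ φ f

end LeakyWire

end

noncomputable section

namespace LeakyWire

set_option linter.unusedSectionVars false

/-! ### Resolvent set of a self-adjoint operator -/

section SelfAdjoint

variable {E : Type*} [NormedAddCommGroup E] [InnerProductSpace ℂ E] [CompleteSpace E]

/-! The space H¹(ℝ²) is realised as the Hilbert space `Sob` of triples (u, ∂₁u, ∂₂u). There q takes
the form ⟨U, T U⟩ with a bounded self-adjoint T (`formBdd`). Once q plus a multiple of ‖u‖² is
coercive (`exists_coercive`), Lax–Milgram yields the self-adjoint operator (`isSelfAdjoint_formOp`).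

The potential is handled by two facts. Multiplication by the components of A is bounded from H¹ to
L² by the closed graph theorem (`mulOp`). The diamagnetic inequality |∂|ψ|| ≤ |(i∂ + A)ψ| then shows
that quantities depending only on |ψ|, such as ‖Aψ‖ and the norm of the trace, are controlled by the
magnetic gradient.

No essential spectrum below -α²/4: where |x + y| > 2a the curve is the diagonal, and on each line
across it h(0)² ≤ ∫ |h||h'| gives the sharp bound of the trace by the gradient and α²/4 times the L²
norm. The rest of the curve lies in the box [-a, a]², which does not meet that region. There a crude
trace inequality on vertical segments costs a constant times the L² norm on the box. Together
(`trace_le`) q[ψ] ≥ -α²/4 ‖ψ‖² - C ∫_box |ψ|². By Poincaré's inequality on small squares, the last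
integral is a small multiple of the H¹ norm up to a form of finite rank. Hence q ≥ μ up to finite
rank for every μ < -α²/4 (`exists_lower_bound_finiteRank`), and this excludes essential spectrum
below μ (`notMem_essentialSpectrum_of_finiteRank`).

Every l ≥ -α²/4 is in the spectrum: far out on the straight part, products of a cut-off plane wave
along the diagonal and a cut-off smoothing of exp(-b|t|) across it are quasi-modes of the problem
without field (`exists_quasimode`). Their supports lie in balls where B = 0; there A is a gradient
up to a small L² error, and a gauge factor exp(iχ) removes it (`exists_gauge`,
`exists_quasimode_formBdd`). A half-line has no isolated points, so all of it is essential spectrum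
(`essentialSpectrum_formOp`). -/

theorem _root_.IsSelfAdjoint.linearPMap_inner_apply {T : E →ₗ.[ℂ] E} (hT : IsSelfAdjoint T)
    (u v : T.domain) : inner ℂ (T u) (v : E) = inner ℂ (u : E) (T v) := by
  have h := T.adjoint_isFormalAdjoint hT.dense_domain
  rw [LinearPMap.isSelfAdjoint_def.1 hT] at h
  exact h u v

theorem _root_.IsSelfAdjoint.mem_graph_of_inner {T : E →ₗ.[ℂ] E} (hT : IsSelfAdjoint T)
    {w f : E} (h : ∀ u : T.domain, inner ℂ f (u : E) = inner ℂ w (T u)) : (w, f) ∈ T.graph := by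
  have hw := T.mem_adjoint_domain_of_exists w ⟨f, h⟩
  have hv := LinearPMap.adjoint_apply_eq hT.dense_domain ⟨w, hw⟩ (x₀ := f) h
  have : (w, f) ∈ (T.adjoint).graph := by
    rw [LinearPMap.mem_graph_iff]
    exact ⟨⟨w, hw⟩, rfl, hv⟩
  rwa [LinearPMap.isSelfAdjoint_def.1 hT] at this

/-- A self-adjoint `T` with `T - z` bounded below and `T - conj z` injective has `z` in its
resolvent set. -/
theorem mem_resolventSet_of_bounded_below {T : E →ₗ.[ℂ] E} (hT : IsSelfAdjoint T) {z : ℂ} {c : ℝ}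
    (hc : 0 < c) (hb : ∀ u : T.domain, c * ‖(u : E)‖ ≤ ‖T u - z • (u : E)‖)
    (hi : ∀ u : T.domain, T u = conj z • (u : E) → (u : E) = 0) : z ∈ resolventSet T := by
  let S : T.domain →ₗ[ℂ] E := T.toFun - z • T.domain.subtype
  have hS : ∀ u : T.domain, S u = T u - z • (u : E) := fun u => rfl
  -- The lower bound turns convergence of the images into convergence of the `u n`, and the graph of
  -- a self-adjoint operator is closed.
  have hclosed : IsClosed (LinearMap.range S : Set E) := by
    rw [← isSeqClosed_iff_isClosed]
    intro y y0 hy hlim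
    choose u hu using hy
    have hcau : CauchySeq fun n => (u n : E) := by
      rw [Metric.cauchySeq_iff']
      intro ε hε
      obtain ⟨N, hN⟩ := Metric.cauchySeq_iff'.1 hlim.cauchySeq (c * ε) (by positivity)
      refine ⟨N, fun n hn => ?_⟩
      have h1 := hN n hn
      have h2 := hb (u n - u N)
      rw [← hS, map_sub, hu, hu, ← dist_eq_norm] at h2
      rw [dist_eq_norm]
      have : c * ‖(u n : E) - u N‖ < c * ε := by
        refine lt_of_le_of_lt ?_ h1
        simpa using h2
      exact lt_of_mul_lt_mul_left this hc.le
    obtain ⟨u0, hu0⟩ := cauchySeq_tendsto_of_complete hcau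
    have hTu : Tendsto (fun n => T (u n)) atTop (𝓝 (y0 + z • u0)) := by
      have : (fun n => T (u n)) = fun n => y n + z • (u n : E) := by
        funext n; rw [← hu, hS]; simp
      rw [this]
      exact hlim.add (hu0.const_smul z)
    have hg : (u0, y0 + z • u0) ∈ T.graph :=
      hT.isClosed.isSeqClosed (x := fun n => ((u n : E), T (u n)))
        (fun n => T.mem_graph (u n)) (hu0.prodMk_nhds hTu)
    rw [LinearPMap.mem_graph_iff] at hg
    obtain ⟨v, hv, hv2⟩ := hg
    exact ⟨v, by rw [hS, hv2]; simp [hv]⟩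
  -- A vector orthogonal to the range lies in the kernel of `T - conj z`, which is trivial by `hi`.
  have htop : LinearMap.range S = ⊤ := by
    have : CompleteSpace (LinearMap.range S) := hclosed.completeSpace_coe
    rw [← Submodule.orthogonal_eq_bot_iff, Submodule.eq_bot_iff]
    intro w hw
    have hgr : (w, conj z • w) ∈ T.graph := by
      apply hT.mem_graph_of_inner
      intro u
      have h := (Submodule.mem_orthogonal' _ w).1 hw (S u) ⟨u, rfl⟩
      rw [hS, inner_sub_right, inner_smul_right, sub_eq_zero] at h
      rw [inner_smul_left, h]; simp
    rw [LinearPMap.mem_graph_iff] at hgr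
    obtain ⟨v, hv, hv2⟩ := hgr
    simp only at hv hv2
    rw [← hv] at hv2 ⊢
    exact hi v hv2
  have hinj : Function.Injective S := by
    rw [injective_iff_map_eq_zero]
    intro u hu
    have h := hb u
    rw [← hS, hu, norm_zero] at h
    have : ‖(u : E)‖ ≤ 0 := by
      by_contra hcon
      push Not at hcon
      nlinarith
    simpa using this
  let e : T.domain ≃ₗ[ℂ] E := LinearEquiv.ofBijective S ⟨hinj, LinearMap.range_eq_top.1 htop⟩
  have he : ∀ f, S (e.symm f) = f := fun f => e.apply_symm_apply f
  let R0 : E →ₗ[ℂ] E := T.domain.subtype ∘ₗ e.symm.toLinearMap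
  have hR0 : ∀ f, R0 f = (e.symm f : E) := fun f => rfl
  refine ⟨R0.mkContinuous c⁻¹ ?_, ?_, ?_⟩
  · intro f
    have h := hb (e.symm f)
    rw [← hS, he] at h
    rw [hR0, inv_mul_eq_div, le_div_iff₀ hc, mul_comm]
    exact h
  · intro f
    refine ⟨(e.symm f).2, ?_⟩
    exact he f
  · intro u
    change (e.symm (S u) : E) = u
    rw [show S u = e u from rfl, e.symm_apply_apply]

/-- Since `⟨u, T u⟩` is real, the imaginary part of `⟨u, (T - w) u⟩` is `-w.im * ‖u‖²`.
Cauchy–Schwarz bounds `T - w` below, for `w = z` and `w = conj z` alike. -/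
theorem mem_resolventSet_of_im_ne_zero {T : E →ₗ.[ℂ] E} (hT : IsSelfAdjoint T) {z : ℂ}
    (hz : z.im ≠ 0) : z ∈ resolventSet T := by
  have key : ∀ (w : ℂ) (u : T.domain), |w.im| * ‖(u : E)‖ ≤ ‖T u - w • (u : E)‖ := by
    intro w u
    have hre : (inner ℂ (u : E) (T u)).im = 0 := by
      have h := hT.linearPMap_inner_apply u u
      rw [← inner_conj_symm] at h
      exact Complex.conj_eq_iff_im.1 h
    have h1 : |w.im| * ‖(u : E)‖ ^ 2 ≤ ‖inner ℂ (u : E) (T u - w • (u : E))‖ := by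
      refine le_trans ?_ (Complex.abs_im_le_norm _)
      rw [inner_sub_right, inner_smul_right, inner_self_eq_norm_sq_to_K, Complex.sub_im, hre]
      have : (w * ((‖(u : E)‖ : ℂ)) ^ 2).im = w.im * ‖(u : E)‖ ^ 2 := by
        rw [← Complex.ofReal_pow, Complex.im_mul_ofReal]
      simp only [Complex.coe_algebraMap, this]
      rw [zero_sub, abs_neg, abs_mul, abs_of_nonneg (sq_nonneg ‖(u : E)‖)]
    have h2 := norm_inner_le_norm (𝕜 := ℂ) (u : E) (T u - w • (u : E))
    by_cases hu : ‖(u : E)‖ = 0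
    · rw [hu]; simp
    · have hu' : 0 < ‖(u : E)‖ := lt_of_le_of_ne (norm_nonneg _) (Ne.symm hu)
      nlinarith
  refine mem_resolventSet_of_bounded_below hT (abs_pos.2 hz) (key z) fun u hu => ?_
  have h := key (conj z) u
  rw [hu, sub_self, norm_zero, Complex.conj_im, abs_neg] at h
  have := abs_pos.2 hz
  have h3 : ‖(u : E)‖ ≤ 0 := by
    by_contra hcon
    push Not at hcon
    nlinarith
  simpa using h3

end SelfAdjoint

/-! ### The operator associated with a coercive form -/

section Form

variable {V E : Type*} [NormedAddCommGroup V] [InnerProductSpace ℂ V] [CompleteSpace V]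
  [NormedAddCommGroup E] [InnerProductSpace ℂ E] [CompleteSpace E]

/-- The graph of the operator of the form `⟨U, T U⟩`, whose form domain `V` is mapped into `E`
by `J`. -/
def formGraph (J : V →L[ℂ] E) (T : V →L[ℂ] V) : Submodule ℂ (E × E) where
  carrier := {p | ∃ U, J U = p.1 ∧ ∀ W, inner ℂ W (T U) = inner ℂ (J W) p.2}
  add_mem' := by
    rintro p q ⟨U, hU, hU'⟩ ⟨U2, hU2, hU2'⟩
    refine ⟨U + U2, by simp [hU, hU2], fun W => ?_⟩
    simp [hU', hU2']
  zero_mem' := ⟨0, by simp⟩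
  smul_mem' := by
    rintro c p ⟨U, hU, hTU⟩
    refine ⟨c • U, by simp [hU], fun W => ?_⟩
    simp [hTU]

/-- The operator of the form `⟨U, T U⟩`. -/
def formOp (J : V →L[ℂ] E) (T : V →L[ℂ] V) : E →ₗ.[ℂ] E := (formGraph J T).toLinearPMap

variable {J : V →L[ℂ] E} {T : V →L[ℂ] V}

/-- The relation is single valued: if `J U = 0`, injectivity gives `U = 0`, so the associated `f` is
orthogonal to the dense range of `J`. -/
theorem graph_formOp (hJ : Function.Injective J) (hd : DenseRange J) :
    (formOp J T).graph = formGraph J T := by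
  apply Submodule.toLinearPMap_graph_eq
  rintro ⟨x, f⟩ ⟨U, hU, hU'⟩ hx
  simp only at hU hU' hx ⊢
  have hU0 : U = 0 := hJ (by rw [hU, hx, map_zero])
  subst hU0
  have : ∀ v : E, inner ℂ v f = 0 := by
    intro v
    have hc : IsClosed {v : E | inner ℂ v f = 0} :=
      isClosed_eq (continuous_id.inner continuous_const) continuous_const
    exact hd.induction_on v hc fun W => by rw [← hU']; simp
  exact inner_self_eq_zero.1 (this f)

theorem mem_graph_formOp (hJ : Function.Injective J) (hd : DenseRange J) {x f : E} :
    (x, f) ∈ (formOp J T).graph ↔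
      ∃ U, J U = x ∧ ∀ W, inner ℂ W (T U) = inner ℂ (J W) f := by
  rw [graph_formOp hJ hd]; rfl

theorem exists_of_formOp (hJ : Function.Injective J) (hd : DenseRange J)
    (u : (formOp J T).domain) :
    ∃ U, J U = u ∧ ∀ W, inner ℂ W (T U) = inner ℂ (J W) (formOp J T u) :=
  (mem_graph_formOp hJ hd).1 ((formOp J T).mem_graph u)

/-- Lax–Milgram. -/
theorem exists_eq_of_coercive {S : V →L[ℂ] V} {δ : ℝ} (hδ : 0 < δ)
    (hc : ∀ U, δ * ‖U‖ ^ 2 ≤ (inner ℂ U (S U)).re) (W : V) : ∃ U, S U = W := by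
  have hb : ∀ U, δ * ‖U‖ ≤ ‖S U‖ := by
    intro U
    have h1 := hc U
    have h2 := (Complex.re_le_norm _).trans (norm_inner_le_norm (𝕜 := ℂ) U (S U))
    rcases eq_or_lt_of_le (norm_nonneg U) with h | h
    · rw [← h]; simp
    · nlinarith
  have hanti : AntilipschitzWith (δ⁻¹).toNNReal S := by
    refine ContinuousLinearMap.antilipschitz_of_bound S fun U => ?_
    rw [Real.coe_toNNReal _ (by positivity), inv_mul_eq_div, le_div_iff₀ hδ, mul_comm]
    exact hb U
  have hclosed : IsClosed (S.range : Set V) := hanti.isClosed_range S.uniformContinuous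
  have htop : S.range = ⊤ := by
    have : CompleteSpace S.range := hclosed.completeSpace_coe
    rw [← Submodule.orthogonal_eq_bot_iff, Submodule.eq_bot_iff]
    intro w hw
    have h := (Submodule.mem_orthogonal' _ w).1 hw (S w) ⟨w, rfl⟩
    have h2 := hc w
    rw [h] at h2
    have : ‖w‖ ^ 2 ≤ 0 := by
      by_contra hcon
      push Not at hcon
      have := mul_pos hδ hcon
      simp at h2
      linarith
    simpa using this
  exact LinearMap.range_eq_top.1 htop W

variable {δ c : ℝ}

/-- The operator `T + c J*J` is coercive on `V`; Lax–Milgram solves the equation with right-hand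
side `J* f`. -/
theorem exists_formOp_resolvent (hδ : 0 < δ)
    (hc : ∀ U, δ * ‖U‖ ^ 2 ≤ (inner ℂ U (T U)).re + c * ‖J U‖ ^ 2) (f : E) :
    ∃ U, ∀ W, inner ℂ W (T U) + c * inner ℂ (J W) (J U) = inner ℂ (J W) f := by
  let S : V →L[ℂ] V := T + (c : ℂ) • (J.adjoint ∘L J)
  have hin : ∀ W U, inner ℂ W (S U) = inner ℂ W (T U) + c * inner ℂ (J W) (J U) := by
    intro W U
    simp [S, ContinuousLinearMap.adjoint_inner_right]
  obtain ⟨U, hU⟩ := exists_eq_of_coercive hδ (fun U => by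
    rw [hin, inner_self_eq_norm_sq_to_K, Complex.add_re]
    refine (hc U).trans (le_of_eq ?_)
    congr 1
    simp only [Complex.coe_algebraMap]
    rw [← Complex.ofReal_pow, ← Complex.ofReal_mul, Complex.ofReal_re]) (J.adjoint f)
  refine ⟨U, fun W => ?_⟩
  rw [← hin, hU, ContinuousLinearMap.adjoint_inner_right]

/-- `H` is symmetric and `H + c` is onto. For `w` in the domain of the adjoint, solve `(H + c) u =
(H* + c) w`; then `w - u` is orthogonal to the range of `H + c`, hence zero. -/
theorem isSelfAdjoint_formOp (hJ : Function.Injective J) (hd : DenseRange J)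
    (hT : IsSelfAdjoint T) (hδ : 0 < δ)
    (hc : ∀ U, δ * ‖U‖ ^ 2 ≤ (inner ℂ U (T U)).re + c * ‖J U‖ ^ 2) :
    IsSelfAdjoint (formOp J T) := by
  set H := formOp J T with hH
  have hTsymm : ∀ U W, inner ℂ (T U) W = inner ℂ U (T W) := fun U W =>
    (ContinuousLinearMap.isSelfAdjoint_iff_isSymmetric.1 hT) U W
  have hsurj : ∀ f : E, ∃ u : H.domain, H u + (c : ℂ) • (u : E) = f := by
    intro f
    obtain ⟨U, hU⟩ := exists_formOp_resolvent (J := J) hδ hc f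
    have : (J U, f - (c : ℂ) • J U) ∈ H.graph := by
      rw [mem_graph_formOp hJ hd]
      refine ⟨U, rfl, fun W => ?_⟩
      rw [inner_sub_right, inner_smul_right, ← hU]; ring
    rw [LinearPMap.mem_graph_iff] at this
    obtain ⟨u, hu, hu2⟩ := this
    exact ⟨u, by rw [hu2, hu]; simp⟩
  have hsym : ∀ u v : H.domain, inner ℂ (H u) (v : E) = inner ℂ (u : E) (H v) := by
    intro u v
    obtain ⟨U, hU, hU'⟩ := exists_of_formOp hJ hd u
    obtain ⟨W, hW, hW'⟩ := exists_of_formOp hJ hd v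
    rw [← hU, ← hW', ← hW, ← inner_conj_symm, ← hU', inner_conj_symm, hTsymm]
  -- A vector `g` orthogonal to the domain equals `(H + c) u`; pairing it with `u` makes the
  -- coercive form vanish at `u`.
  have hdense : Dense (H.domain : Set E) := by
    rw [Submodule.dense_iff_topologicalClosure_eq_top,
      Submodule.topologicalClosure_eq_top_iff, Submodule.eq_bot_iff]
    intro g hg
    obtain ⟨u, hu⟩ := hsurj g
    obtain ⟨U, hU, hU'⟩ := exists_of_formOp hJ hd u
    have h0 := (Submodule.mem_orthogonal _ g).1 hg u u.2
    rw [← hu, inner_add_right, inner_smul_right, ← hU, ← hU', inner_self_eq_norm_sq_to_K] at h0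
    have h1 := congrArg Complex.re h0
    simp only [Complex.coe_algebraMap] at h1
    rw [Complex.add_re, ← Complex.ofReal_pow, ← Complex.ofReal_mul, Complex.ofReal_re] at h1
    have h2 := hc U
    rw [h1] at h2
    have h3 : ‖U‖ ^ 2 ≤ 0 := by
      by_contra hcon
      push Not at hcon
      have := mul_pos hδ hcon
      simp at h2
      linarith
    have hU0 : U = 0 := by simpa using h3
    have hu0 : u = 0 := by
      rw [hU0, map_zero] at hU
      exact Subtype.ext hU.symm
    rw [← hu, hu0]; simp
  rw [LinearPMap.isSelfAdjoint_def]
  have hle : H ≤ H.adjoint := LinearPMap.IsFormalAdjoint.le_adjoint hdense hsym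
  refine (LinearPMap.eq_of_le_of_domain_eq hle (le_antisymm hle.1 ?_)).symm
  intro w hw
  obtain ⟨u, hu⟩ := hsurj (H.adjoint ⟨w, hw⟩ + (c : ℂ) • w)
  suffices w = u by rw [this]; exact u.2
  obtain ⟨v, hv⟩ := hsurj (w - u)
  have h1 := H.adjoint_isFormalAdjoint hdense ⟨w, hw⟩ v
  have h2 := hsym u v
  have h3 : inner ℂ (w - u) (H v + (c : ℂ) • (v : E)) = 0 := by
    simp only at h1
    rw [inner_add_right, inner_smul_right, inner_sub_left, inner_sub_left, ← h1, ← h2]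
    have h4 : H.adjoint ⟨w, hw⟩ = H u + (c : ℂ) • (u : E) - (c : ℂ) • w := by rw [hu]; simp
    rw [h4, inner_sub_left, inner_add_left, inner_smul_left, inner_smul_left]
    simp only [Complex.conj_ofReal]
    ring
  rw [hv, inner_self_eq_zero, sub_eq_zero] at h3
  exact h3

end Form

/-! ### Lower bounds up to finite rank exclude essential spectrum -/

section Weyl

variable {E : Type*} [NormedAddCommGroup E] [InnerProductSpace ℂ E] [CompleteSpace E]

theorem mem_eigenspace_iff {T : E →ₗ.[ℂ] E} {z : ℂ} {u : T.domain} :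
    u ∈ eigenspace T z ↔ T u = z • (u : E) := by
  unfold eigenspace
  rw [LinearMap.mem_ker, LinearMap.sub_apply, sub_eq_zero]
  rfl

/-- If `T ≥ μ > l` up to a form of finite rank, then `T - l` is bounded below on the orthogonal
complement of its kernel. -/
theorem exists_bounded_below_of_finiteRank {T : E →ₗ.[ℂ] E} (hT : IsSelfAdjoint T) {l μ : ℝ}
    (hl : l < μ) {n : ℕ} (e : Fin n → E)
    (h : ∀ u : T.domain, μ * ‖(u : E)‖ ^ 2 ≤ (inner ℂ (u : E) (T u)).re +
      ∑ j, ‖(inner ℂ (e j) (u : E) : ℂ)‖ ^ 2) :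
    ∃ δ > 0, ∀ u : T.domain, (∀ w ∈ eigenspace T l, inner ℂ (w : E) (u : E) = 0) →
      δ * ‖(u : E)‖ ≤ ‖T u - (l : ℂ) • (u : E)‖ := by
  have key : ∀ u : T.domain, (μ - l) * ‖(u : E)‖ ^ 2 ≤
      ‖(u : E)‖ * ‖T u - (l : ℂ) • (u : E)‖ + ∑ j, ‖(inner ℂ (e j) (u : E) : ℂ)‖ ^ 2 := by
    intro u
    have h1 := h u
    have h2 := (Complex.re_le_norm _).trans
      (norm_inner_le_norm (𝕜 := ℂ) (u : E) (T u - (l : ℂ) • (u : E)))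
    rw [inner_sub_right, inner_smul_right, inner_self_eq_norm_sq_to_K, Complex.sub_re] at h2
    simp only [Complex.coe_algebraMap] at h2
    rw [← Complex.ofReal_pow, ← Complex.ofReal_mul, Complex.ofReal_re] at h2
    linarith
  by_contra hcon
  push Not at hcon
  -- If no `δ` works, there are unit vectors orthogonal to the kernel on which `T - l` tends to
  -- zero. A limit of a subsequence will be a unit vector both in the kernel and orthogonal to it.
  have hex : ∀ k : ℕ, ∃ u : T.domain, (∀ w ∈ eigenspace T l, inner ℂ (w : E) (u : E) = 0) ∧
      ‖(u : E)‖ = 1 ∧ ‖T u - (l : ℂ) • (u : E)‖ ≤ 1 / ((k : ℝ) + 1) := by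
    intro k
    obtain ⟨u, hu1, hu2⟩ := hcon (1 / ((k : ℝ) + 1)) (by positivity)
    have hu0 : ‖(u : E)‖ ≠ 0 := by
      intro h0
      rw [h0, mul_zero] at hu2
      exact absurd hu2 (not_lt.2 (norm_nonneg _))
    have hpos : 0 < ‖(u : E)‖ := lt_of_le_of_ne (norm_nonneg _) (Ne.symm hu0)
    refine ⟨((‖(u : E)‖⁻¹ : ℝ) : ℂ) • u, fun w hw => ?_, ?_, ?_⟩
    · rw [Submodule.coe_smul, inner_smul_right, hu1 w hw, mul_zero]
    · rw [Submodule.coe_smul, norm_smul, Complex.norm_real, norm_inv, norm_norm,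
        inv_mul_cancel₀ hu0]
    · rw [LinearPMap.map_smul, Submodule.coe_smul, smul_comm, ← smul_sub, norm_smul,
        Complex.norm_real, norm_inv, norm_norm, inv_mul_eq_div, div_le_iff₀ hpos]
      exact hu2.le
  choose u hu1 hu2 hu3 using hex
  -- Compactness enters only through these finitely many coefficients: along a subsequence they
  -- converge, and `key` applied to differences makes the vectors Cauchy.
  let c : ℕ → Fin n → ℂ := fun k j => inner ℂ (e j) (u k : E)
  have hcb : ∀ k, c k ∈ Metric.closedBall (0 : Fin n → ℂ) (∑ j, ‖e j‖) := by
    intro k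
    rw [mem_closedBall_zero_iff, pi_norm_le_iff_of_nonneg (by positivity)]
    intro j
    refine (norm_inner_le_norm _ _).trans ?_
    rw [hu2, mul_one]
    exact Finset.single_le_sum (f := fun j => ‖e j‖) (fun i _ => norm_nonneg _) (Finset.mem_univ j)
  obtain ⟨c0, -, θ, hθ, hlim⟩ := (isCompact_closedBall _ _).tendsto_subseq hcb
  have hcomp : Tendsto (fun k => T (u (θ k)) - (l : ℂ) • (u (θ k) : E)) atTop (𝓝 0) := by
    have : Tendsto (fun k => T (u k) - (l : ℂ) • (u k : E)) atTop (𝓝 0) :=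
      squeeze_zero_norm hu3 tendsto_one_div_add_atTop_nhds_zero_nat
    exact this.comp hθ.tendsto_atTop
  have hcau : CauchySeq fun k => (u (θ k) : E) := by
    rw [Metric.cauchySeq_iff']
    intro ε hε
    have hη : 0 < (μ - l) * ε ^ 2 := mul_pos (sub_pos.2 hl) (by positivity)
    -- Write `η = (μ - l) ε²`. Differences of unit vectors have norm at most 2, so the two errors `η
    -- / 8` contribute at most `η / 2`, and the coefficients less than `η / 4`.
    obtain ⟨N1, hN1⟩ := Metric.tendsto_atTop.1 hcomp ((μ - l) * ε ^ 2 / 8) (by positivity)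
    have hsum : Tendsto (fun p : ℕ × ℕ => ∑ j, ‖c (θ p.1) j - c (θ p.2) j‖ ^ 2) (atTop ×ˢ atTop)
        (𝓝 (∑ j, ‖c0 j - c0 j‖ ^ 2)) := by
      refine tendsto_finsetSum _ fun j _ => ?_
      have hj := (tendsto_pi_nhds.1 hlim j)
      exact (((hj.comp tendsto_fst).sub (hj.comp tendsto_snd)).norm).pow 2
    simp only [sub_self, norm_zero, ne_eq, OfNat.ofNat_ne_zero, not_false_eq_true, zero_pow,
      Finset.sum_const_zero] at hsum
    have hev := hsum.eventually (gt_mem_nhds (show 0 < (μ - l) * ε ^ 2 / 4 by positivity))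
    rw [prod_atTop_atTop_eq] at hev
    obtain ⟨⟨a1, a2⟩, hN2⟩ := eventually_atTop.1 hev
    refine ⟨max N1 (max a1 a2), fun k hk => ?_⟩
    set N := max N1 (max a1 a2) with hN
    have hd := key (u (θ k) - u (θ N))
    have h1 := hN1 k (le_trans (le_max_left _ _) hk)
    have h2 := hN1 N (le_max_left _ _)
    have h3 := hN2 (k, N) ⟨(le_max_left a1 a2).trans ((le_max_right _ _).trans hk),
      (le_max_right a1 a2).trans (le_max_right _ _)⟩
    rw [dist_zero_right] at h1 h2
    have h4 : T (u (θ k) - u (θ N)) - (l : ℂ) • ((u (θ k) - u (θ N) : T.domain) : E) =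
        (T (u (θ k)) - (l : ℂ) • (u (θ k) : E)) - (T (u (θ N)) - (l : ℂ) • (u (θ N) : E)) := by
      rw [LinearPMap.map_sub, Submodule.coe_sub, smul_sub]; abel
    rw [h4] at hd
    have h5 := norm_sub_le (T (u (θ k)) - (l : ℂ) • (u (θ k) : E))
      (T (u (θ N)) - (l : ℂ) • (u (θ N) : E))
    have h6 : ‖((u (θ k) - u (θ N) : T.domain) : E)‖ ≤ 2 := by
      rw [Submodule.coe_sub]
      refine (norm_sub_le _ _).trans ?_
      rw [hu2, hu2]; norm_num
    have h7 : ∀ j, (inner ℂ (e j) ((u (θ k) - u (θ N) : T.domain) : E) : ℂ) =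
        c (θ k) j - c (θ N) j := by
      intro j
      rw [Submodule.coe_sub, inner_sub_right]
    simp only [h7] at hd
    rw [dist_eq_norm, ← Submodule.coe_sub]
    have h8 : (μ - l) * ‖((u (θ k) - u (θ N) : T.domain) : E)‖ ^ 2 < (μ - l) * ε ^ 2 := by
      have h9 := mul_le_mul h6 h5 (norm_nonneg _) (by norm_num)
      simp only at h3
      linarith
    exact lt_of_pow_lt_pow_left₀ 2 hε.le (lt_of_mul_lt_mul_left h8 (sub_pos.2 hl).le)
  obtain ⟨u0, hu0⟩ := cauchySeq_tendsto_of_complete hcau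
  have hTu : Tendsto (fun k => T (u (θ k))) atTop (𝓝 ((l : ℂ) • u0)) := by
    have := hcomp.add (hu0.const_smul (l : ℂ))
    simpa using this
  have hg : (u0, (l : ℂ) • u0) ∈ T.graph :=
    hT.isClosed.isSeqClosed (x := fun k => ((u (θ k) : E), T (u (θ k))))
      (fun k => T.mem_graph (u (θ k))) (hu0.prodMk_nhds hTu)
  rw [LinearPMap.mem_graph_iff] at hg
  obtain ⟨v, hv, hv2⟩ := hg
  simp only at hv hv2
  have hve : v ∈ eigenspace T l := by rw [mem_eigenspace_iff, hv2, hv]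
  have hnorm : ‖u0‖ = 1 := by
    have := hu0.norm
    simp only [hu2] at this
    exact tendsto_nhds_unique this tendsto_const_nhds
  have horth : inner ℂ (v : E) u0 = 0 := by
    have h1 := (tendsto_const_nhds (x := (v : E)) (f := atTop (α := ℕ))).inner (𝕜 := ℂ) hu0
    simp only [hu1 _ v hve] at h1
    exact tendsto_nhds_unique h1 tendsto_const_nhds
  rw [hv, inner_self_eq_zero] at horth
  rw [horth, norm_zero] at hnorm
  exact zero_ne_one hnorm

/-- On the eigenspace the bound reads `(μ - l) ‖u‖² ≤ ∑ ‖⟨e j, u⟩‖²`, so the `n` coefficients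
determine `u`. -/
theorem finiteDimensional_eigenspace_of_finiteRank {T : E →ₗ.[ℂ] E} {l μ : ℝ}
    (hl : l < μ) {n : ℕ} (e : Fin n → E)
    (h : ∀ u : T.domain, μ * ‖(u : E)‖ ^ 2 ≤ (inner ℂ (u : E) (T u)).re +
      ∑ j, ‖(inner ℂ (e j) (u : E) : ℂ)‖ ^ 2) :
    FiniteDimensional ℂ (eigenspace T l) := by
  let f : eigenspace T l →ₗ[ℂ] (Fin n → ℂ) :=
    LinearMap.pi fun j => (innerSL ℂ (e j)).toLinearMap ∘ₗ T.domain.subtype ∘ₗ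
      (eigenspace T l).subtype
  have hf : ∀ u j, f u j = inner ℂ (e j) ((u : T.domain) : E) := fun u j => rfl
  refine FiniteDimensional.of_injective f ?_
  rw [injective_iff_map_eq_zero]
  intro u hu
  have h1 := h u
  have h2 := mem_eigenspace_iff.1 u.2
  rw [h2, inner_smul_right, inner_self_eq_norm_sq_to_K] at h1
  simp only [Complex.coe_algebraMap, ← hf, hu] at h1
  rw [← Complex.ofReal_pow, ← Complex.ofReal_mul, Complex.ofReal_re] at h1
  simp at h1
  have h3 : ‖((u : T.domain) : E)‖ ^ 2 ≤ 0 := by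
    by_contra hcon
    push Not at hcon
    nlinarith
  have h4 : ((u : T.domain) : E) = 0 := by simpa using h3
  exact Subtype.ext (Subtype.ext h4)

/-- A self-adjoint operator bounded below by `μ` up to a form of finite rank has no essential
spectrum below `μ`. -/
theorem notMem_essentialSpectrum_of_finiteRank {T : E →ₗ.[ℂ] E} (hT : IsSelfAdjoint T) {l μ : ℝ}
    (hl : l < μ) {n : ℕ} (e : Fin n → E)
    (h : ∀ u : T.domain, μ * ‖(u : E)‖ ^ 2 ≤ (inner ℂ (u : E) (T u)).re +
      ∑ j, ‖(inner ℂ (e j) (u : E) : ℂ)‖ ^ 2) :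
    (l : ℂ) ∉ essentialSpectrum T := by
  obtain ⟨δ, hδ, hb⟩ := exists_bounded_below_of_finiteRank hT hl e h
  have hfin := finiteDimensional_eigenspace_of_finiteRank hl e h
  rintro ⟨hsp, hnd⟩
  apply hnd
  -- With a trivial kernel the bound holds on the whole domain, and `l` would be in the resolvent
  -- set.
  have hne : eigenspace T l ≠ ⊥ := by
    intro hbot
    apply hsp
    refine mem_resolventSet_of_bounded_below hT hδ (fun u => hb u ?_) fun u hu => ?_
    · rw [hbot]
      intro w hw
      rw [(Submodule.mem_bot ℂ).1 hw]
      simp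
    · rw [Complex.conj_ofReal] at hu
      have : u ∈ eigenspace T l := mem_eigenspace_iff.2 hu
      rw [hbot, Submodule.mem_bot] at this
      rw [this]; rfl
  refine ⟨⟨Metric.ball (l : ℂ) δ, Metric.ball_mem_nhds _ hδ, ?_⟩, hne, hfin⟩
  refine Subset.antisymm ?_ (by
    rw [singleton_subset_iff]; exact ⟨Metric.mem_ball_self hδ, hsp⟩)
  rintro z ⟨hz, hzs⟩
  by_contra hzl
  rw [mem_singleton_iff] at hzl
  apply hzs
  by_cases him : z.im = 0
  swap
  · exact mem_resolventSet_of_im_ne_zero hT him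
  have hd : 0 < ‖z - l‖ := norm_pos_iff.2 (sub_ne_zero.2 hzl)
  have hd2 : ‖z - l‖ < δ := by rwa [Metric.mem_ball, dist_eq_norm] at hz
  have hconj : conj z = z := Complex.conj_eq_iff_im.2 him
  set N : Submodule ℂ E := (eigenspace T l).map T.domain.subtype with hN
  have : FiniteDimensional ℂ N := by rw [hN]; infer_instance
  -- Split `u` into its projection `w` on the kernel of `T - l` and the rest `v`. On `w` the
  -- operator `T - z` is multiplication by `l - z`; on `v` it is bounded below by `δ - ‖z - l‖`; the
  -- two images are orthogonal.
  have hcb : ∀ u : T.domain, min ‖z - l‖ (δ - ‖z - l‖) * ‖(u : E)‖ ≤ ‖T u - z • (u : E)‖ := by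
    intro u
    obtain ⟨w, hw, hwu⟩ : ∃ w ∈ eigenspace T l, (w : E) = N.starProjection (u : E) := by
      have := N.starProjection_apply_mem (u : E)
      obtain ⟨w, hw, hw2⟩ := this
      exact ⟨w, hw, hw2⟩
    set v : T.domain := u - w with hv
    have hvo : ∀ w' ∈ eigenspace T l, inner ℂ (w' : E) (v : E) = 0 := by
      intro w' hw'
      have := N.sub_starProjection_mem_orthogonal (u : E)
      rw [hv, Submodule.coe_sub, hwu]
      exact (Submodule.mem_orthogonal _ _).1 this w' ⟨w', hw', rfl⟩
    have hu : u = w + v := by rw [hv]; abel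
    have hTw := mem_eigenspace_iff.1 hw
    have hTv := hb v hvo
    have hdec : T u - z • (u : E) = (l - z) • (w : E) + (T v - z • (v : E)) := by
      rw [hu, LinearPMap.map_add, hTw, Submodule.coe_add, smul_add, sub_smul]; abel
    have horth2 : inner ℂ (w : E) (T v - z • (v : E)) = 0 := by
      rw [inner_sub_right, inner_smul_right, hvo w hw, ← hT.linearPMap_inner_apply, hTw,
        inner_smul_left, hvo w hw]; simp
    have hn1 : ‖T u - z • (u : E)‖ ^ 2 = (‖z - l‖ * ‖(w : E)‖) ^ 2 + ‖T v - z • (v : E)‖ ^ 2 := by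
      rw [hdec, sq, norm_add_sq_eq_norm_sq_add_norm_sq_of_inner_eq_zero (𝕜 := ℂ)]
      · rw [norm_smul, norm_sub_rev]; ring
      · rw [inner_smul_left, horth2, mul_zero]
    have hn2 : ‖(u : E)‖ ^ 2 = ‖(w : E)‖ ^ 2 + ‖(v : E)‖ ^ 2 := by
      rw [hu, Submodule.coe_add, sq,
        norm_add_sq_eq_norm_sq_add_norm_sq_of_inner_eq_zero (𝕜 := ℂ) _ _ (hvo w hw)]
      ring
    have hv3 : (δ - ‖z - l‖) * ‖(v : E)‖ ≤ ‖T v - z • (v : E)‖ := by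
      have h1 : T v - (l : ℂ) • (v : E) = (T v - z • (v : E)) + (z - l) • (v : E) := by
        rw [sub_smul]; abel
      have h2 := norm_add_le (T v - z • (v : E)) ((z - l) • (v : E))
      rw [← h1, norm_smul] at h2
      linarith
    set m := min ‖z - l‖ (δ - ‖z - l‖) with hm
    have hm0 : 0 ≤ m := le_min hd.le (by linarith)
    refine le_of_sq_le_sq ?_ (norm_nonneg _)
    rw [hn1, mul_pow, hn2, mul_add, ← mul_pow, ← mul_pow]
    refine add_le_add (pow_le_pow_left₀ (by positivity) ?_ 2) (pow_le_pow_left₀ (by positivity) ?_ 2)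
    · exact mul_le_mul_of_nonneg_right (min_le_left _ _) (norm_nonneg _)
    · exact (mul_le_mul_of_nonneg_right (min_le_right _ _) (norm_nonneg _)).trans hv3
  have hm : 0 < min ‖z - l‖ (δ - ‖z - l‖) := lt_min hd (by linarith)
  refine mem_resolventSet_of_bounded_below hT hm hcb fun u hu => ?_
  have h1 := hcb u
  rw [hu, hconj, sub_self, norm_zero] at h1
  have h3 : ‖(u : E)‖ ≤ 0 := by
    by_contra hcon
    push Not at hcon
    nlinarith
  simpa using h3

end Weyl

/-! ### Quasi-modes and the essential spectrum of a form -/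

section Form

variable {V E : Type*} [NormedAddCommGroup V] [InnerProductSpace ℂ V] [CompleteSpace V]
  [NormedAddCommGroup E] [InnerProductSpace ℂ E] [CompleteSpace E]
  {J : V →L[ℂ] E} {T : V →L[ℂ] V} {δ c : ℝ}

/-- A real number with quasi-modes in the sense of the form lies in the spectrum. -/
theorem mem_spectrum_formOp (hJ : Function.Injective J) (hd : DenseRange J)
    (hT : IsSelfAdjoint T) (hδ : 0 < δ)
    (hc : ∀ U, δ * ‖U‖ ^ 2 ≤ (inner ℂ U (T U)).re + c * ‖J U‖ ^ 2) {l : ℝ}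
    (hq : ∀ ε > 0, ∃ U, 0 < ‖J U‖ ∧ ∀ W,
      ‖(inner ℂ W (T U) - l * inner ℂ (J W) (J U) : ℂ)‖ ≤ ε * ‖W‖ * ‖J U‖) :
    (l : ℂ) ∈ spectrum (formOp J T) := by
  rintro ⟨R, hR, -⟩
  set K : ℝ := ‖R‖ + (|l| + |c|) * ‖R‖ ^ 2 with hK
  have hK0 : 0 ≤ K := by positivity
  -- A bounded resolvent on `E` is also bounded into the form domain: coercivity estimates the
  -- `V`-norm of the solution by `‖f‖`. This is what makes quasi-modes in the weak sense of the form
  -- sufficient.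
  have hbound : ∀ f : E, ∃ W, J W = R f ∧ (∀ U, inner ℂ W (T U) - l * inner ℂ (J W) (J U) =
      inner ℂ f (J U)) ∧ δ * ‖W‖ ^ 2 ≤ K * ‖f‖ ^ 2 := by
    intro f
    obtain ⟨h, hf⟩ := hR f
    obtain ⟨W, hW, hW'⟩ := exists_of_formOp hJ hd ⟨R f, h⟩
    have hHW : formOp J T ⟨R f, h⟩ = f + (l : ℂ) • R f :=
      sub_eq_iff_eq_add.1 hf
    simp only at hW
    rw [hHW] at hW'
    refine ⟨W, hW, fun U => ?_, ?_⟩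
    · have h1 := hW' U
      have h2 : inner ℂ W (T U) = conj (inner ℂ U (T W)) := by
        rw [inner_conj_symm]
        exact ((ContinuousLinearMap.isSelfAdjoint_iff_isSymmetric.1 hT) W U).symm
      rw [h2, h1, inner_add_right, inner_smul_right, map_add, map_mul, inner_conj_symm,
        inner_conj_symm, hW, Complex.conj_ofReal]
      ring
    · refine (hc W).trans ?_
      rw [hW', hW, inner_add_right, inner_smul_right, inner_self_eq_norm_sq_to_K, Complex.add_re]
      simp only [Complex.coe_algebraMap]
      rw [← Complex.ofReal_pow, ← Complex.ofReal_mul, Complex.ofReal_re]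
      have h1 := (Complex.re_le_norm _).trans (norm_inner_le_norm (𝕜 := ℂ) (R f) f)
      have h2 := R.le_opNorm f
      have h3 : ‖R f‖ * ‖f‖ ≤ ‖R‖ * ‖f‖ ^ 2 := by
        nlinarith [norm_nonneg f]
      have h4 : ‖R f‖ ^ 2 ≤ ‖R‖ ^ 2 * ‖f‖ ^ 2 := by
        rw [← mul_pow]; exact pow_le_pow_left₀ (norm_nonneg _) h2 2
      have h5 : l * ‖R f‖ ^ 2 ≤ |l| * (‖R‖ ^ 2 * ‖f‖ ^ 2) :=
        mul_le_mul (le_abs_self _) h4 (by positivity) (abs_nonneg _)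
      have h6 : c * ‖R f‖ ^ 2 ≤ |c| * (‖R‖ ^ 2 * ‖f‖ ^ 2) :=
        mul_le_mul (le_abs_self _) h4 (by positivity) (abs_nonneg _)
      rw [hK]
      linarith
  -- For the solution `W` with right-hand side `J U`, the quasi-mode estimate gives `‖J U‖ ≤ ε ‖W‖`,
  -- while `δ ‖W‖² ≤ K ‖J U‖²`. The choice `ε² = δ / (4 (K + 1))` makes the two contradict each
  -- other.
  set ε : ℝ := Real.sqrt (δ / (K + 1)) / 2 with hε
  have hε0 : 0 < ε := by positivity
  obtain ⟨U, hU, hUq⟩ := hq ε hε0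
  obtain ⟨W, hW, hW1, hW2⟩ := hbound (J U)
  have h1 := hUq W
  rw [hW1 U, inner_self_eq_norm_sq_to_K, norm_pow] at h1
  simp only [Complex.coe_algebraMap, Complex.norm_real, norm_norm] at h1
  have h2 : ‖J U‖ ≤ ε * ‖W‖ := by
    have : ‖J U‖ * ‖J U‖ ≤ ε * ‖W‖ * ‖J U‖ := by rw [← sq]; exact h1
    exact le_of_mul_le_mul_right this hU
  have h3 : ‖J U‖ ^ 2 ≤ ε ^ 2 * ‖W‖ ^ 2 := by
    rw [← mul_pow]; exact pow_le_pow_left₀ (norm_nonneg _) h2 2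
  have h4 : ε ^ 2 = δ / (K + 1) / 4 := by
    rw [hε, div_pow, Real.sq_sqrt (by positivity)]; norm_num
  have h5 : ε ^ 2 * ‖W‖ ^ 2 * (4 * (K + 1)) = δ * ‖W‖ ^ 2 := by
    rw [h4]; field_simp
  have h6 : 0 < ‖J U‖ ^ 2 := by positivity
  nlinarith

/-- The whole half-line consists of spectrum, so none of its points is isolated and multiplicities
need not be examined. Below `l₀` the finite rank criterion applies with some `μ` strictly between.
-/
theorem essentialSpectrum_formOp (hJ : Function.Injective J) (hd : DenseRange J)
    (hT : IsSelfAdjoint T) (hδ : 0 < δ)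
    (hc : ∀ U, δ * ‖U‖ ^ 2 ≤ (inner ℂ U (T U)).re + c * ‖J U‖ ^ 2) {l₀ : ℝ}
    (hlow : ∀ μ < l₀, ∃ (n : ℕ) (e : Fin n → E), ∀ U, μ * ‖J U‖ ^ 2 ≤ (inner ℂ U (T U)).re +
      ∑ j, ‖(inner ℂ (e j) (J U) : ℂ)‖ ^ 2)
    (hq : ∀ l : ℝ, l₀ ≤ l → ∀ ε > 0, ∃ U, 0 < ‖J U‖ ∧ ∀ W,
      ‖(inner ℂ W (T U) - l * inner ℂ (J W) (J U) : ℂ)‖ ≤ ε * ‖W‖ * ‖J U‖) :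
    essentialSpectrum (formOp J T) = (fun s : ℝ => (s : ℂ)) '' Ici l₀ := by
  have hsa := isSelfAdjoint_formOp hJ hd hT hδ hc
  have hspec : ∀ l : ℝ, l₀ ≤ l → (l : ℂ) ∈ spectrum (formOp J T) := fun l hl =>
    mem_spectrum_formOp hJ hd hT hδ hc (hq l hl)
  apply Subset.antisymm
  · intro z hz
    have him : z.im = 0 := by
      by_contra him
      exact hz.1 (mem_resolventSet_of_im_ne_zero hsa him)
    have hzr : z = (z.re : ℂ) := Complex.ext rfl (by simpa using him)
    refine ⟨z.re, ?_, hzr.symm⟩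
    by_contra hlt
    rw [mem_Ici, not_le] at hlt
    obtain ⟨μ, hμ1, hμ2⟩ := exists_between hlt
    obtain ⟨n, e, he⟩ := hlow μ hμ2
    rw [hzr] at hz
    refine notMem_essentialSpectrum_of_finiteRank hsa hμ1 e (fun u => ?_) hz
    obtain ⟨U, hU, hU'⟩ := exists_of_formOp hJ hd u
    rw [← hU, ← hU']
    exact he U
  · rintro _ ⟨l, hl, rfl⟩
    refine ⟨hspec l hl, fun ⟨⟨N, hN, hNs⟩, _⟩ => ?_⟩
    obtain ⟨r, hr, hrN⟩ := Metric.mem_nhds_iff.1 hN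
    have hmem : ((l + r / 2 : ℝ) : ℂ) ∈ N ∩ spectrum (formOp J T) := by
      refine ⟨hrN ?_, hspec _ ((mem_Ici.1 hl).trans (by linarith))⟩
      rw [Metric.mem_ball, Complex.dist_of_im_eq (by simp)]
      simp only [Complex.ofReal_re]
      rw [Real.dist_eq, add_sub_cancel_left, abs_of_pos (by positivity)]
      linarith
    rw [hNs, mem_singleton_iff, Complex.ofReal_inj] at hmem
    linarith

end Form

/-! ### Mollification in L² -/

section Mollification

open scoped Convolution ENNReal

variable {F : Type*} [NormedAddCommGroup F]

theorem eLpNorm_two_sq {X : Type*} {m : MeasurableSpace X} (μ : Measure X) (f : X → F) :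
    eLpNorm f 2 μ ^ 2 = ∫⁻ x, ‖f x‖ₑ ^ 2 ∂μ := by
  have := eLpNorm_nnreal_pow_eq_lintegral (μ := μ) (f := f) (p := 2) (by norm_num)
  simpa using this

/-- Translations preserve the measure and depend continuously on the shift, and composition with
such maps is continuous in L². -/
theorem tendsto_eLpNorm_translate {w : Plane → F} (hw : MemLp w 2 volume) :
    Tendsto (fun z : Plane => eLpNorm (fun p => w (p - z) - w p) 2 volume) (𝓝 0) (𝓝 0) := by
  let g : Plane → C(Plane, Plane) := fun z => ⟨fun p => p - z, by fun_prop⟩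
  have hg : Continuous g := ContinuousMap.continuous_of_continuous_uncurry _
    (by simp only [g, Function.uncurry_def, ContinuousMap.coe_mk]; fun_prop)
  have hgm : ∀ z, MeasurePreserving (g z) volume volume := fun z =>
    measurePreserving_sub_right volume z
  have hc := (Continuous.compMeasurePreservingLp (p := 2)
    (continuous_const (y := hw.toLp w)) hg hgm (by norm_num)).tendsto 0
  have h0 := (tendsto_iff_edist_tendsto_0).1 hc
  refine h0.congr fun z => ?_
  rw [Lp.edist_def]
  refine eLpNorm_congr_ae ?_
  have h1 := Lp.coeFn_compMeasurePreserving (hw.toLp w) (hgm z)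
  have h2 := Lp.coeFn_compMeasurePreserving (hw.toLp w) (hgm 0)
  have h3 := (hgm z).quasiMeasurePreserving.ae_eq_comp hw.coeFn_toLp
  have h4 := (hgm 0).quasiMeasurePreserving.ae_eq_comp hw.coeFn_toLp
  filter_upwards [h1, h2, h3, h4] with p h1 h2 h3 h4
  rw [Pi.sub_apply, h1, h2, h3, h4]
  simp [g]

variable [NormedSpace ℝ F]

/-- The convolution of `w` with the scalar kernel `ρ`. -/
def moll (ρ : Plane → ℝ) (w : Plane → F) (p : Plane) : F := ∫ q, ρ (p - q) • w q

theorem moll_eq_convolution (ρ : Plane → ℝ) (w : Plane → F) :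
    moll ρ w = w ⋆[(ContinuousLinearMap.lsmul ℝ ℝ).flip, volume] ρ := rfl

theorem moll_congr_ae (ρ : Plane → ℝ) {w w' : Plane → F} (h : w =ᵐ[volume] w') :
    moll ρ w = moll ρ w' := by
  funext p
  refine integral_congr_ae ?_
  filter_upwards [h] with q hq
  rw [hq]

theorem contDiff_moll [CompleteSpace F] {ρ : Plane → ℝ} (hρ : IsTest ρ) {w : Plane → F}
    (hw : LocallyIntegrable w volume) : ContDiff ℝ ∞ (moll ρ w) :=
  hρ.2.contDiff_convolution_right (ContinuousLinearMap.lsmul ℝ ℝ).flip hw hρ.1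

theorem fderiv_moll [CompleteSpace F] {ρ : Plane → ℝ} (hρ : IsTest ρ) {w : Plane → F}
    (hw : LocallyIntegrable w volume) (p e : Plane) :
    fderiv ℝ (moll ρ w) p e = ∫ q, (fderiv ℝ ρ (p - q) e) • w q := by
  rw [moll_eq_convolution, (hρ.2.hasFDerivAt_convolution_right
    (ContinuousLinearMap.lsmul ℝ ℝ).flip hw (hρ.1.of_le (by simp)) p).fderiv]
  have hcs : HasCompactSupport (fderiv ℝ ρ) := hρ.2.fderiv ℝ
  have hcont : Continuous (fderiv ℝ ρ) := hρ.1.continuous_fderiv (by simp)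
  have hex := hcs.convolutionExists_right
    ((ContinuousLinearMap.lsmul ℝ ℝ).flip.precompR Plane : F →L[ℝ] (Plane →L[ℝ] ℝ) →L[ℝ] _)
    hw hcont p
  rw [convolution_def, ContinuousLinearMap.integral_apply hex]
  rfl

/-- Mollifications converge in `L²`. -/
theorem tendsto_eLpNorm_moll [CompleteSpace F] {w : Plane → F} (hw : MemLp w 2 volume)
    {φ : ℕ → ContDiffBump (0 : Plane)} (hφ : Tendsto (fun n => (φ n).rOut) atTop (𝓝 0)) :
    Tendsto (fun n => eLpNorm (fun p => moll ((φ n).normed volume) w p - w p) 2 volume)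
      atTop (𝓝 0) := by
  -- The mollification does not depend on the representative. A strongly measurable one makes the
  -- integrand jointly measurable, as the exchange of integrals below requires.
  wlog hsm : StronglyMeasurable w generalizing w
  · have hae := hw.1.ae_eq_mk
    have h1 := this (hw.ae_eq hae) hw.1.stronglyMeasurable_mk
    refine h1.congr fun n => eLpNorm_congr_ae ?_
    filter_upwards [hae] with p hp
    rw [moll_congr_ae _ hae, hp]
  rw [ENNReal.tendsto_nhds_zero]
  intro ε hε
  have htr := (ENNReal.tendsto_nhds_zero.1 (tendsto_eLpNorm_translate hw)) ε hε
  obtain ⟨δ, hδ, hball⟩ := Metric.eventually_nhds_iff_ball.1 htr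
  filter_upwards [hφ.eventually (gt_mem_nhds hδ)] with n hn
  set ρ : Plane → ℝ := (φ n).normed volume with hρ
  have hρc : Continuous ρ := (φ n).continuous_normed
  have hρ0 : ∀ z, 0 ≤ ρ z := (φ n).nonneg_normed
  have hρsupp : ∀ z, ρ z ≠ 0 → z ∈ Metric.ball (0 : Plane) δ := by
    intro z hz
    have : z ∈ Function.support ρ := hz
    rw [hρ, (φ n).support_normed_eq] at this
    exact Metric.ball_subset_ball hn.le this
  have hρint : Integrable ρ := (φ n).integrable_normed
  have hρ1 : ∫⁻ z, ENNReal.ofReal (ρ z) = 1 := by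
    rw [← ofReal_integral_eq_lintegral_ofReal hρint (Eventually.of_forall hρ0),
      (φ n).integral_normed, ENNReal.ofReal_one]
  -- For this probability measure the L¹ norm is at most the L² norm, so the squared error at `p` is
  -- at most the `ν`-average of `‖w (p - z) - w p‖²`. Integrating over `p` first leaves translates
  -- by small `z`.
  set ν : Measure Plane := volume.withDensity fun z => ENNReal.ofReal (ρ z) with hν
  have hνp : IsProbabilityMeasure ν := ⟨by rw [hν, withDensity_apply _ MeasurableSet.univ]; simpa⟩
  have hρm : Measurable fun z => ENNReal.ofReal (ρ z) := by fun_prop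
  have hli : LocallyIntegrable w volume := hw.locallyIntegrable (by norm_num)
  have hgm : ∀ p, StronglyMeasurable fun z => w (p - z) - w p := fun p =>
    (hsm.comp_measurable (by fun_prop)).sub stronglyMeasurable_const
  have hpt : ∀ p, ‖moll ρ w p - w p‖ₑ ^ 2 ≤
      ∫⁻ z, ENNReal.ofReal (ρ z) * ‖w (p - z) - w p‖ₑ ^ 2 := by
    intro p
    have h1 : moll ρ w p - w p = ∫ z, ρ z • (w (p - z) - w p) := by
      have e1 : moll ρ w p = ∫ z, ρ z • w (p - z) := by
        unfold moll
        rw [← integral_sub_left_eq_self _ volume p]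
        simp
      have hex : Integrable fun z => ρ z • w (p - z) :=
        ((φ n).hasCompactSupport_normed.convolutionExists_left
          (ContinuousLinearMap.lsmul ℝ ℝ) hρc hli p).integrable
      simp_rw [smul_sub]
      rw [integral_sub hex (hρint.smul_const _), integral_smul_const, (φ n).integral_normed,
        one_smul, e1]
    have h2 : ‖moll ρ w p - w p‖ₑ ≤ eLpNorm (fun z => w (p - z) - w p) 1 ν := by
      rw [h1, eLpNorm_one_eq_lintegral_enorm, hν, lintegral_withDensity_eq_lintegral_mul _ hρm
        (hgm p).enorm]
      refine (enorm_integral_le_lintegral_enorm _).trans (le_of_eq (lintegral_congr fun z => ?_))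
      rw [enorm_smul, Pi.mul_apply, Real.enorm_of_nonneg (hρ0 z)]
    have h3 := h2.trans (eLpNorm_le_eLpNorm_of_exponent_le (by norm_num : (1 : ℝ≥0∞) ≤ 2)
      (hgm p).aestronglyMeasurable)
    refine (pow_le_pow_left' h3 2).trans (le_of_eq ?_)
    rw [eLpNorm_two_sq, hν, lintegral_withDensity_eq_lintegral_mul _ hρm
      ((hgm p).enorm.pow_const 2)]
    rfl
  have hsq : eLpNorm (fun p => moll ρ w p - w p) 2 volume ^ 2 ≤ ε ^ 2 := by
    rw [eLpNorm_two_sq]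
    calc ∫⁻ p, ‖moll ρ w p - w p‖ₑ ^ 2
        ≤ ∫⁻ p, ∫⁻ z, ENNReal.ofReal (ρ z) * ‖w (p - z) - w p‖ₑ ^ 2 := lintegral_mono hpt
      _ = ∫⁻ z, ∫⁻ p, ENNReal.ofReal (ρ z) * ‖w (p - z) - w p‖ₑ ^ 2 := by
          refine lintegral_lintegral_swap (Measurable.aemeasurable ?_)
          refine (hρm.comp measurable_snd).mul (Measurable.pow_const (StronglyMeasurable.enorm ?_) 2)
          exact (hsm.comp_measurable (by fun_prop)).sub (hsm.comp_measurable (by fun_prop))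
      _ ≤ ∫⁻ z, ENNReal.ofReal (ρ z) * ε ^ 2 := by
          refine lintegral_mono fun z => ?_
          rw [lintegral_const_mul _ (by
            refine Measurable.pow_const (StronglyMeasurable.enorm ?_) 2
            exact (hsm.comp_measurable (by fun_prop)).sub hsm)]
          by_cases hz : ρ z = 0
          · simp [hz]
          · rw [← eLpNorm_two_sq volume (fun p => w (p - z) - w p)]
            gcongr
            exact hball z (hρsupp z hz)
      _ = ε ^ 2 := by rw [lintegral_mul_const _ hρm, hρ1, one_mul]
  exact (ENNReal.pow_le_pow_left_iff (by norm_num)).1 hsq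

theorem exists_contDiffBump_rOut_lt :
    ∃ φ : ℕ → ContDiffBump (0 : Plane), Tendsto (fun n => (φ n).rOut) atTop (𝓝 0) := by
  refine ⟨fun n => ⟨1 / ((n : ℝ) + 1) / 2, 1 / ((n : ℝ) + 1), by positivity, ?_⟩, ?_⟩
  · exact half_lt_self (by positivity)
  · exact tendsto_one_div_add_atTop_nhds_zero_nat

theorem isTest_normed (φ : ContDiffBump (0 : Plane)) : IsTest (φ.normed volume) :=
  ⟨φ.contDiff_normed, φ.hasCompactSupport_normed⟩

end Mollification

/-! ### Operations on test functions -/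

section TestFunctions

variable {F : Type*} [NormedAddCommGroup F] [NormedSpace ℝ F]

theorem IsTest.continuous {φ : Plane → F} (h : IsTest φ) : Continuous φ := h.1.continuous

theorem IsTest.differentiable {φ : Plane → F} (h : IsTest φ) : Differentiable ℝ φ :=
  h.1.differentiable (by simp)

theorem IsTest.fderiv_apply {φ : Plane → F} (h : IsTest φ) (e : Plane) :
    IsTest fun p => fderiv ℝ φ p e :=
  ⟨(h.1.fderiv_right (m := ∞) (by simp)).clm_apply contDiff_const, h.2.fderiv_apply ℝ e⟩

theorem IsTest.add {φ ψ : Plane → F} (h : IsTest φ) (h' : IsTest ψ) :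
    IsTest fun p => φ p + ψ p := ⟨h.1.add h'.1, h.2.add h'.2⟩

theorem IsTest.sub {φ ψ : Plane → F} (h : IsTest φ) (h' : IsTest ψ) :
    IsTest fun p => φ p - ψ p := ⟨h.1.sub h'.1, h.2.sub h'.2⟩

theorem IsTest.const_mul {φ : Plane → ℂ} (h : IsTest φ) (c : ℂ) :
    IsTest fun p => c * φ p := ⟨contDiff_const.mul h.1, h.2.mul_left⟩

theorem IsTest.mul {φ ψ : Plane → ℂ} (h : IsTest φ) (h' : IsTest ψ) :
    IsTest fun p => φ p * ψ p := ⟨h.1.mul h'.1, h.2.mul_right⟩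

theorem IsTest.conj {φ : Plane → ℂ} (h : IsTest φ) : IsTest fun p => conj (φ p) :=
  ⟨Complex.conjCLE.contDiff.comp h.1, h.2.comp_left (g := fun z => (starRingEnd ℂ) z) (map_zero _)⟩

theorem IsTest.ofReal {φ : Plane → ℝ} (h : IsTest φ) : IsTest fun p => (φ p : ℂ) :=
  ⟨Complex.ofRealCLM.contDiff.comp h.1, h.2.comp_left (g := fun x : ℝ => (x : ℂ)) Complex.ofReal_zero⟩

theorem IsTest.memLp {φ : Plane → F} (h : IsTest φ) (q : ENNReal) (μ : Measure Plane)
    [IsFiniteMeasureOnCompacts μ] : MemLp φ q μ :=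
  h.continuous.memLp_of_hasCompactSupport h.2

theorem fderiv_ofReal_apply {φ : Plane → ℝ} (h : IsTest φ) (p e : Plane) :
    fderiv ℝ (fun p => (φ p : ℂ)) p e = (fderiv ℝ φ p e : ℂ) := by
  have := (Complex.ofRealCLM.hasFDerivAt.comp p (h.differentiable p).hasFDerivAt).fderiv
  change fderiv ℝ (Complex.ofRealCLM ∘ φ) p e = _
  rw [this]; rfl

theorem integral_fderiv_smul {φ : Plane → ℝ} (hφ : IsTest φ) {ψ : Plane → F} (hψ : IsTest ψ)
    (e : Plane) : ∫ p, fderiv ℝ φ p e • ψ p = -∫ p, φ p • fderiv ℝ ψ p e := by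
  have hc : ∀ {f : Plane → ℝ} {g : Plane → F}, Continuous f → Continuous g → HasCompactSupport f →
      Integrable fun p => f p • g p := fun hf hg hcs =>
    (hf.smul hg).integrable_of_hasCompactSupport hcs.smul_right
  rw [integral_smul_fderiv_eq_neg_fderiv_smul_of_integrable
    (hc (hφ.fderiv_apply e).continuous hψ.continuous (hφ.fderiv_apply e).2)
    (hc hφ.continuous (hψ.fderiv_apply e).continuous hφ.2)
    (hc hφ.continuous hψ.continuous hφ.2) (fun x _ => hφ.differentiable x)
    (fun x _ => hψ.differentiable x), neg_neg]

end TestFunctions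

/-! ### Square integrable functions and their classes -/

section L2

open scoped Classical in
/-- The class of a square integrable function (`0` for other functions). -/
def toL2 (f : Plane → ℂ) : L2 := if h : MemLp f 2 volume then h.toLp f else 0

theorem toL2_eq {f : Plane → ℂ} (h : MemLp f 2 volume) : toL2 f = h.toLp f := dif_pos h

theorem coeFn_toL2 {f : Plane → ℂ} (h : MemLp f 2 volume) : toL2 f =ᵐ[volume] f := by
  rw [toL2_eq h]; exact h.coeFn_toLp

theorem toL2_coe (u : L2) : toL2 u = u := by
  rw [toL2_eq (Lp.memLp u)]; exact Lp.toLp_coeFn u _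

theorem toL2_congr {f g : Plane → ℂ} (h : f =ᵐ[volume] g) : toL2 f = toL2 g := by
  by_cases hf : MemLp f 2 volume
  · rw [toL2_eq hf, toL2_eq (hf.ae_eq h)]
    exact (MemLp.toLp_eq_toLp_iff _ _).2 h
  · have hg : ¬ MemLp g 2 volume := fun hg => hf (hg.ae_eq h.symm)
    rw [toL2, toL2, dif_neg hf, dif_neg hg]

theorem toL2_add {f g : Plane → ℂ} (hf : MemLp f 2 volume) (hg : MemLp g 2 volume) :
    toL2 (fun p => f p + g p) = toL2 f + toL2 g := by
  rw [toL2_eq hf, toL2_eq hg, toL2_eq (f := fun p => f p + g p) (hf.add hg)]; rfl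

theorem toL2_sub {f g : Plane → ℂ} (hf : MemLp f 2 volume) (hg : MemLp g 2 volume) :
    toL2 (fun p => f p - g p) = toL2 f - toL2 g := by
  rw [toL2_eq hf, toL2_eq hg, toL2_eq (f := fun p => f p - g p) (hf.sub hg)]; rfl

theorem toL2_const_mul {f : Plane → ℂ} (hf : MemLp f 2 volume) (c : ℂ) :
    toL2 (fun p => c * f p) = c • toL2 f := by
  rw [toL2_eq hf, toL2_eq (hf.const_mul c)]; rfl

theorem inner_eq_integral (u v : L2) : inner ℂ u v = ∫ p, conj (u p) * v p := by
  rw [L2.inner_def]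
  simp_rw [RCLike.inner_apply, mul_comm]

theorem inner_toL2 {f g : Plane → ℂ} (hf : MemLp f 2 volume) (hg : MemLp g 2 volume) :
    inner ℂ (toL2 f) (toL2 g) = ∫ p, conj (f p) * g p := by
  rw [inner_eq_integral]
  refine integral_congr_ae ?_
  filter_upwards [coeFn_toL2 hf, coeFn_toL2 hg] with p h1 h2
  rw [h1, h2]

theorem norm_toL2_sq {f : Plane → ℂ} (hf : MemLp f 2 volume) :
    ‖toL2 f‖ ^ 2 = ∫ p, ‖f p‖ ^ 2 := by
  have h := inner_toL2 hf hf
  rw [inner_self_eq_norm_sq_to_K] at h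
  have h2 : ∀ p, conj (f p) * f p = ((‖f p‖ ^ 2 : ℝ) : ℂ) := fun p => by
    rw [Complex.conj_mul']; simp
  simp_rw [h2] at h
  rw [integral_complex_ofReal] at h
  apply Complex.ofReal_injective
  rw [Complex.ofReal_pow]
  exact h

theorem enorm_toL2 {f : Plane → ℂ} (hf : MemLp f 2 volume) :
    ‖toL2 f‖ₑ = eLpNorm f 2 volume := by
  rw [toL2_eq hf, Lp.enorm_def]
  exact eLpNorm_congr_ae hf.coeFn_toLp

theorem tendsto_toL2_iff {ι : Type*} {l : Filter ι} {f : ι → Plane → ℂ}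
    (hf : ∀ i, MemLp (f i) 2 volume) (u : L2) :
    Tendsto (fun i => toL2 (f i)) l (𝓝 u) ↔
      Tendsto (fun i => eLpNorm (fun p => f i p - u p) 2 volume) l (𝓝 0) := by
  rw [tendsto_iff_edist_tendsto_0]
  refine iff_of_eq (congrArg (fun g => Tendsto g l (𝓝 0)) (funext fun i => ?_))
  rw [Lp.edist_def]
  refine eLpNorm_congr_ae ?_
  filter_upwards [coeFn_toL2 (hf i)] with p hp
  rw [Pi.sub_apply, hp]

theorem tendsto_eLpNorm_zero_of_dominated {f : ℕ → Plane → ℂ} {g : Plane → ℝ}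
    (hf : ∀ n, AEStronglyMeasurable (f n) volume) (hg : MemLp g 2 volume)
    (hb : ∀ n p, ‖f n p‖ ≤ ‖g p‖) (hlim : ∀ᵐ p, Tendsto (fun n => f n p) atTop (𝓝 0)) :
    Tendsto (fun n => eLpNorm (f n) 2 volume) atTop (𝓝 0) := by
  have h : Tendsto (fun n => ∫⁻ p, ‖f n p‖ₑ ^ 2) atTop (𝓝 (∫⁻ _ : Plane, (0 : ENNReal))) := by
    refine tendsto_lintegral_of_dominated_convergence' (fun p => ‖g p‖ₑ ^ 2)
      (fun n => (hf n).enorm.pow_const 2) (fun n => Eventually.of_forall fun p => ?_) ?_ ?_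
    · exact pow_le_pow_left' (enorm_le_iff_norm_le.2 (hb n p)) 2
    · rw [← eLpNorm_two_sq]
      exact ENNReal.pow_ne_top hg.2.ne
    · filter_upwards [hlim] with p hp
      have := hp.enorm
      rw [enorm_zero] at this
      have h2 := ((ENNReal.continuous_pow 2).tendsto 0).comp this
      rw [zero_pow two_ne_zero] at h2
      exact h2
  rw [lintegral_zero] at h
  simp_rw [← eLpNorm_two_sq] at h
  have h2 := (ENNReal.continuous_rpow_const (y := 1 / 2)).tendsto 0 |>.comp h
  simp only [Function.comp_def] at h2
  rw [ENNReal.zero_rpow_of_pos (by norm_num)] at h2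
  refine h2.congr fun n => ?_
  rw [← ENNReal.rpow_natCast, ← ENNReal.rpow_mul]
  norm_num

end L2

/-! ### The Sobolev space as a Hilbert space and density of test functions -/

section Sobolev

theorem inner_toL2_ofReal {φ : Plane → ℝ} (h : IsTest φ) (u : L2) :
    inner ℂ (toL2 fun p => (φ p : ℂ)) u = ∫ p, φ p • u p := by
  rw [inner_eq_integral]
  refine integral_congr_ae ?_
  filter_upwards [coeFn_toL2 (h.ofReal.memLp 2 volume)] with p hp
  rw [hp, Complex.conj_ofReal, Complex.real_smul]

/-- In this form the condition is visibly linear and continuous in the pair `(u, g)`, so that `Sob`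
is a closed subspace. -/
theorem hasWeakDeriv_iff {e : Plane} {u g : L2} : HasWeakDeriv e u g ↔
    ∀ φ : Plane → ℝ, IsTest φ → inner ℂ (toL2 fun p => ((fderiv ℝ φ p e : ℝ) : ℂ)) u +
      inner ℂ (toL2 fun p => (φ p : ℂ)) g = 0 := by
  refine forall_congr' fun φ => forall_congr' fun hφ => ?_
  rw [inner_toL2_ofReal hφ, inner_toL2_ofReal (hφ.fderiv_apply e), eq_neg_iff_add_eq_zero]

theorem eq_zero_of_inner_test {u : L2}
    (h : ∀ φ : Plane → ℝ, IsTest φ → inner ℂ (toL2 fun p => (φ p : ℂ)) u = 0) : u = 0 := by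
  have hli : LocallyIntegrable u volume := (Lp.memLp u).locallyIntegrable (by norm_num)
  have := ae_eq_zero_of_integral_contDiff_smul_eq_zero hli (fun φ h1 h2 => by
    rw [← inner_toL2_ofReal ⟨h1, h2⟩]; exact h φ ⟨h1, h2⟩)
  exact (Lp.eq_zero_iff_ae_eq_zero).2 this

theorem HasWeakDeriv.unique {e : Plane} {u g g' : L2} (h : HasWeakDeriv e u g)
    (h' : HasWeakDeriv e u g') : g = g' := by
  rw [← sub_eq_zero]
  refine eq_zero_of_inner_test fun φ hφ => ?_
  have h1 := hasWeakDeriv_iff.1 h φ hφ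
  have h2 := hasWeakDeriv_iff.1 h' φ hφ
  rw [inner_sub_right, sub_eq_zero]
  exact add_left_cancel (h1.trans h2.symm)

theorem weakDeriv_eq {e : Plane} {u g : L2} (h : HasWeakDeriv e u g) : weakDeriv e u = g := by
  have hex : ∃ g, HasWeakDeriv e u g := ⟨g, h⟩
  rw [weakDeriv, dif_pos hex]
  exact hex.choose_spec.unique h

/-- `L²(ℝ²)³`. -/
abbrev Triple : Type := PiLp 2 fun _ : Fin 3 => L2

/-- The Sobolev space `H¹(ℝ²)` as a space of triples `(u, ∂₁u, ∂₂u)`. -/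
def Sob : Submodule ℂ Triple where
  carrier := {U | HasWeakDeriv (1, 0) (U 0) (U 1) ∧ HasWeakDeriv (0, 1) (U 0) (U 2)}
  add_mem' := by
    rintro U W ⟨h1, h2⟩ ⟨h3, h4⟩
    simp only [hasWeakDeriv_iff, mem_ofPred_eq, PiLp.add_apply, inner_add_right] at *
    refine ⟨fun φ hφ => ?_, fun φ hφ => ?_⟩
    · linear_combination h1 φ hφ + h3 φ hφ
    · linear_combination h2 φ hφ + h4 φ hφ
  zero_mem' := by simp [hasWeakDeriv_iff]
  smul_mem' := by
    rintro c U ⟨h1, h2⟩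
    simp only [hasWeakDeriv_iff, mem_ofPred_eq, PiLp.smul_apply, inner_smul_right] at *
    refine ⟨fun φ hφ => ?_, fun φ hφ => ?_⟩
    · linear_combination c * h1 φ hφ
    · linear_combination c * h2 φ hφ

theorem isClosed_Sob : IsClosed (Sob : Set Triple) := by
  have : (Sob : Set Triple) = {U | HasWeakDeriv (1, 0) (U 0) (U 1) ∧
    HasWeakDeriv (0, 1) (U 0) (U 2)} := rfl
  rw [this]
  simp only [hasWeakDeriv_iff, ofPred_and, ofPred_forall]
  have hc : ∀ i : Fin 3, Continuous fun U : Triple => U i := fun i => by fun_prop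
  refine IsClosed.inter ?_ ?_ <;>
  · refine isClosed_iInter fun φ => isClosed_iInter fun _ => isClosed_eq ?_ continuous_const
    exact (continuous_const.inner (hc _)).add (continuous_const.inner (hc _))

instance : CompleteSpace Sob := isClosed_Sob.completeSpace_coe

/-- The components `u`, `∂₁u`, `∂₂u` of an element of `H¹(ℝ²)`. -/
def comp (i : Fin 3) : Sob →L[ℂ] L2 := PiLp.proj 2 (fun _ : Fin 3 => L2) i ∘L Sob.subtypeL

theorem norm_sq_Sob (U : Sob) :
    ‖U‖ ^ 2 = ‖comp 0 U‖ ^ 2 + ‖comp 1 U‖ ^ 2 + ‖comp 2 U‖ ^ 2 := by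
  rw [Submodule.coe_norm, PiLp.norm_sq_eq_of_L2, Fin.sum_univ_three]
  rfl

theorem norm_comp_le (i : Fin 3) (U : Sob) : ‖comp i U‖ ≤ ‖U‖ := by
  have h := norm_sq_Sob U
  refine le_of_sq_le_sq ?_ (norm_nonneg U)
  rw [h]
  fin_cases i
  · exact (le_add_of_nonneg_right (sq_nonneg _)).trans (le_add_of_nonneg_right (sq_nonneg _))
  · exact (le_add_of_nonneg_left (sq_nonneg _)).trans (le_add_of_nonneg_right (sq_nonneg _))
  · exact le_add_of_nonneg_left (add_nonneg (sq_nonneg _) (sq_nonneg _))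

theorem hasWeakDeriv_comp_one (U : Sob) : HasWeakDeriv (1, 0) (comp 0 U) (comp 1 U) := U.2.1

theorem hasWeakDeriv_comp_two (U : Sob) : HasWeakDeriv (0, 1) (comp 0 U) (comp 2 U) := U.2.2

/-- Weak derivatives are unique, so identities in `Sob` may be checked on the function alone. -/
theorem comp_zero_injective : Function.Injective (comp 0) := by
  intro U W h
  have h1 := hasWeakDeriv_comp_one U
  have h2 := hasWeakDeriv_comp_two U
  rw [h] at h1 h2
  have h1' := h1.unique (hasWeakDeriv_comp_one W)
  have h2' := h2.unique (hasWeakDeriv_comp_two W)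
  refine Subtype.ext (PiLp.ext fun i => ?_)
  fin_cases i
  · exact h
  · exact h1'
  · exact h2'

theorem mem_H1_iff {u : L2} : u ∈ H1 ↔ ∃ U, comp 0 U = u := by
  constructor
  · rintro ⟨⟨g1, h1⟩, g2, h2⟩
    exact ⟨⟨WithLp.toLp 2 ![u, g1, g2], h1, h2⟩, rfl⟩
  · rintro ⟨U, rfl⟩
    exact ⟨⟨_, hasWeakDeriv_comp_one U⟩, _, hasWeakDeriv_comp_two U⟩

theorem weakDeriv_comp_one (U : Sob) : weakDeriv (1, 0) (comp 0 U) = comp 1 U :=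
  weakDeriv_eq (hasWeakDeriv_comp_one U)

theorem weakDeriv_comp_two (U : Sob) : weakDeriv (0, 1) (comp 0 U) = comp 2 U :=
  weakDeriv_eq (hasWeakDeriv_comp_two U)

theorem hasWeakDeriv_toL2 {φ : Plane → ℂ} (hφ : IsTest φ) (e : Plane) :
    HasWeakDeriv e (toL2 φ) (toL2 fun p => fderiv ℝ φ p e) := by
  intro ψ hψ
  have h1 : ∫ p, fderiv ℝ ψ p e • toL2 φ p = ∫ p, fderiv ℝ ψ p e • φ p := by
    refine integral_congr_ae ?_
    filter_upwards [coeFn_toL2 (hφ.memLp 2 volume)] with p hp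
    rw [hp]
  have h2 : ∫ p, ψ p • toL2 (fun p => fderiv ℝ φ p e) p = ∫ p, ψ p • fderiv ℝ φ p e := by
    refine integral_congr_ae ?_
    filter_upwards [coeFn_toL2 ((hφ.fderiv_apply e).memLp 2 volume)] with p hp
    rw [hp]
  rw [h1, h2, integral_fderiv_smul hψ hφ e]

/-- A test function as an element of `H¹(ℝ²)`. -/
def ofTest (φ : Plane → ℂ) (hφ : IsTest φ) : Sob :=
  ⟨WithLp.toLp 2 ![toL2 φ, toL2 fun p => fderiv ℝ φ p (1, 0), toL2 fun p => fderiv ℝ φ p (0, 1)],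
    hasWeakDeriv_toL2 hφ _, hasWeakDeriv_toL2 hφ _⟩

variable {φ : Plane → ℂ} (hφ : IsTest φ)

theorem comp_zero_ofTest : comp 0 (ofTest φ hφ) = toL2 φ := rfl

theorem comp_one_ofTest : comp 1 (ofTest φ hφ) = toL2 fun p => fderiv ℝ φ p (1, 0) := rfl

theorem comp_two_ofTest : comp 2 (ofTest φ hφ) = toL2 fun p => fderiv ℝ φ p (0, 1) := rfl

theorem tendsto_Sob_iff {ι : Type*} {l : Filter ι} {U : ι → Sob} {W : Sob} :
    Tendsto U l (𝓝 W) ↔ ∀ i, Tendsto (fun n => comp i (U n)) l (𝓝 (comp i W)) := by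
  constructor
  · exact fun h i => ((comp i).continuous.tendsto W).comp h
  · intro h
    rw [tendsto_iff_norm_sub_tendsto_zero]
    have h2 : Tendsto (fun n => ‖U n - W‖ ^ 2) l (𝓝 0) := by
      have : ∀ i, Tendsto (fun n => ‖comp i (U n - W)‖ ^ 2) l (𝓝 0) := by
        intro i
        have := (tendsto_iff_norm_sub_tendsto_zero.1 (h i)).pow 2
        simpa using this
      have h3 := ((this 0).add (this 1)).add (this 2)
      simp only [add_zero] at h3
      exact h3.congr fun n => (norm_sq_Sob _).symm
    have h3 := h2.sqrt
    simpa [Real.sqrt_sq (norm_nonneg _)] using h3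

theorem isTest_comp_sub {ρ : Plane → ℝ} (hρ : IsTest ρ) (p : Plane) :
    IsTest fun q => ρ (p - q) :=
  ⟨hρ.1.comp (contDiff_const.sub contDiff_id), hρ.2.comp_homeomorph (Homeomorph.subLeft p)⟩

theorem fderiv_comp_sub {ρ : Plane → ℝ} (hρ : IsTest ρ) (p q e : Plane) :
    fderiv ℝ (fun q => ρ (p - q)) q e = -(fderiv ℝ ρ (p - q) e) := by
  have := ((hρ.differentiable (p - q)).hasFDerivAt).comp q ((hasFDerivAt_id q).const_sub p)
  rw [ContinuousLinearMap.comp_neg, ContinuousLinearMap.comp_id] at this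
  change fderiv ℝ (ρ ∘ fun q => p - q) q e = _
  rw [HasFDerivAt.fderiv this]; rfl

/-- Test the weak derivative with `q ↦ ρ (p - q)`; the sign from reflecting `ρ` cancels the one from
integration by parts. -/
theorem fderiv_moll_of_hasWeakDeriv {ρ : Plane → ℝ} (hρ : IsTest ρ) {e : Plane} {u g : L2}
    (h : HasWeakDeriv e u g) (p : Plane) : fderiv ℝ (moll ρ u) p e = moll ρ g p := by
  rw [fderiv_moll hρ ((Lp.memLp u).locallyIntegrable (by norm_num))]
  have h1 := h _ (isTest_comp_sub hρ p)
  simp_rw [fderiv_comp_sub hρ, neg_smul] at h1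
  rw [integral_neg, neg_inj] at h1
  exact h1

/-- Cut-off functions at scale `m + 1`. -/
theorem exists_cutoff : ∃ (θ : ℕ → Plane → ℝ) (C : ℝ), (∀ m, IsTest (θ m)) ∧
    (∀ m p, ‖θ m p‖ ≤ 1) ∧ (∀ m p (e : Plane), ‖fderiv ℝ (θ m) p e‖ ≤ C * ‖e‖) ∧
    (∀ p, ∀ᶠ m in atTop, θ m =ᶠ[𝓝 p] fun _ => 1) := by
  let b : ContDiffBump (0 : Plane) := ⟨1, 2, by norm_num, by norm_num⟩
  have hb : IsTest (b : Plane → ℝ) := ⟨b.contDiff, b.hasCompactSupport⟩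
  obtain ⟨C, hC⟩ := (hb.2.fderiv ℝ).exists_bound_of_continuous
    (hb.1.continuous_fderiv (by simp))
  have hder : ∀ (m : ℕ) p, HasFDerivAt (fun p => b (((m : ℝ) + 1)⁻¹ • p))
      ((fderiv ℝ b (((m : ℝ) + 1)⁻¹ • p)).comp
        (((m : ℝ) + 1)⁻¹ • ContinuousLinearMap.id ℝ Plane)) p := by
    intro m p
    exact (hb.differentiable _).hasFDerivAt.comp p
      (((m : ℝ) + 1)⁻¹ • ContinuousLinearMap.id ℝ Plane).hasFDerivAt
  have hm1 : ∀ m : ℕ, ‖((m : ℝ) + 1)⁻¹‖ ≤ 1 := by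
    intro m
    rw [norm_inv, Real.norm_of_nonneg (by positivity)]
    exact inv_le_one_of_one_le₀ (by linarith [Nat.cast_nonneg (α := ℝ) m])
  have hC0 : 0 ≤ C := (norm_nonneg _).trans (hC 0)
  refine ⟨fun m p => b (((m : ℝ) + 1)⁻¹ • p), C, fun m => ⟨?_, ?_⟩, fun m p => ?_, fun m p e => ?_,
    fun p => ?_⟩
  · exact b.contDiff.comp (contDiff_const_smul _)
  · exact b.hasCompactSupport.comp_smul (by positivity)
  · rw [Real.norm_of_nonneg b.nonneg]; exact b.le_one
  · rw [(hder m p).fderiv]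
    simp only [ContinuousLinearMap.comp_apply, smul_apply,
      ContinuousLinearMap.id_apply]
    refine (ContinuousLinearMap.le_opNorm _ _).trans ?_
    refine mul_le_mul (hC _) ?_ (norm_nonneg _) hC0
    rw [norm_smul]
    exact mul_le_of_le_one_left (norm_nonneg _) (hm1 m)
  · obtain ⟨N, hN⟩ := exists_nat_gt ‖p‖
    filter_upwards [eventually_ge_atTop N] with m hm
    have hopen : IsOpen {q : Plane | ‖q‖ < (m : ℝ) + 1} := isOpen_lt continuous_norm continuous_const
    have hp : p ∈ {q : Plane | ‖q‖ < (m : ℝ) + 1} := by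
      have : (N : ℝ) ≤ m := by exact_mod_cast hm
      simp only [mem_ofPred_eq]; linarith
    filter_upwards [hopen.mem_nhds hp] with q hq
    apply b.one_of_mem_closedBall
    rw [mem_closedBall_zero_iff, norm_smul, norm_inv, Real.norm_of_nonneg (by positivity),
      inv_mul_eq_div, div_le_one (by positivity)]
    exact hq.le

/-- Test functions are dense in `H¹(ℝ²)`. -/
theorem exists_tendsto_ofTest (U : Sob) : ∃ (φ : ℕ → Plane → ℂ) (hφ : ∀ n, IsTest (φ n)),
    Tendsto (fun n => ofTest (φ n) (hφ n)) atTop (𝓝 U) := by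
  -- Mollify first, then cut off. Working with the closure lets the two limits be taken one after
  -- the other, without a diagonal sequence.
  suffices h : U ∈ closure {W : Sob | ∃ φ hφ, W = ofTest φ hφ} by
    obtain ⟨W, hW, hlim⟩ := mem_closure_iff_seq_limit.1 h
    choose φ hφ hWφ using hW
    exact ⟨φ, hφ, by rwa [← funext hWφ]⟩
  obtain ⟨b, hb⟩ := exists_contDiffBump_rOut_lt
  obtain ⟨θ, C, hθ, hθ1, hθC, hθlim⟩ := exists_cutoff
  set ρ : ℕ → Plane → ℝ := fun n => (b n).normed volume with hρdef
  have hρ : ∀ n, IsTest (ρ n) := fun n => isTest_normed (b n)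
  have hmem : ∀ (n : ℕ) (u : L2), eLpNorm (fun p => moll (ρ n) u p - u p) 2 volume < ⊤ →
      MemLp (moll (ρ n) u) 2 volume := by
    intro n u h
    have hsm : AEStronglyMeasurable (moll (ρ n) u) volume :=
      (contDiff_moll (hρ n) ((Lp.memLp u).locallyIntegrable (by norm_num))).continuous.aestronglyMeasurable
    have h2 : MemLp (fun p => moll (ρ n) u p - u p) 2 volume := ⟨hsm.sub (Lp.memLp u).1, h⟩
    have := h2.add (Lp.memLp u)
    refine this.ae_eq (Eventually.of_forall fun p => ?_)
    simp
  have hconv : ∀ i, Tendsto (fun n => eLpNorm (fun p => moll (ρ n) (comp i U) p - comp i U p) 2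
      volume) atTop (𝓝 0) := fun i => tendsto_eLpNorm_moll (Lp.memLp _) hb
  -- Square integrability of a mollification is read off from its finite distance to the function,
  -- which is known only for large `n`; hence the threshold `N`.
  have hev : ∀ᶠ n in atTop, ∀ i, MemLp (moll (ρ n) (comp i U)) 2 volume := by
    rw [eventually_all]
    intro i
    filter_upwards [(hconv i).eventually (gt_mem_nhds ENNReal.zero_lt_top)] with n hn
    exact hmem n _ hn
  obtain ⟨N, hN⟩ := eventually_atTop.1 hev
  have hsm : ∀ n i, ContDiff ℝ ∞ (moll (ρ n) (comp i U)) := fun n i =>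
    contDiff_moll (hρ n) ((Lp.memLp _).locallyIntegrable (by norm_num))
  have hd1 : ∀ n p, fderiv ℝ (moll (ρ n) (comp 0 U)) p (1, 0) = moll (ρ n) (comp 1 U) p :=
    fun n p => fderiv_moll_of_hasWeakDeriv (hρ n) (hasWeakDeriv_comp_one U) p
  have hd2 : ∀ n p, fderiv ℝ (moll (ρ n) (comp 0 U)) p (0, 1) = moll (ρ n) (comp 2 U) p :=
    fun n p => fderiv_moll_of_hasWeakDeriv (hρ n) (hasWeakDeriv_comp_two U) p
  -- the mollification as an element of `Sob`, a limit of cut-offs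
  have hstep : ∀ n ≥ N, ∃ W ∈ closure {W : Sob | ∃ φ hφ, W = ofTest φ hφ},
      ∀ i, comp i W = toL2 (moll (ρ n) (comp i U)) := by
    intro n hn
    set w := moll (ρ n) (comp 0 U) with hw
    have hφ : ∀ m, IsTest fun p => (θ m p : ℂ) * w p := fun m =>
      ⟨(hθ m).ofReal.1.mul (hsm n 0), (hθ m).ofReal.2.mul_right⟩
    have hder : ∀ m p e, fderiv ℝ (fun p => (θ m p : ℂ) * w p) p e =
        (θ m p : ℂ) * fderiv ℝ w p e + (fderiv ℝ (θ m) p e : ℂ) * w p := by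
      intro m p e
      rw [fderiv_fun_mul ((hθ m).ofReal.differentiable p) ((hsm n 0).differentiable (by simp) p)]
      simp only [add_apply, smul_apply, smul_eq_mul,
        fderiv_ofReal_apply (hθ m)]
      ring
    have hcut : ∀ v : Plane → ℂ, Continuous v → MemLp v 2 volume →
        Tendsto (fun m => eLpNorm (fun p => (θ m p : ℂ) * v p - v p) 2 volume) atTop (𝓝 0) := by
      intro v hv hvm
      refine tendsto_eLpNorm_zero_of_dominated (g := fun p => 2 * ‖v p‖) (fun m => ?_)
        (hvm.norm.const_mul 2) (fun m p => ?_) (Eventually.of_forall fun p => ?_)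
      · exact (((hθ m).ofReal.continuous.mul hv).sub hv).aestronglyMeasurable
      · refine (norm_sub_le _ _).trans ?_
        rw [norm_mul, Complex.norm_real, norm_mul, norm_norm, Real.norm_of_nonneg zero_le_two]
        nlinarith [hθ1 m p, norm_nonneg (v p)]
      · refine tendsto_const_nhds.congr' ?_
        filter_upwards [hθlim p] with m hm
        rw [hm.eq_of_nhds]; simp
    have hcutd : ∀ e : Plane, Tendsto (fun m => eLpNorm
        (fun p => (fderiv ℝ (θ m) p e : ℂ) * w p) 2 volume) atTop (𝓝 0) := by
      intro e
      refine tendsto_eLpNorm_zero_of_dominated (g := fun p => (C * ‖e‖) * ‖w p‖) (fun m => ?_)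
        ((hN n hn 0).norm.const_mul _) (fun m p => ?_) (Eventually.of_forall fun p => ?_)
      · exact ((((hθ m).fderiv_apply e).ofReal).continuous.mul
          (hsm n 0).continuous).aestronglyMeasurable
      · rw [norm_mul, Complex.norm_real, norm_mul, norm_norm]
        exact mul_le_mul_of_nonneg_right ((hθC m p e).trans (le_abs_self _)) (norm_nonneg _)
      · refine tendsto_const_nhds.congr' ?_
        filter_upwards [hθlim p] with m hm
        rw [hm.fderiv_eq]; simp
    have hsum : ∀ (e : Plane) (v : Plane → ℂ), Continuous v → MemLp v 2 volume →
        (∀ p, fderiv ℝ w p e = v p) →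
        Tendsto (fun m => eLpNorm (fun p => fderiv ℝ (fun p => (θ m p : ℂ) * w p) p e - v p) 2
          volume) atTop (𝓝 0) := by
      intro e v hv hvm hvw
      have h := (hcut v hv hvm).add (hcutd e)
      rw [add_zero] at h
      refine tendsto_of_tendsto_of_tendsto_of_le_of_le tendsto_const_nhds h (fun _ => zero_le)
        fun m => ?_
      have : (fun p => fderiv ℝ (fun p => (θ m p : ℂ) * w p) p e - v p) =
          (fun p => (θ m p : ℂ) * v p - v p) + fun p => (fderiv ℝ (θ m) p e : ℂ) * w p := by
        funext p
        rw [hder, hvw, Pi.add_apply]; ring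
      simp only
      rw [this]
      refine eLpNorm_add_le ?_ ?_ (by norm_num)
      · exact (((hθ m).ofReal.continuous.mul hv).sub hv).aestronglyMeasurable
      · exact ((((hθ m).fderiv_apply e).ofReal).continuous.mul
          (hsm n 0).continuous).aestronglyMeasurable
    have hL : ∀ i, Tendsto (fun m => comp i (ofTest _ (hφ m))) atTop
        (𝓝 (toL2 (moll (ρ n) (comp i U)))) := by
      have aux : ∀ (f : ℕ → Plane → ℂ) (v : Plane → ℂ), (∀ m, MemLp (f m) 2 volume) →
          MemLp v 2 volume → Tendsto (fun m => eLpNorm (fun p => f m p - v p) 2 volume) atTop (𝓝 0) →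
          Tendsto (fun m => toL2 (f m)) atTop (𝓝 (toL2 v)) := by
        intro f v hf hv h
        rw [tendsto_toL2_iff hf]
        refine h.congr fun m => eLpNorm_congr_ae ?_
        filter_upwards [coeFn_toL2 hv] with p hp
        rw [hp]
      intro i
      fin_cases i
      · exact aux _ _ (fun m => (hφ m).memLp 2 volume) (hN n hn 0)
          (hcut _ (hsm n 0).continuous (hN n hn 0))
      · exact aux _ _ (fun m => ((hφ m).fderiv_apply _).memLp 2 volume) (hN n hn 1)
          (hsum _ _ (hsm n 1).continuous (hN n hn 1) (hd1 n))
      · exact aux _ _ (fun m => ((hφ m).fderiv_apply _).memLp 2 volume) (hN n hn 2)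
          (hsum _ _ (hsm n 2).continuous (hN n hn 2) (hd2 n))
    have hlimT : Tendsto (fun m => ((ofTest _ (hφ m) : Sob) : Triple)) atTop
        (𝓝 (WithLp.toLp 2 fun i => toL2 (moll (ρ n) (comp i U)))) := by
      have h0 : Tendsto (fun m => (fun i => comp i (ofTest _ (hφ m)) : Fin 3 → L2)) atTop
          (𝓝 fun i => toL2 (moll (ρ n) (comp i U))) := tendsto_pi_nhds.2 hL
      exact ((PiLp.continuous_toLp 2 (fun _ : Fin 3 => L2)).tendsto _).comp h0
    have hin : (WithLp.toLp 2 fun i => toL2 (moll (ρ n) (comp i U)) : Triple) ∈ Sob :=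
      isClosed_Sob.mem_of_tendsto hlimT (Eventually.of_forall fun m => (ofTest _ (hφ m)).2)
    refine ⟨⟨_, hin⟩, ?_, fun i => rfl⟩
    refine mem_closure_of_tendsto (tendsto_subtype_rng.2 hlimT) (Eventually.of_forall fun m => ?_)
    exact ⟨_, hφ m, rfl⟩
  choose! W hWc hW using hstep
  refine isClosed_closure.mem_of_tendsto (b := atTop) (f := W) ?_
    (eventually_atTop.2 ⟨N, fun n hn => hWc n hn⟩)
  rw [tendsto_Sob_iff]
  intro i
  have h1 : Tendsto (fun n => toL2 (moll (ρ (n + N)) (comp i U))) atTop (𝓝 (comp i U)) := by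
    rw [tendsto_toL2_iff fun n => hN (n + N) (by omega) i]
    exact (hconv i).comp (tendsto_add_atTop_nat N)
  rw [← tendsto_add_atTop_iff_nat N]
  exact h1.congr fun n => (hW (n + N) (by omega) i).symm

theorem Sob_induction {p : Sob → Prop} (hp : IsClosed {U | p U})
    (h : ∀ φ hφ, p (ofTest φ hφ)) (U : Sob) : p U := by
  obtain ⟨φ, hφ, hlim⟩ := exists_tendsto_ofTest U
  exact hp.mem_of_tendsto hlim (Eventually.of_forall fun n => h _ _)

theorem denseRange_comp_zero : DenseRange (comp 0) := by
  have : (LinearMap.range (comp 0).toLinearMap).topologicalClosure = ⊤ := by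
    rw [Submodule.topologicalClosure_eq_top_iff, Submodule.eq_bot_iff]
    intro u hu
    refine eq_zero_of_inner_test fun φ hφ => ?_
    exact (Submodule.mem_orthogonal _ u).1 hu _ ⟨ofTest _ hφ.ofReal, rfl⟩
  have h2 := Submodule.dense_iff_topologicalClosure_eq_top.2 this
  exact h2

end Sobolev

/-! ### The curve and its arc length measure -/

section Curve

variable {γ : ℝ → ℝ}

/-- Near `x₀` no other break point occurs, so on each side `γ` is C¹ up to the end points of a
compact interval and its derivative is bounded there. -/
theorem IsPiecewiseC1.exists_deriv_bound_nhds (h : IsPiecewiseC1 γ) (x₀ : ℝ) :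
    ∃ L, ∀ᶠ x in 𝓝 x₀, |deriv γ x| ≤ L := by
  obtain ⟨S, hS⟩ := h
  have hfin : ((S : Set ℝ) \ {x₀}).Finite := S.finite_toSet.subset sdiff_subset
  have hnhds : ((S : Set ℝ) \ {x₀})ᶜ ∈ 𝓝 x₀ :=
    hfin.isClosed.isOpen_compl.mem_nhds (by simp)
  obtain ⟨r, hr, hball⟩ := Metric.mem_nhds_iff.1 hnhds
  have key : ∀ c d : ℝ, c < d → Ioo c d ⊆ Metric.ball x₀ r → x₀ ∉ Ioo c d →
      ∃ M, ∀ x ∈ Ioo c d, |deriv γ x| ≤ M := by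
    intro c d hcd hsub hx₀
    have hdis : Disjoint (Ioo c d) (S : Set ℝ) := by
      rw [Set.disjoint_left]
      intro x hx hxS
      exact hball (hsub hx) ⟨hxS, fun hxx => hx₀ (by rwa [mem_singleton_iff.1 hxx] at hx)⟩
    have hcont := (hS c d hcd hdis).continuousOn_derivWithin (uniqueDiffOn_Icc hcd) le_rfl
    obtain ⟨M, hM⟩ := isCompact_Icc.exists_bound_of_continuousOn hcont
    refine ⟨M, fun x hx => ?_⟩
    have := hM x (Ioo_subset_Icc_self hx)
    rwa [derivWithin_of_mem_nhds (Icc_mem_nhds hx.1 hx.2), Real.norm_eq_abs] at this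
  obtain ⟨M1, hM1⟩ := key (x₀ - r) x₀ (by linarith)
    (fun x hx => by rw [Real.ball_eq_Ioo]; exact ⟨hx.1, by linarith [hx.2]⟩) (fun h => lt_irrefl _ h.2)
  obtain ⟨M2, hM2⟩ := key x₀ (x₀ + r) (by linarith)
    (fun x hx => by rw [Real.ball_eq_Ioo]; exact ⟨by linarith [hx.1], hx.2⟩) (fun h => lt_irrefl _ h.1)
  -- At `x₀` itself the derivative may not exist; whatever value `deriv` takes there is included in
  -- the maximum.
  refine ⟨max |deriv γ x₀| (max M1 M2), ?_⟩
  filter_upwards [Metric.ball_mem_nhds x₀ hr] with x hx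
  rw [Real.ball_eq_Ioo] at hx
  rcases lt_trichotomy x x₀ with hlt | rfl | hgt
  · exact (hM1 x ⟨hx.1, hlt⟩).trans ((le_max_left _ _).trans (le_max_right _ _))
  · exact le_max_left _ _
  · exact (hM2 x ⟨hgt, hx.2⟩).trans ((le_max_right _ _).trans (le_max_right _ _))

theorem deriv_eq_one_of_lt {a : ℝ} (hout : ∀ x, a ≤ |x| → γ x = x) {x : ℝ} (hx : a < |x|) :
    deriv γ x = 1 := by
  have : γ =ᶠ[𝓝 x] id := by
    filter_upwards [(isOpen_lt continuous_const continuous_abs).mem_nhds hx] with y hy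
    exact hout y (le_of_lt hy)
  rw [this.deriv_eq, deriv_id]

theorem IsPiecewiseC1.exists_deriv_bound (h : IsPiecewiseC1 γ) {a : ℝ}
    (hout : ∀ x, a ≤ |x| → γ x = x) : ∃ L, 1 ≤ L ∧ ∀ x, |deriv γ x| ≤ L := by
  have hK : ∃ M, ∀ x ∈ Icc (-a) a, |deriv γ x| ≤ M := by
    refine isCompact_Icc.induction_on (p := fun s => ∃ M, ∀ x ∈ s, |deriv γ x| ≤ M)
      ⟨0, by simp⟩ (fun s t hst ⟨M, hM⟩ => ⟨M, fun x hx => hM x (hst hx)⟩)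
      (fun s t ⟨M, hM⟩ ⟨M', hM'⟩ => ⟨max M M', ?_⟩) fun x _ => ?_
    · rintro x (hx | hx)
      · exact (hM x hx).trans (le_max_left _ _)
      · exact (hM' x hx).trans (le_max_right _ _)
    · obtain ⟨M, hM⟩ := h.exists_deriv_bound_nhds x
      exact ⟨_, mem_nhdsWithin_of_mem_nhds hM, M, fun y hy => hy⟩
  obtain ⟨M, hM⟩ := hK
  refine ⟨max 1 M, le_max_left _ _, fun x => ?_⟩
  by_cases hx : |x| ≤ a
  · exact (hM x (abs_le.1 hx)).trans (le_max_right _ _)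
  · rw [deriv_eq_one_of_lt hout (not_le.1 hx), abs_one]
    exact le_max_left _ _

theorem measurable_arcLength_density :
    Measurable fun x => ENNReal.ofReal (Real.sqrt (1 + (deriv γ x) ^ 2)) :=
  ((((measurable_deriv γ).pow_const 2).const_add 1).sqrt).ennreal_ofReal

theorem sqrt_density_le {L : ℝ} (hL : ∀ x, |deriv γ x| ≤ L) (x : ℝ) :
    Real.sqrt (1 + (deriv γ x) ^ 2) ≤ Real.sqrt (1 + L ^ 2) := by
  refine Real.sqrt_le_sqrt (add_le_add le_rfl ?_)
  exact sq_le_sq' (abs_le.1 (hL x)).1 (abs_le.1 (hL x)).2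

theorem isFiniteMeasureOnCompacts_arcLength (hγ : Continuous γ) {L : ℝ}
    (hL : ∀ x, |deriv γ x| ≤ L) : IsFiniteMeasureOnCompacts (arcLength γ) := by
  have hm : Measurable fun x => (x, γ x) := by fun_prop
  refine ⟨fun K hK => ?_⟩
  rw [arcLength, Measure.map_apply hm hK.measurableSet,
    withDensity_apply _ (hm hK.measurableSet)]
  have hsub : (fun x => (x, γ x)) ⁻¹' K ⊆ Prod.fst '' K := fun x hx => ⟨_, hx, rfl⟩
  have hcomp : IsCompact (Prod.fst '' K) := hK.image continuous_fst
  calc _ ≤ ∫⁻ x in (fun x => (x, γ x)) ⁻¹' K, ENNReal.ofReal (Real.sqrt (1 + L ^ 2)) :=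
        lintegral_mono fun x => ENNReal.ofReal_le_ofReal (sqrt_density_le hL x)
    _ = ENNReal.ofReal (Real.sqrt (1 + L ^ 2)) * volume ((fun x => (x, γ x)) ⁻¹' K) := by
        rw [setLIntegral_const]
    _ ≤ ENNReal.ofReal (Real.sqrt (1 + L ^ 2)) * volume (Prod.fst '' K) := by gcongr
    _ < ⊤ := ENNReal.mul_lt_top ENNReal.ofReal_lt_top hcomp.measure_lt_top

theorem integral_arcLength {E : Type*} [NormedAddCommGroup E] [NormedSpace ℝ E]
    (hγ : Continuous γ) {F : Plane → E} (hF : StronglyMeasurable F) :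
    ∫ p, F p ∂(arcLength γ) = ∫ x, Real.sqrt (1 + (deriv γ x) ^ 2) • F (x, γ x) := by
  rw [arcLength, integral_map (by fun_prop) hF.aestronglyMeasurable,
    integral_withDensity_eq_integral_toReal_smul measurable_arcLength_density (by simp)]
  refine integral_congr_ae (Eventually.of_forall fun x => ?_)
  simp only
  rw [ENNReal.toReal_ofReal (Real.sqrt_nonneg _)]

theorem isClosedEmbedding_graph (hγ : Continuous γ) :
    Topology.IsClosedEmbedding fun x : ℝ => (x, γ x) := by
  refine Topology.IsClosedEmbedding.of_continuous_injective_isClosedMap (by fun_prop)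
    (fun x y h => (Prod.mk.inj h).1) fun s hs => ?_
  have : (fun x : ℝ => (x, γ x)) '' s = {p : Plane | p.1 ∈ s ∧ p.2 = γ p.1} := by
    ext p
    constructor
    · rintro ⟨x, hx, rfl⟩; exact ⟨hx, rfl⟩
    · rintro ⟨h1, h2⟩; exact ⟨p.1, h1, by ext <;> simp [h2]⟩
  rw [this]
  exact (hs.preimage continuous_fst).inter (isClosed_eq continuous_snd (hγ.comp continuous_fst))

end Curve

/-! ### Coordinates along and across the diagonal -/

section Rotation

/-- The linear map `(x, t) ↦ (x + t, x - t)`. -/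
def diag : Plane →ₗ[ℝ] Plane :=
  Matrix.toLin (Module.Basis.finTwoProd ℝ) (Module.Basis.finTwoProd ℝ) !![1, 1; 1, -1]

theorem diag_apply (p : Plane) : diag p = (p.1 + p.2, p.1 - p.2) := by
  rw [diag, Matrix.toLin_finTwoProd_apply]
  ext <;> simp [sub_eq_add_neg]

theorem continuous_diag : Continuous diag := by
  have : (diag : Plane → Plane) = fun p => (p.1 + p.2, p.1 - p.2) := funext diag_apply
  rw [this]; fun_prop

theorem injective_diag : Function.Injective diag := by
  intro p q h
  rw [diag_apply, diag_apply, Prod.mk.injEq] at h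
  ext <;> linarith [h.1, h.2]

theorem measurableEmbedding_diag : MeasurableEmbedding diag :=
  continuous_diag.measurableEmbedding injective_diag

theorem map_diag_volume : (volume : Measure Plane).map diag = ENNReal.ofReal (1 / 2) • volume := by
  have hdet : LinearMap.det diag = -2 := by
    rw [diag, LinearMap.det_toLin, Matrix.det_fin_two_of]; norm_num
  rw [Measure.map_linearMap_addHaar_eq_smul_addHaar _ (by rw [hdet]; norm_num), hdet]
  norm_num [abs_of_neg]

theorem setIntegral_diag {E : Type*} [NormedAddCommGroup E] [NormedSpace ℝ E]
    (f : Plane → E) (s : Set Plane) :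
    ∫ p in diag ⁻¹' s, f (diag p) = (1 / 2 : ℝ) • ∫ p in s, f p := by
  rw [← measurableEmbedding_diag.setIntegral_map, map_diag_volume, Measure.restrict_smul,
    integral_smul_measure, ENNReal.toReal_ofReal (by norm_num)]

theorem integral_diag {E : Type*} [NormedAddCommGroup E] [NormedSpace ℝ E] (f : Plane → E) :
    ∫ p, f (diag p) = (1 / 2 : ℝ) • ∫ p, f p := by
  have := setIntegral_diag f univ
  simpa using this

theorem integrable_comp_diag {E : Type*} [NormedAddCommGroup E]
    {f : Plane → E} (hf : Integrable f) : Integrable fun p => f (diag p) := by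
  have h : Integrable f ((volume : Measure Plane).map diag) := by
    rw [map_diag_volume]
    exact hf.smul_measure (by simp)
  exact (measurableEmbedding_diag.integrable_map_iff).1 h

end Rotation

/-! ### Trace inequalities without magnetic field -/

section KeyInequality

/-- One-dimensional trace inequality on the line. -/
theorem sq_le_integral_abs_mul_deriv {h : ℝ → ℝ} (hh : ContDiff ℝ 1 h) (hc : HasCompactSupport h)
    (x : ℝ) : h x ^ 2 ≤ ∫ t, |h t| * |deriv h t| := by
  have hd : ∀ t, deriv (fun t => h t ^ 2) t = 2 * h t * deriv h t := fun t => by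
    have := ((hh.differentiable (by simp) t).hasDerivAt.fun_pow 2).deriv
    simpa using this
  have hsq : ContDiff ℝ 1 fun t => h t ^ 2 := hh.pow 2
  have hcs : HasCompactSupport fun t => h t ^ 2 :=
    hc.comp_left (g := fun y : ℝ => y ^ 2) (by simp)
  have h1 := hcs.integral_Iic_deriv_eq hsq x
  have h2 := hcs.integral_Ioi_deriv_eq hsq x
  have hint : Integrable fun t => |h t| * |deriv h t| := by
    refine Continuous.integrable_of_hasCompactSupport ?_ ?_
    · exact hh.continuous.abs.mul (hh.continuous_deriv le_rfl).abs
    · exact (hc.comp_left (g := fun y : ℝ => |y|) abs_zero).mul_right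
  have hint2 : Integrable (deriv fun t => h t ^ 2) :=
    (hsq.continuous_deriv le_rfl).integrable_of_hasCompactSupport hcs.deriv
  have hb : ∀ t, |deriv (fun t => h t ^ 2) t| ≤ 2 * (|h t| * |deriv h t|) := fun t => by
    rw [hd, abs_mul, abs_mul, abs_two, mul_assoc]
  -- The value `h x ^ 2` is recovered from the left half-line and again from the right one.
  -- Averaging both gains the factor 1/2 on which the sharp constant `α² / 4` depends.
  have e1 : h x ^ 2 ≤ ∫ t in Iic x, 2 * (|h t| * |deriv h t|) := by
    rw [← h1]
    exact integral_mono hint2.integrableOn (hint.const_mul 2).integrableOn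
      fun t => (le_abs_self _).trans (hb t)
  have e2 : h x ^ 2 ≤ ∫ t in Ioi x, 2 * (|h t| * |deriv h t|) := by
    have : h x ^ 2 = ∫ t in Ioi x, -deriv (fun t => h t ^ 2) t := by
      rw [integral_neg, h2, neg_neg]
    rw [this]
    exact integral_mono hint2.integrableOn.neg (hint.const_mul 2).integrableOn
      fun t => (neg_le_abs _).trans (hb t)
  have e3 := intervalIntegral.integral_Iic_add_Ioi (b := x) (μ := volume)
    (f := fun t => 2 * (|h t| * |deriv h t|)) (hint.const_mul 2).integrableOn
    (hint.const_mul 2).integrableOn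
  have e4 : ∫ t, 2 * (|h t| * |deriv h t|) = 2 * ∫ t, |h t| * |deriv h t| := integral_const_mul _ _
  linarith

/-- One-dimensional trace inequality on an interval. -/
theorem mul_sq_le_setIntegral {h : ℝ → ℝ} (hh : ContDiff ℝ 1 h) {a M : ℝ} (ha : 0 < a)
    (hM : 0 ≤ M) {x : ℝ} (hx : x ∈ Icc (-a) a) :
    M * h x ^ 2 ≤ ∫ t in Icc (-a) a, (deriv h t ^ 2 + (M ^ 2 + M / (2 * a)) * h t ^ 2) := by
  have hd : ∀ t, HasDerivAt (fun t => h t ^ 2) (2 * h t * deriv h t) t := fun t => by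
    have := (hh.differentiable (by simp) t).hasDerivAt.fun_pow 2
    simpa using this
  have hcd : Continuous (deriv h) := hh.continuous_deriv le_rfl
  have hch := hh.continuous
  have hio : ∀ {f : ℝ → ℝ}, Continuous f → IntegrableOn f (Icc (-a) a) := fun hf =>
    hf.integrableOn_Icc
  have hpt : ∀ y ∈ Icc (-a) a, h x ^ 2 ≤ h y ^ 2 + ∫ t in Icc (-a) a, 2 * (|h t| * |deriv h t|) := by
    intro y hy
    have hftc := intervalIntegral.integral_eq_sub_of_hasDerivAt (a := y) (b := x)
      (fun t _ => hd t) (Continuous.intervalIntegrable (by fun_prop) _ _)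
    have hle := intervalIntegral.norm_integral_le_integral_norm_uIoc (a := y) (b := x) (μ := volume)
      (f := fun t => 2 * h t * deriv h t)
    rw [hftc] at hle
    have hle2 : ∫ t in uIoc y x, ‖2 * h t * deriv h t‖ ≤
        ∫ t in Icc (-a) a, 2 * (|h t| * |deriv h t|) := by
      have : ∀ t, ‖2 * h t * deriv h t‖ = 2 * (|h t| * |deriv h t|) := fun t => by
        rw [Real.norm_eq_abs, abs_mul, abs_mul, abs_two, mul_assoc]
      simp_rw [this]
      refine setIntegral_mono_set (hio (by fun_prop)) (Eventually.of_forall fun t => by positivity)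
        (LE.le.eventuallyLE ?_)
      exact uIoc_subset_uIcc.trans (uIcc_subset_Icc hy hx)
    have := (le_abs_self _).trans (hle.trans hle2)
    linarith
  -- Averaging the pointwise bound over `y` turns `h y ^ 2` into `(2a)⁻¹` times its integral.
  have havg : ∫ y in Icc (-a) a, h x ^ 2 ≤ ∫ y in Icc (-a) a,
      (h y ^ 2 + ∫ t in Icc (-a) a, 2 * (|h t| * |deriv h t|)) :=
    setIntegral_mono_on (hio (by fun_prop)) (hio (by fun_prop)) measurableSet_Icc hpt
  rw [integral_add (hio (by fun_prop)) (hio continuous_const), setIntegral_const, setIntegral_const,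
    Real.volume_real_Icc_of_le (by linarith), smul_eq_mul, smul_eq_mul] at havg
  have hA : h x ^ 2 ≤ (2 * a)⁻¹ * (∫ y in Icc (-a) a, h y ^ 2) +
      ∫ t in Icc (-a) a, 2 * (|h t| * |deriv h t|) := by
    have h2a : 0 < 2 * a := by linarith
    have : (2 * a) * h x ^ 2 ≤ (2 * a) * ((2 * a)⁻¹ * (∫ y in Icc (-a) a, h y ^ 2) +
        ∫ t in Icc (-a) a, 2 * (|h t| * |deriv h t|)) := by
      rw [mul_add, mul_inv_cancel_left₀ h2a.ne']
      linarith
    exact le_of_mul_le_mul_left this h2a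
  calc M * h x ^ 2 ≤ M * ((2 * a)⁻¹ * (∫ y in Icc (-a) a, h y ^ 2) +
        ∫ t in Icc (-a) a, 2 * (|h t| * |deriv h t|)) := mul_le_mul_of_nonneg_left hA hM
    _ = ∫ t in Icc (-a) a, (M * (2 * a)⁻¹ * h t ^ 2 + M * (2 * (|h t| * |deriv h t|))) := by
        rw [integral_add (hio (by fun_prop)) (hio (by fun_prop)),
          integral_const_mul (M * (2 * a)⁻¹), integral_const_mul M]
        ring
    _ ≤ _ := by
        refine integral_mono (hio (by fun_prop)) (hio (by fun_prop)) fun t => ?_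
        simp only
        have h1 : M * (2 * (|h t| * |deriv h t|)) ≤ deriv h t ^ 2 + M ^ 2 * h t ^ 2 := by
          nlinarith [sq_nonneg (|deriv h t| - M * |h t|), sq_abs (h t), sq_abs (deriv h t)]
        have h2 : M / (2 * a) = M * (2 * a)⁻¹ := div_eq_mul_inv _ _
        rw [h2]
        linarith

variable {γ : ℝ → ℝ} {a : ℝ}

/-- The gradient term and the multiple of `f ^ 2` that control the trace on the diagonal. -/
theorem outer_trace_le {α : ℝ} (hα : 0 ≤ α) {f : Plane → ℝ} (hf : IsTest f) :
    α * ∫ x in {x : ℝ | a < |x|}, Real.sqrt 2 * f (x, x) ^ 2 ≤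
      ∫ p in {p : Plane | 2 * a < |p.1 + p.2|}, (fderiv ℝ f p (1, 0) ^ 2 +
        fderiv ℝ f p (0, 1) ^ 2 + α ^ 2 / 4 * f p ^ 2) := by
  set g : Plane → ℝ := fun p => fderiv ℝ f p (1, 0) ^ 2 +
        fderiv ℝ f p (0, 1) ^ 2 + α ^ 2 / 4 * f p ^ 2 with hg
  have h1c := (hf.fderiv_apply (1, 0)).continuous
  have h2c := (hf.fderiv_apply (0, 1)).continuous
  have hfc := hf.continuous
  have hsqcs : ∀ {u : Plane → ℝ}, HasCompactSupport u → HasCompactSupport fun p => u p ^ 2 :=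
    fun hu => hu.comp_left (g := fun y : ℝ => y ^ 2) (by simp)
  have hgi : Integrable g := by
    refine Continuous.integrable_of_hasCompactSupport (by fun_prop) ?_
    exact ((hsqcs (hf.fderiv_apply (1, 0)).2).add (hsqcs (hf.fderiv_apply (0, 1)).2)).add
      (hsqcs hf.2).mul_left
  set S : Set ℝ := {x : ℝ | a < |x|} with hS
  have hSm : MeasurableSet S := measurableSet_lt measurable_const measurable_id.abs
  -- In the coordinates of `diag` the two half-planes become `|x| > a`, with the full line as range
  -- of `t`, so each slice carries the sharp inequality on ℝ.
  have hpre : diag ⁻¹' {p : Plane | 2 * a < |p.1 + p.2|} = S ×ˢ univ := by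
    ext p
    simp only [mem_preimage, mem_ofPred_eq, diag_apply, hS, mem_prod, mem_univ, and_true]
    rw [show p.1 + p.2 + (p.1 - p.2) = 2 * p.1 by ring, abs_mul, abs_two]
    exact mul_lt_mul_iff_right₀ zero_lt_two
  have hgd := integrable_comp_diag hgi
  have hcv := setIntegral_diag g {p : Plane | 2 * a < |p.1 + p.2|}
  rw [hpre, Measure.volume_eq_prod, setIntegral_prod _ (by
    rw [← Measure.volume_eq_prod]; exact hgd.integrableOn)] at hcv
  have hR : ∫ p in {p : Plane | 2 * a < |p.1 + p.2|}, g p =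
      ∫ x in S, ∫ t in univ, 2 * g (diag (x, t)) := by
    simp_rw [integral_const_mul]
    rw [hcv, smul_eq_mul, ← Measure.volume_eq_prod]; ring
  rw [hR, ← integral_const_mul]
  have hinner : Integrable fun x => ∫ t in univ, 2 * g (diag (x, t)) := by
    have := (hgd.const_mul 2)
    rw [Measure.volume_eq_prod] at this
    have := this.integral_prod_left
    simpa using this
  have hdiagcs : HasCompactSupport fun x : ℝ => f (x, x) :=
    hf.2.comp_isClosedEmbedding (isClosedEmbedding_graph continuous_id)
  have hlhs : Integrable fun x : ℝ => α * (Real.sqrt 2 * f (x, x) ^ 2) := by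
    refine Continuous.integrable_of_hasCompactSupport (by fun_prop) ?_
    exact ((hdiagcs.comp_left (g := fun y : ℝ => y ^ 2) (by simp)).mul_left).mul_left
  refine integral_mono hlhs.integrableOn hinner.integrableOn fun x => ?_
  simp only [Measure.restrict_univ]
  set h : ℝ → ℝ := fun t => f (diag (x, t)) with hh
  have haff : ∀ t, HasDerivAt (fun t => diag (x, t)) ((1, -1) : Plane) t := by
    intro t
    simp only [diag_apply]
    exact ((hasDerivAt_id t).const_add x).prodMk ((hasDerivAt_id t).const_sub x)
  have hdh : ∀ t, HasDerivAt h (fderiv ℝ f (diag (x, t)) (1, 0) -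
      fderiv ℝ f (diag (x, t)) (0, 1)) t := by
    intro t
    have := (hf.differentiable (diag (x, t))).hasFDerivAt.comp_hasDerivAt t (haff t)
    have e : ((1, -1) : Plane) = (1, 0) - (0, 1) := by ext <;> simp
    rw [e, map_sub] at this
    exact this
  have hsm : ContDiff ℝ 1 h := by
    have : ContDiff ℝ 1 fun t : ℝ => diag (x, t) := by
      simp only [diag_apply]; fun_prop
    exact (hf.1.of_le (by simp)).comp this
  have hcl : Topology.IsClosedEmbedding fun t : ℝ => diag (x, t) := by
    refine (Isometry.of_dist_eq fun s t => ?_).isClosedEmbedding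
    simp only [diag_apply, Prod.dist_eq, dist_add_left, dist_sub_left, max_self]
  have hcs : HasCompactSupport h := hf.2.comp_isClosedEmbedding hcl
  have h0 := sq_le_integral_abs_mul_deriv hsm hcs 0
  have e0 : h 0 = f (x, x) := by simp [hh, diag_apply]
  rw [e0] at h0
  have hint : Integrable fun t => |h t| * |deriv h t| := by
    refine Continuous.integrable_of_hasCompactSupport ?_ ?_
    · exact hsm.continuous.abs.mul (hsm.continuous_deriv le_rfl).abs
    · exact (hcs.comp_left (g := fun y : ℝ => |y|) abs_zero).mul_right
  have hint2 : Integrable fun t => g (diag (x, t)) := by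
    refine Continuous.integrable_of_hasCompactSupport ?_ ?_
    · have : Continuous g := by fun_prop
      exact this.comp hcl.continuous
    · have : HasCompactSupport g :=
        ((hsqcs (hf.fderiv_apply (1, 0)).2).add (hsqcs (hf.fderiv_apply (0, 1)).2)).add
          (hsqcs hf.2).mul_left
      exact this.comp_isClosedEmbedding hcl
  calc α * (Real.sqrt 2 * f (x, x) ^ 2)
      ≤ α * (Real.sqrt 2 * ∫ t, |h t| * |deriv h t|) := by gcongr
    _ = ∫ t, α * (Real.sqrt 2 * (|h t| * |deriv h t|)) := by
        rw [integral_const_mul, integral_const_mul]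
    _ ≤ _ := by
        refine integral_mono ((hint.const_mul _).const_mul _) (hint2.const_mul 2) fun t => ?_
        simp only
        rw [(hdh t).deriv, hg]
        simp only
        set d1 := fderiv ℝ f (diag (x, t)) (1, 0)
        set d2 := fderiv ℝ f (diag (x, t)) (0, 1)
        have hs : Real.sqrt 2 ^ 2 = 2 := Real.sq_sqrt (by norm_num)
        have e1 : f (diag (x, t)) ^ 2 = |h t| ^ 2 := by rw [sq_abs]
        rw [e1]
        -- The derivative of `h` is `d1 - d2`. Completing the square gives `√2 α |h| |d1 - d2| ≤ (d1
        -- - d2)² + α² h² / 2`, and `2 (d1² + d2²)` exceeds `(d1 - d2)²` by `(d1 + d2)²`.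
        nlinarith [sq_nonneg (|d1 - d2| * Real.sqrt 2 - α * |h t|), sq_abs (d1 - d2),
          sq_nonneg (d1 + d2)]

/-- For `|x| ≤ a` the point of the curve lies on the vertical segment over `x` in the box, where the
inequality on an interval applies; `M` absorbs the density of arc length. The squared derivative
keeps the coefficient 1, and only the harmless term on the box gets a large constant. -/
theorem inner_trace_le (ha : 0 < a) (hγ : Continuous γ) (hout : ∀ x, a ≤ |x| → γ x = x)
    (hin : ∀ x, |x| < a → |γ x| ≤ a) {L : ℝ} (hL : ∀ x, |deriv γ x| ≤ L) {α : ℝ} (hα : 0 ≤ α)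
    {f : Plane → ℝ} (hf : IsTest f) {M : ℝ} (hM : M = α * Real.sqrt (1 + L ^ 2)) :
    α * ∫ x in Icc (-a) a, Real.sqrt (1 + deriv γ x ^ 2) * f (x, γ x) ^ 2 ≤
      ∫ p in Icc (-a) a ×ˢ Icc (-a) a, (fderiv ℝ f p (0, 1) ^ 2 +
        (M ^ 2 + M / (2 * a)) * f p ^ 2) := by
  have h2c := (hf.fderiv_apply (0, 1)).continuous
  have hfc := hf.continuous
  have hM0 : 0 ≤ M := by rw [hM]; positivity
  have hcont : Continuous fun p => fderiv ℝ f p (0, 1) ^ 2 + (M ^ 2 + M / (2 * a)) * f p ^ 2 := by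
    fun_prop
  have hio : IntegrableOn (fun p => fderiv ℝ f p (0, 1) ^ 2 + (M ^ 2 + M / (2 * a)) * f p ^ 2)
      (Icc (-a) a ×ˢ Icc (-a) a) volume :=
    hcont.continuousOn.integrableOn_compact (isCompact_Icc.prod isCompact_Icc)
  rw [Measure.volume_eq_prod, setIntegral_prod _ (by rw [← Measure.volume_eq_prod]; exact hio),
    ← integral_const_mul]
  have hd : ∀ x y, deriv (fun y => f (x, y)) y = fderiv ℝ f (x, y) (0, 1) := by
    intro x y
    exact ((hf.differentiable (x, y)).hasFDerivAt.comp_hasDerivAt y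
      ((hasDerivAt_const y x).prodMk (hasDerivAt_id y))).deriv
  have hfx : ∀ x, ContDiff ℝ 1 fun y => f (x, y) := fun x =>
    (hf.1.of_le (by simp)).comp (by fun_prop)
  have hγa : ∀ x ∈ Icc (-a) a, γ x ∈ Icc (-a) a := by
    intro x hx
    rcases lt_or_eq_of_le (abs_le.2 hx) with h | h
    · exact abs_le.1 (hin x h)
    · rw [hout x h.ge]; exact hx
  have hmeas : Measurable fun x => Real.sqrt (1 + deriv γ x ^ 2) :=
    (((measurable_deriv γ).pow_const 2).const_add 1).sqrt
  refine setIntegral_mono_on ?_ ?_ measurableSet_Icc fun x hx => ?_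
  · refine Integrable.const_mul ?_ _
    refine Integrable.bdd_mul (c := Real.sqrt (1 + L ^ 2)) ?_ hmeas.aestronglyMeasurable ?_
    · exact (Continuous.integrableOn_Icc (by fun_prop))
    · refine Eventually.of_forall fun x => ?_
      rw [Real.norm_of_nonneg (Real.sqrt_nonneg _)]
      exact sqrt_density_le hL x
  · have : Integrable (fun p => fderiv ℝ f p (0, 1) ^ 2 + (M ^ 2 + M / (2 * a)) * f p ^ 2)
        ((volume.restrict (Icc (-a) a)).prod (volume.restrict (Icc (-a) a))) := by
      rw [Measure.prod_restrict, ← Measure.volume_eq_prod]; exact hio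
    exact this.integral_prod_left
  · have h1 := mul_sq_le_setIntegral (hfx x) ha hM0 (hγa x hx)
    simp only [hd] at h1
    refine le_trans ?_ h1
    rw [hM, ← mul_assoc]
    exact mul_le_mul_of_nonneg_right (mul_le_mul_of_nonneg_left (sqrt_density_le hL x) hα)
      (sq_nonneg _)

/-- The two half-planes `|x + y| > 2a` serve the diagonal part of the curve and the box serves the
rest. The regions are disjoint, so the gradient is spent only once. -/
theorem trace_le_real (ha : 0 < a) (hγ : Continuous γ) (hout : ∀ x, a ≤ |x| → γ x = x)
    (hin : ∀ x, |x| < a → |γ x| ≤ a) {L : ℝ} (hL : ∀ x, |deriv γ x| ≤ L) {α : ℝ} (hα : 0 ≤ α) :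
    ∃ C, 0 ≤ C ∧ ∀ f : Plane → ℝ, IsTest f →
      α * ∫ p, f p ^ 2 ∂(arcLength γ) ≤
        (∫ p, (fderiv ℝ f p (1, 0) ^ 2 + fderiv ℝ f p (0, 1) ^ 2 + α ^ 2 / 4 * f p ^ 2)) +
          C * ∫ p in Icc (-a) a ×ˢ Icc (-a) a, f p ^ 2 := by
  set M := α * Real.sqrt (1 + L ^ 2) with hM
  have hM0 : 0 ≤ M := by rw [hM]; positivity
  refine ⟨M ^ 2 + M / (2 * a), by positivity, fun f hf => ?_⟩
  have h1c := (hf.fderiv_apply (1, 0)).continuous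
  have h2c := (hf.fderiv_apply (0, 1)).continuous
  have hfc := hf.continuous
  set g : Plane → ℝ := fun p => fderiv ℝ f p (1, 0) ^ 2 +
        fderiv ℝ f p (0, 1) ^ 2 + α ^ 2 / 4 * f p ^ 2 with hg
  have hsqcs : ∀ {u : Plane → ℝ}, HasCompactSupport u → HasCompactSupport fun p => u p ^ 2 :=
    fun hu => hu.comp_left (g := fun y : ℝ => y ^ 2) (by simp)
  have hgi : Integrable g := by
    refine Continuous.integrable_of_hasCompactSupport (by fun_prop) ?_
    exact ((hsqcs (hf.fderiv_apply (1, 0)).2).add (hsqcs (hf.fderiv_apply (0, 1)).2)).add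
      (hsqcs hf.2).mul_left
  have hfin := isFiniteMeasureOnCompacts_arcLength hγ hL
  have hdens : Measurable fun x => Real.sqrt (1 + deriv γ x ^ 2) :=
    (((measurable_deriv γ).pow_const 2).const_add 1).sqrt
  have hcl := isClosedEmbedding_graph hγ
  have hint : Integrable fun x => Real.sqrt (1 + deriv γ x ^ 2) * f (x, γ x) ^ 2 := by
    refine Integrable.bdd_mul (c := Real.sqrt (1 + L ^ 2)) ?_ hdens.aestronglyMeasurable ?_
    · refine Continuous.integrable_of_hasCompactSupport (by fun_prop) ?_
      exact (hsqcs hf.2).comp_isClosedEmbedding hcl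
    · refine Eventually.of_forall fun x => ?_
      rw [Real.norm_of_nonneg (Real.sqrt_nonneg _)]
      exact sqrt_density_le hL x
  rw [integral_arcLength (F := fun p => f p ^ 2) hγ (hfc.pow 2).stronglyMeasurable]
  simp only [smul_eq_mul]
  have hset : ({x : ℝ | a < |x|} : Set ℝ)ᶜ = Icc (-a) a := by
    ext x; simp [abs_le]
  have hSm : MeasurableSet {x : ℝ | a < |x|} := measurableSet_lt measurable_const measurable_id.abs
  rw [← integral_add_compl hSm hint, hset, mul_add]
  have hout' : ∫ x in {x : ℝ | a < |x|}, Real.sqrt (1 + deriv γ x ^ 2) * f (x, γ x) ^ 2 =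
      ∫ x in {x : ℝ | a < |x|}, Real.sqrt 2 * f (x, x) ^ 2 := by
    refine setIntegral_congr_fun hSm fun x hx => ?_
    rw [deriv_eq_one_of_lt hout hx, hout x (le_of_lt hx)]
    norm_num
  rw [hout']
  have h1 := outer_trace_le (a := a) hα hf
  have h2 := inner_trace_le ha hγ hout hin hL hα hf hM
  set B : Set Plane := Icc (-a) a ×ˢ Icc (-a) a with hB
  have hBm : MeasurableSet B := measurableSet_Icc.prod measurableSet_Icc
  have hBc : IsCompact B := isCompact_Icc.prod isCompact_Icc
  have hTm : MeasurableSet {p : Plane | 2 * a < |p.1 + p.2|} :=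
    measurableSet_lt measurable_const (measurable_fst.add measurable_snd).abs
  have hsub : B ⊆ {p : Plane | 2 * a < |p.1 + p.2|}ᶜ := by
    rintro p ⟨hp1, hp2⟩
    simp only [mem_compl_iff, mem_ofPred_eq, not_lt]
    exact (abs_add_le _ _).trans (by linarith [abs_le.2 hp1, abs_le.2 hp2])
  have hio : ∀ {u : Plane → ℝ}, Continuous u → IntegrableOn u B := fun hu =>
    hu.continuousOn.integrableOn_compact hBc
  have h3 : ∫ p in B, (fderiv ℝ f p (0, 1) ^ 2 + (M ^ 2 + M / (2 * a)) * f p ^ 2) ≤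
      (∫ p in {p : Plane | 2 * a < |p.1 + p.2|}ᶜ, g p) +
        (M ^ 2 + M / (2 * a)) * ∫ p in B, f p ^ 2 := by
    rw [integral_add (hio (by fun_prop)) (hio (by fun_prop)), integral_const_mul]
    refine add_le_add ?_ le_rfl
    calc ∫ p in B, fderiv ℝ f p (0, 1) ^ 2 ≤ ∫ p in B, g p := by
          refine integral_mono (hio (by fun_prop)) hgi.integrableOn fun p => ?_
          simp only [hg]
          nlinarith [sq_nonneg (fderiv ℝ f p (1, 0)), sq_nonneg (α * f p)]
      _ ≤ _ := setIntegral_mono_set hgi.integrableOn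
          (Eventually.of_forall fun p => by simp only [hg, Pi.zero_apply]; positivity)
          hsub.eventuallyLE
  have h4 := integral_add_compl hTm hgi
  linarith

end KeyInequality

/-! ### Multiplication operators from H¹ to L² -/

section Multiplication

/-- Multiplication by `c` as a map from `H¹(ℝ²)` to `L²(ℝ²)`. -/
def mulLin (c : Plane → ℝ) (hc : ∀ U : Sob, MemLp (fun p => (c p : ℂ) * comp 0 U p) 2 volume) :
    Sob →ₗ[ℂ] L2 where
  toFun U := toL2 fun p => (c p : ℂ) * comp 0 U p
  map_add' U W := by
    rw [← toL2_add (hc U) (hc W)]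
    refine toL2_congr ?_
    rw [map_add]
    filter_upwards [Lp.coeFn_add (comp 0 U) (comp 0 W)] with p hp
    rw [hp, Pi.add_apply, mul_add]
  map_smul' k U := by
    rw [RingHom.id_apply, ← toL2_const_mul (hc U)]
    refine toL2_congr ?_
    rw [map_smul]
    filter_upwards [Lp.coeFn_smul k (comp 0 U)] with p hp
    rw [hp, Pi.smul_apply, smul_eq_mul]; ring

theorem exists_subseq_tendsto_ae {u : ℕ → L2} {v : L2} (h : Tendsto u atTop (𝓝 v)) :
    ∃ ns : ℕ → ℕ, StrictMono ns ∧
      ∀ᵐ p, Tendsto (fun i => u (ns i) p) atTop (𝓝 (v p)) :=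
  (tendstoInMeasure_of_tendsto_Lp h).exists_seq_tendsto_ae

/-- Multiplication by `c` is bounded from `H¹(ℝ²)` to `L²(ℝ²)`, by the closed graph theorem. -/
def mulOp (c : Plane → ℝ) (hc : ∀ U : Sob, MemLp (fun p => (c p : ℂ) * comp 0 U p) 2 volume) :
    Sob →L[ℂ] L2 :=
  ContinuousLinearMap.ofSeqClosedGraph (g := mulLin c hc) (by
    intro U x y hU hy
    -- Along a common subsequence both L² limits are pointwise limits almost everywhere, which
    -- identifies the limit of the products.
    obtain ⟨ns, hns, h1⟩ := exists_subseq_tendsto_ae (((comp 0).continuous.tendsto x).comp hU)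
    obtain ⟨ms, hms, h2⟩ := exists_subseq_tendsto_ae (hy.comp hns.tendsto_atTop)
    refine Lp.ext ?_
    have h3 : ∀ᵐ p, ∀ n, mulLin c hc (U n) p = (c p : ℂ) * comp 0 (U n) p :=
      ae_all_iff.2 fun n => coeFn_toL2 (hc (U n))
    filter_upwards [h1, h2, h3, coeFn_toL2 (hc x)] with p h1 h2 h3 h4
    refine tendsto_nhds_unique h2 ?_
    change Tendsto _ _ (𝓝 (toL2 (fun p => (c p : ℂ) * comp 0 x p) p))
    rw [h4]
    have := ((h1.comp hms.tendsto_atTop).const_mul (c p : ℂ))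
    refine this.congr fun i => ?_
    simp only [Function.comp_apply, h3])

theorem mulOp_apply (c : Plane → ℝ)
    (hc : ∀ U : Sob, MemLp (fun p => (c p : ℂ) * comp 0 U p) 2 volume) (U : Sob) :
    mulOp c hc U = toL2 fun p => (c p : ℂ) * comp 0 U p := rfl

end Multiplication

/-! ### The diamagnetic inequality and its consequences -/

section Diamagnetic

/-- A smooth compactly supported regularization of `‖ψ‖`. -/
def regNorm (ε : ℝ) (ψ : Plane → ℂ) (p : Plane) : ℝ :=
  Real.sqrt ((ψ p).re ^ 2 + (ψ p).im ^ 2 + ε ^ 2) - ε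

variable {ψ : Plane → ℂ} {ε : ℝ}

theorem isTest_regNorm (hψ : IsTest ψ) (hε : 0 < ε) : IsTest (regNorm ε ψ) := by
  constructor
  · refine ContDiff.sub (ContDiff.sqrt ?_ fun p => by positivity) contDiff_const
    exact (((Complex.reCLM.contDiff.comp hψ.1).pow 2).add
      ((Complex.imCLM.contDiff.comp hψ.1).pow 2)).add contDiff_const
  · exact hψ.2.comp_left (g := fun z : ℂ => Real.sqrt (z.re ^ 2 + z.im ^ 2 + ε ^ 2) - ε)
      (by simp [Real.sqrt_sq hε.le])

theorem re_sq_add_im_sq (z : ℂ) : z.re ^ 2 + z.im ^ 2 = ‖z‖ ^ 2 := by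
  rw [Complex.sq_norm, Complex.normSq_apply]; ring

theorem regNorm_eq (p : Plane) : regNorm ε ψ p = Real.sqrt (‖ψ p‖ ^ 2 + ε ^ 2) - ε := by
  rw [regNorm, re_sq_add_im_sq]

theorem regNorm_nonneg (p : Plane) : 0 ≤ regNorm ε ψ p := by
  rw [regNorm_eq, sub_nonneg]
  exact Real.le_sqrt_of_sq_le (le_add_of_nonneg_left (sq_nonneg _))

theorem regNorm_le (hε : 0 ≤ ε) (p : Plane) : regNorm ε ψ p ≤ ‖ψ p‖ := by
  rw [regNorm_eq, sub_le_iff_le_add]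
  refine Real.sqrt_le_iff.2 ⟨by positivity, ?_⟩
  nlinarith [mul_nonneg (norm_nonneg (ψ p)) hε]

theorem regNorm_sq_le (hε : 0 ≤ ε) (p : Plane) : regNorm ε ψ p ^ 2 ≤ ‖ψ p‖ ^ 2 :=
  pow_le_pow_left₀ (regNorm_nonneg p) (regNorm_le hε p) 2

theorem tendsto_regNorm (ψ : Plane → ℂ) (p : Plane) :
    Tendsto (fun n : ℕ => regNorm (1 / ((n : ℝ) + 1)) ψ p) atTop (𝓝 ‖ψ p‖) := by
  have hc : Continuous fun ε : ℝ => Real.sqrt (‖ψ p‖ ^ 2 + ε ^ 2) - ε := by fun_prop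
  have h := (hc.tendsto 0).comp (tendsto_one_div_add_atTop_nhds_zero_nat (𝕜 := ℝ))
  simp only [ne_eq, OfNat.ofNat_ne_zero, not_false_eq_true, zero_pow, add_zero, sub_zero,
    Real.sqrt_sq (norm_nonneg _)] at h
  exact h.congr fun n => (regNorm_eq p).symm

/-- The diamagnetic inequality. -/
theorem abs_fderiv_regNorm_le (hψ : IsTest ψ) (hε : 0 < ε) (p e : Plane) (c : ℝ) :
    |fderiv ℝ (regNorm ε ψ) p e| ≤ ‖Complex.I * fderiv ℝ ψ p e + (c : ℂ) * ψ p‖ := by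
  set d := fderiv ℝ ψ p e with hd
  have hψd := (hψ.differentiable p).hasFDerivAt
  have hre : HasFDerivAt (fun p => (ψ p).re) (Complex.reCLM.comp (fderiv ℝ ψ p)) p :=
    Complex.reCLM.hasFDerivAt.comp p hψd
  have him : HasFDerivAt (fun p => (ψ p).im) (Complex.imCLM.comp (fderiv ℝ ψ p)) p :=
    Complex.imCLM.hasFDerivAt.comp p hψd
  have hN := ((hre.pow 2).fun_add (him.pow 2)).add_const (ε ^ 2)
  have hpos : 0 < (ψ p).re ^ 2 + (ψ p).im ^ 2 + ε ^ 2 := by positivity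
  have hs := (hN.sqrt hpos.ne').sub_const ε
  have hs' : HasFDerivAt (regNorm ε ψ) _ p := hs
  rw [hs'.fderiv]
  simp only [smul_apply, add_apply, ContinuousLinearMap.comp_apply,
    Complex.reCLM_apply, Complex.imCLM_apply, smul_eq_mul, nsmul_eq_mul, Nat.cast_ofNat,
    ← hd, Nat.add_one_sub_one, pow_one]
  set s := Real.sqrt ((ψ p).re ^ 2 + (ψ p).im ^ 2 + ε ^ 2) with hs
  have hs0 : 0 < s := Real.sqrt_pos.2 hpos
  have hsψ : ‖ψ p‖ ≤ s := by
    rw [hs, re_sq_add_im_sq]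
    exact Real.le_sqrt_of_sq_le (le_add_of_nonneg_right (sq_nonneg _))
  -- Taking the imaginary part of `conj ψ * (i∂ψ + cψ)` removes the real potential and leaves half
  -- the derivative of `‖ψ‖²`.
  have him2 : (conj (ψ p) * (Complex.I * d + (c : ℂ) * ψ p)).im =
      (ψ p).re * d.re + (ψ p).im * d.im := by
    simp [Complex.mul_im, Complex.mul_re]; ring
  have hle : |(ψ p).re * d.re + (ψ p).im * d.im| ≤ s * ‖Complex.I * d + (c : ℂ) * ψ p‖ := by
    rw [← him2]
    refine (Complex.abs_im_le_norm _).trans ?_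
    rw [norm_mul, Complex.norm_conj]
    gcongr
  have heq : 1 / (2 * s) * (2 * (ψ p).re * d.re + 2 * (ψ p).im * d.im) =
      ((ψ p).re * d.re + (ψ p).im * d.im) / s := by
    field_simp
  rw [heq, abs_div, abs_of_pos hs0, div_le_iff₀ hs0, mul_comm _ s]
  exact hle

variable {γ : ℝ → ℝ} {a : ℝ}

theorem sq_fderiv_regNorm_le (hψ : IsTest ψ) (hε : 0 < ε) (p e : Plane) (c : ℝ) :
    fderiv ℝ (regNorm ε ψ) p e ^ 2 ≤ ‖Complex.I * fderiv ℝ ψ p e + (c : ℂ) * ψ p‖ ^ 2 := by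
  rw [← sq_abs]
  exact pow_le_pow_left₀ (abs_nonneg _) (abs_fderiv_regNorm_le hψ hε p e c) 2

theorem integrable_norm_sq {f : Plane → ℂ} (hf : MemLp f 2 volume) :
    Integrable fun p => ‖f p‖ ^ 2 := hf.integrable_norm_pow (by norm_num)

/-- The magnetic trace inequality. -/
theorem trace_le (ha : 0 < a) (hγ : Continuous γ) (hout : ∀ x, a ≤ |x| → γ x = x)
    (hin : ∀ x, |x| < a → |γ x| ≤ a) {L : ℝ} (hL : ∀ x, |deriv γ x| ≤ L) {α : ℝ} (hα : 0 ≤ α) :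
    ∃ C, 0 ≤ C ∧ ∀ (c₁ c₂ : Plane → ℝ) (ψ : Plane → ℂ), IsTest ψ →
      MemLp (fun p => Complex.I * fderiv ℝ ψ p (1, 0) + (c₁ p : ℂ) * ψ p) 2 volume →
      MemLp (fun p => Complex.I * fderiv ℝ ψ p (0, 1) + (c₂ p : ℂ) * ψ p) 2 volume →
      α * ∫ p, ‖ψ p‖ ^ 2 ∂(arcLength γ) ≤
        (∫ p, ‖Complex.I * fderiv ℝ ψ p (1, 0) + (c₁ p : ℂ) * ψ p‖ ^ 2) +
        (∫ p, ‖Complex.I * fderiv ℝ ψ p (0, 1) + (c₂ p : ℂ) * ψ p‖ ^ 2) +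
        α ^ 2 / 4 * (∫ p, ‖ψ p‖ ^ 2) + C * ∫ p in Icc (-a) a ×ˢ Icc (-a) a, ‖ψ p‖ ^ 2 := by
  obtain ⟨C, hC0, hC⟩ := trace_le_real ha hγ hout hin hL hα
  refine ⟨C, hC0, fun c₁ c₂ ψ hψ h1 h2 => ?_⟩
  have hfin := isFiniteMeasureOnCompacts_arcLength hγ hL
  have hψi : Integrable fun p => ‖ψ p‖ ^ 2 := integrable_norm_sq (hψ.memLp 2 volume)
  have hψΓ : Integrable (fun p => ‖ψ p‖ ^ 2) (arcLength γ) :=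
    (hψ.memLp 2 (arcLength γ)).integrable_norm_pow (by norm_num)
  have hpos : ∀ n : ℕ, 0 < 1 / ((n : ℝ) + 1) := fun n => by positivity
  have hlim : Tendsto (fun n : ℕ => α * ∫ p, regNorm (1 / ((n : ℝ) + 1)) ψ p ^ 2 ∂(arcLength γ))
      atTop (𝓝 (α * ∫ p, ‖ψ p‖ ^ 2 ∂(arcLength γ))) := by
    refine Tendsto.const_mul _ (tendsto_integral_of_dominated_convergence (fun p => ‖ψ p‖ ^ 2)
      (fun n => ?_) hψΓ (fun n => Eventually.of_forall fun p => ?_)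
      (Eventually.of_forall fun p => (tendsto_regNorm ψ p).pow 2))
    · exact ((isTest_regNorm hψ (hpos n)).continuous.pow 2).aestronglyMeasurable
    · rw [Real.norm_of_nonneg (sq_nonneg _)]
      exact regNorm_sq_le (hpos n).le p
  -- Only the left side has to pass to the limit: the right side is bounded by the magnetic
  -- quantities uniformly in the regularization.
  refine le_of_tendsto' hlim fun n => ?_
  have hm := isTest_regNorm hψ (hpos n)
  refine (hC _ hm).trans (add_le_add ?_ (mul_le_mul_of_nonneg_left ?_ hC0))
  · have hi1 := integrable_norm_sq h1
    have hi2 := integrable_norm_sq h2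
    set d₁ : Plane → ℂ := fun p => Complex.I * fderiv ℝ ψ p (1, 0) + (c₁ p : ℂ) * ψ p with hd₁
    set d₂ : Plane → ℂ := fun p => Complex.I * fderiv ℝ ψ p (0, 1) + (c₂ p : ℂ) * ψ p with hd₂
    have heq : (∫ p, ‖d₁ p‖ ^ 2) + (∫ p, ‖d₂ p‖ ^ 2) + α ^ 2 / 4 * (∫ p, ‖ψ p‖ ^ 2) =
        ∫ p, (‖d₁ p‖ ^ 2 + ‖d₂ p‖ ^ 2 + α ^ 2 / 4 * ‖ψ p‖ ^ 2) := by
      rw [integral_add (hi1.fun_add hi2) (hψi.const_mul _), integral_add hi1 hi2,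
        integral_const_mul]
    rw [heq]
    refine integral_mono_of_nonneg (Eventually.of_forall fun p => ?_)
      ((hi1.fun_add hi2).fun_add (hψi.const_mul _)) (Eventually.of_forall fun p => ?_)
    · simp only [Pi.zero_apply]; positivity
    · exact add_le_add (add_le_add (sq_fderiv_regNorm_le hψ (hpos n) p _ _)
        (sq_fderiv_regNorm_le hψ (hpos n) p _ _))
        (mul_le_mul_of_nonneg_left (regNorm_sq_le (hpos n).le p) (by positivity))
  · refine integral_mono_of_nonneg (Eventually.of_forall fun p => sq_nonneg _) hψi.integrableOn
      (Eventually.of_forall fun p => regNorm_sq_le (hpos n).le p)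

/-- Multiplication by `c` is bounded with respect to the magnetic Sobolev norm. -/
theorem norm_mulOp_sq_le (c c₁ c₂ : Plane → ℝ)
    (hc : ∀ U : Sob, MemLp (fun p => (c p : ℂ) * comp 0 U p) 2 volume) (hψ : IsTest ψ)
    (h1 : MemLp (fun p => Complex.I * fderiv ℝ ψ p (1, 0) + (c₁ p : ℂ) * ψ p) 2 volume)
    (h2 : MemLp (fun p => Complex.I * fderiv ℝ ψ p (0, 1) + (c₂ p : ℂ) * ψ p) 2 volume) :
    ‖mulOp c hc (ofTest ψ hψ)‖ ^ 2 ≤ ‖mulOp c hc‖ ^ 2 * ((∫ p, ‖ψ p‖ ^ 2) +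
      (∫ p, ‖Complex.I * fderiv ℝ ψ p (1, 0) + (c₁ p : ℂ) * ψ p‖ ^ 2) +
      (∫ p, ‖Complex.I * fderiv ℝ ψ p (0, 1) + (c₂ p : ℂ) * ψ p‖ ^ 2)) := by
  have hval : ∀ (φ : Plane → ℂ) (hφ : IsTest φ), MemLp (fun p => (c p : ℂ) * φ p) 2 volume ∧
      ‖mulOp c hc (ofTest φ hφ)‖ ^ 2 = ∫ p, ‖(c p : ℂ) * φ p‖ ^ 2 := by
    intro φ hφ
    have hae : (fun p => (c p : ℂ) * comp 0 (ofTest φ hφ) p) =ᵐ[volume] fun p => (c p : ℂ) * φ p := by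
      filter_upwards [coeFn_toL2 (hφ.memLp 2 volume)] with p hp
      rw [comp_zero_ofTest, hp]
    have hm := (hc (ofTest φ hφ)).ae_eq hae
    refine ⟨hm, ?_⟩
    rw [mulOp_apply, toL2_congr hae, norm_toL2_sq hm]
  have hpos : ∀ n : ℕ, 0 < 1 / ((n : ℝ) + 1) := fun n => by positivity
  have hm := fun n => isTest_regNorm hψ (hpos n)
  -- The norm of `c ψ` depends only on the modulus of `ψ`, so the bound on H¹ may be used at the
  -- regularized modulus, whose gradient is at most the magnetic one.
  have hlim : Tendsto (fun n : ℕ => ‖mulOp c hc (ofTest _ (hm n).ofReal)‖ ^ 2) atTop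
      (𝓝 (‖mulOp c hc (ofTest ψ hψ)‖ ^ 2)) := by
    rw [(hval ψ hψ).2]
    simp_rw [(hval _ (hm _).ofReal).2]
    refine tendsto_integral_of_dominated_convergence (fun p => ‖(c p : ℂ) * ψ p‖ ^ 2)
      (fun n => ?_) (integrable_norm_sq (hval ψ hψ).1) (fun n => Eventually.of_forall fun p => ?_)
      (Eventually.of_forall fun p => ?_)
    · exact (hval _ (hm n).ofReal).1.1.norm.pow 2
    · rw [norm_pow, norm_norm, norm_mul, norm_mul, Complex.norm_real (regNorm _ _ _),
        Real.norm_of_nonneg (regNorm_nonneg p)]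
      gcongr
      · exact mul_nonneg (norm_nonneg _) (regNorm_nonneg p)
      · exact regNorm_le (hpos n).le p
    · have := ((tendsto_regNorm ψ p).const_mul ‖(c p : ℂ)‖).pow 2
      rw [norm_mul]
      refine this.congr fun n => ?_
      rw [norm_mul, Complex.norm_real (regNorm _ _ _),
        Real.norm_of_nonneg (regNorm_nonneg p)]
  refine le_of_tendsto' hlim fun n => ?_
  refine (pow_le_pow_left₀ (norm_nonneg _) ((mulOp c hc).le_opNorm _) 2).trans ?_
  rw [mul_pow, norm_sq_Sob, comp_zero_ofTest, comp_one_ofTest, comp_two_ofTest,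
    norm_toL2_sq ((hm n).ofReal.memLp 2 volume),
    norm_toL2_sq (((hm n).ofReal.fderiv_apply _).memLp 2 volume),
    norm_toL2_sq (((hm n).ofReal.fderiv_apply _).memLp 2 volume)]
  refine mul_le_mul_of_nonneg_left (add_le_add (add_le_add ?_ ?_) ?_) (sq_nonneg _)
  · refine integral_mono_of_nonneg (Eventually.of_forall fun p => sq_nonneg _)
      (integrable_norm_sq (hψ.memLp 2 volume)) (Eventually.of_forall fun p => ?_)
    simp only
    rw [Complex.norm_real, Real.norm_eq_abs, sq_abs]
    exact regNorm_sq_le (hpos n).le p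
  · refine integral_mono_of_nonneg (Eventually.of_forall fun p => sq_nonneg _)
      (integrable_norm_sq h1) (Eventually.of_forall fun p => ?_)
    simp only
    rw [fderiv_ofReal_apply (hm n), Complex.norm_real, Real.norm_eq_abs, sq_abs]
    exact sq_fderiv_regNorm_le hψ (hpos n) p _ _
  · refine integral_mono_of_nonneg (Eventually.of_forall fun p => sq_nonneg _)
      (integrable_norm_sq h2) (Eventually.of_forall fun p => ?_)
    simp only
    rw [fderiv_ofReal_apply (hm n), Complex.norm_real, Real.norm_eq_abs, sq_abs]
    exact sq_fderiv_regNorm_le hψ (hpos n) p _ _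

end Diamagnetic

/-! ### The trace as a bounded operator -/

section Trace

variable {γ : ℝ → ℝ}

theorem sub_ofTest {φ ψ : Plane → ℂ} (hφ : IsTest φ) (hψ : IsTest ψ) :
    ofTest φ hφ - ofTest ψ hψ = ofTest _ (hφ.sub hψ) := by
  apply comp_zero_injective
  rw [map_sub, comp_zero_ofTest, comp_zero_ofTest, comp_zero_ofTest,
    toL2_sub (hφ.memLp 2 volume) (hψ.memLp 2 volume)]

theorem add_ofTest {φ ψ : Plane → ℂ} (hφ : IsTest φ) (hψ : IsTest ψ) :
    ofTest φ hφ + ofTest ψ hψ = ofTest _ (hφ.add hψ) := by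
  apply comp_zero_injective
  rw [map_add, comp_zero_ofTest, comp_zero_ofTest, comp_zero_ofTest,
    toL2_add (hφ.memLp 2 volume) (hψ.memLp 2 volume)]

theorem smul_ofTest {φ : Plane → ℂ} (hφ : IsTest φ) (c : ℂ) :
    c • ofTest φ hφ = ofTest _ (hφ.const_mul c) := by
  apply comp_zero_injective
  rw [map_smul, comp_zero_ofTest, comp_zero_ofTest, toL2_const_mul (hφ.memLp 2 volume)]

/-- Stated with limits in Hilbert spaces, the definition inherits linearity and norm bounds from
continuity. -/
theorem isTrace_iff [IsFiniteMeasureOnCompacts (arcLength γ)] {U : Sob}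
    {t : Lp ℂ 2 (arcLength γ)} : IsTrace γ (comp 0 U) t ↔
    ∃ (φ : ℕ → Plane → ℂ) (hφ : ∀ n, IsTest (φ n)),
      Tendsto (fun n => ofTest (φ n) (hφ n)) atTop (𝓝 U) ∧
      Tendsto (fun n => ((hφ n).memLp 2 (arcLength γ)).toLp (φ n)) atTop (𝓝 t) := by
  have hΓ : ∀ (φ : ℕ → Plane → ℂ) (hφ : ∀ n, IsTest (φ n)),
      Tendsto (fun n => ((hφ n).memLp 2 (arcLength γ)).toLp (φ n)) atTop (𝓝 t) ↔
      Tendsto (fun n => eLpNorm (fun p => φ n p - t p) 2 (arcLength γ)) atTop (𝓝 0) := by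
    intro φ hφ
    rw [tendsto_iff_edist_tendsto_0]
    refine iff_of_eq (congrArg (fun g => Tendsto g atTop (𝓝 0)) (funext fun i => ?_))
    rw [Lp.edist_def]
    refine eLpNorm_congr_ae ?_
    filter_upwards [((hφ i).memLp 2 (arcLength γ)).coeFn_toLp] with p hp
    rw [Pi.sub_apply, hp]
  have hV : ∀ (φ : ℕ → Plane → ℂ) (hφ : ∀ n, IsTest (φ n)),
      Tendsto (fun n => ofTest (φ n) (hφ n)) atTop (𝓝 U) ↔
      Tendsto (fun n => eLpNorm (fun p => φ n p - comp 0 U p) 2 volume) atTop (𝓝 0) ∧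
      (∀ e ∈ ({(1, 0), (0, 1)} : Set Plane), Tendsto
        (fun n => eLpNorm (fun p => fderiv ℝ (φ n) p e - weakDeriv e (comp 0 U) p) 2 volume)
        atTop (𝓝 0)) := by
    intro φ hφ
    rw [tendsto_Sob_iff, Fin.forall_fin_succ, Fin.forall_fin_two]
    simp only [Set.mem_insert_iff, Set.mem_singleton_iff, forall_eq_or_imp, forall_eq,
      weakDeriv_comp_one, weakDeriv_comp_two]
    rw [← tendsto_toL2_iff (fun n => (hφ n).memLp 2 volume),
      ← tendsto_toL2_iff (fun n => ((hφ n).fderiv_apply _).memLp 2 volume),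
      ← tendsto_toL2_iff (fun n => ((hφ n).fderiv_apply _).memLp 2 volume)]
    rfl
  constructor
  · rintro ⟨φ, hφ, h1, h2, h3⟩
    exact ⟨φ, hφ, (hV φ hφ).2 ⟨h1, h2⟩, (hΓ φ hφ).2 h3⟩
  · rintro ⟨φ, hφ, h1, h2⟩
    have := (hV φ hφ).1 h1
    exact ⟨φ, hφ, this.1, this.2, (hΓ φ hφ).1 h2⟩

/-- The trace is a bounded operator on `H¹(ℝ²)` if it is bounded on test functions. -/
theorem exists_traceOp [IsFiniteMeasureOnCompacts (arcLength γ)] {K : ℝ}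
    (hK : ∀ (φ : Plane → ℂ) (hφ : IsTest φ),
      ‖(hφ.memLp 2 (arcLength γ)).toLp φ‖ ≤ K * ‖ofTest φ hφ‖) :
    ∃ τ : Sob →L[ℂ] Lp ℂ 2 (arcLength γ), (∀ U, trace γ (comp 0 U) = τ U) ∧
      ∀ (φ : Plane → ℂ) (hφ : IsTest φ),
        τ (ofTest φ hφ) = (hφ.memLp 2 (arcLength γ)).toLp φ := by
  have hex : ∀ U : Sob, ∃ t, IsTrace γ (comp 0 U) t := by
    intro U
    obtain ⟨φ, hφ, hlim⟩ := exists_tendsto_ofTest U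
    have hK0 : 0 ≤ |K| + 1 := by positivity
    have hcau : CauchySeq fun n => ((hφ n).memLp 2 (arcLength γ)).toLp (φ n) := by
      rw [Metric.cauchySeq_iff']
      intro ε hε
      obtain ⟨N, hN⟩ := Metric.cauchySeq_iff'.1 hlim.cauchySeq (ε / (|K| + 1)) (by positivity)
      refine ⟨N, fun n hn => ?_⟩
      have h1 := hN n hn
      rw [dist_eq_norm, sub_ofTest, lt_div_iff₀ (by positivity)] at h1
      have h2 := hK _ ((hφ n).sub (hφ N))
      rw [dist_eq_norm, ← MemLp.toLp_sub]
      refine lt_of_le_of_lt h2 (lt_of_le_of_lt ?_ h1)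
      rw [mul_comm]
      exact mul_le_mul_of_nonneg_left ((le_abs_self K).trans (by linarith)) (norm_nonneg _)
    obtain ⟨t, ht⟩ := cauchySeq_tendsto_of_complete hcau
    exact ⟨t, isTrace_iff.2 ⟨φ, hφ, hlim, ht⟩⟩
  have hbound : ∀ (U : Sob) t, IsTrace γ (comp 0 U) t → ‖t‖ ≤ K * ‖U‖ := by
    intro U t ht
    obtain ⟨φ, hφ, h1, h2⟩ := isTrace_iff.1 ht
    exact le_of_tendsto_of_tendsto' h2.norm (h1.norm.const_mul K) fun n => hK _ _
  have hadd : ∀ (U W : Sob) t s, IsTrace γ (comp 0 U) t → IsTrace γ (comp 0 W) s →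
      IsTrace γ (comp 0 (U + W)) (t + s) := by
    intro U W t s ht hs
    obtain ⟨φ, hφ, h1, h2⟩ := isTrace_iff.1 ht
    obtain ⟨ψ, hψ, h3, h4⟩ := isTrace_iff.1 hs
    refine isTrace_iff.2 ⟨_, fun n => (hφ n).add (hψ n), ?_, ?_⟩
    · exact (h1.add h3).congr fun n => add_ofTest _ _
    · exact h2.add h4
  have hsmul : ∀ (c : ℂ) (U : Sob) t, IsTrace γ (comp 0 U) t →
      IsTrace γ (comp 0 (c • U)) (c • t) := by
    intro c U t ht
    obtain ⟨φ, hφ, h1, h2⟩ := isTrace_iff.1 ht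
    refine isTrace_iff.2 ⟨_, fun n => (hφ n).const_mul c, ?_, ?_⟩
    · exact (h1.const_smul c).congr fun n => smul_ofTest _ _
    · exact h2.const_smul c
  -- The difference of two traces of the same function is a trace of zero, and `hbound` makes it
  -- vanish.
  have huniq : ∀ (U : Sob) t s, IsTrace γ (comp 0 U) t → IsTrace γ (comp 0 U) s → t = s := by
    intro U t s ht hs
    have h1 := hadd _ _ _ _ ht (hsmul (-1) _ _ hs)
    have h2 := hbound _ _ h1
    simp only [neg_one_smul, add_neg_cancel, norm_zero, mul_zero, ← sub_eq_add_neg] at h2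
    exact sub_eq_zero.1 (norm_le_zero_iff.1 h2)
  have hspec : ∀ U : Sob, IsTrace γ (comp 0 U) (trace γ (comp 0 U)) := by
    intro U
    rw [trace, dif_pos (hex U)]
    exact (hex U).choose_spec
  let τ₀ : Sob →ₗ[ℂ] Lp ℂ 2 (arcLength γ) :=
    { toFun := fun U => trace γ (comp 0 U)
      map_add' := fun U W => huniq _ _ _ (hspec _) (hadd _ _ _ _ (hspec U) (hspec W))
      map_smul' := fun c U => huniq _ _ _ (hspec _) (hsmul c _ _ (hspec U)) }
  refine ⟨τ₀.mkContinuous K fun U => hbound U _ (hspec U), fun U => rfl, fun φ hφ => ?_⟩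
  refine huniq (ofTest φ hφ) _ _ (hspec _) (isTrace_iff.2 ⟨fun _ => φ, fun _ => hφ, ?_, ?_⟩)
  · exact tendsto_const_nhds
  · exact tendsto_const_nhds

theorem norm_toLp_sq {μ : Measure Plane} {f : Plane → ℂ} (hf : MemLp f 2 μ) :
    ‖hf.toLp f‖ ^ 2 = ∫ p, ‖f p‖ ^ 2 ∂μ := by
  have h := L2.inner_def (𝕜 := ℂ) (hf.toLp f) (hf.toLp f)
  rw [inner_self_eq_norm_sq_to_K] at h
  have h2 : ∫ p, inner ℂ (hf.toLp f p) (hf.toLp f p) ∂μ = ∫ p, ((‖f p‖ ^ 2 : ℝ) : ℂ) ∂μ := by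
    refine integral_congr_ae ?_
    filter_upwards [hf.coeFn_toLp] with p hp
    rw [hp, inner_self_eq_norm_sq_to_K]
    simp
  rw [h2, integral_complex_ofReal] at h
  apply Complex.ofReal_injective
  rw [Complex.ofReal_pow]
  exact h

end Trace

/-! ### The magnetic form as a bounded operator on H¹ -/

section MagneticForm

variable {A : Plane → ℝ × ℝ} {γ : ℝ → ℝ}

theorem MapsH1ToL2.fst (hA : MapsH1ToL2 A) (U : Sob) :
    MemLp (fun p => ((A p).1 : ℂ) * comp 0 U p) 2 volume := (hA _ (mem_H1_iff.2 ⟨U, rfl⟩)).1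

theorem MapsH1ToL2.snd (hA : MapsH1ToL2 A) (U : Sob) :
    MemLp (fun p => ((A p).2 : ℂ) * comp 0 U p) 2 volume := (hA _ (mem_H1_iff.2 ⟨U, rfl⟩)).2

/-- First component of `i∇ + A` on `H¹(ℝ²)`. -/
def covX (hA : MapsH1ToL2 A) : Sob →L[ℂ] L2 :=
  Complex.I • comp 1 + mulOp (fun p => (A p).1) hA.fst

/-- Second component of `i∇ + A` on `H¹(ℝ²)`. -/
def covY (hA : MapsH1ToL2 A) : Sob →L[ℂ] L2 :=
  Complex.I • comp 2 + mulOp (fun p => (A p).2) hA.snd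

theorem covX_ae (hA : MapsH1ToL2 A) (U : Sob) : covX hA U =ᵐ[volume] magX A (comp 0 U) := by
  have h : covX hA U = Complex.I • comp 1 U + mulOp (fun p => (A p).1) hA.fst U := rfl
  rw [h]
  filter_upwards [Lp.coeFn_add (Complex.I • comp 1 U) (mulOp (fun p => (A p).1) hA.fst U),
    Lp.coeFn_smul Complex.I (comp 1 U), coeFn_toL2 (hA.fst U)] with p h1 h2 h3
  rw [h1, Pi.add_apply, h2, Pi.smul_apply, mulOp_apply, h3, magX, weakDeriv_comp_one, smul_eq_mul]

theorem covY_ae (hA : MapsH1ToL2 A) (U : Sob) : covY hA U =ᵐ[volume] magY A (comp 0 U) := by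
  have h : covY hA U = Complex.I • comp 2 U + mulOp (fun p => (A p).2) hA.snd U := rfl
  rw [h]
  filter_upwards [Lp.coeFn_add (Complex.I • comp 2 U) (mulOp (fun p => (A p).2) hA.snd U),
    Lp.coeFn_smul Complex.I (comp 2 U), coeFn_toL2 (hA.snd U)] with p h1 h2 h3
  rw [h1, Pi.add_apply, h2, Pi.smul_apply, mulOp_apply, h3, magY, weakDeriv_comp_two, smul_eq_mul]

theorem covX_ofTest_ae (hA : MapsH1ToL2 A) {φ : Plane → ℂ} (hφ : IsTest φ) :
    covX hA (ofTest φ hφ) =ᵐ[volume]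
      fun p => Complex.I * fderiv ℝ φ p (1, 0) + ((A p).1 : ℂ) * φ p := by
  filter_upwards [covX_ae hA (ofTest φ hφ), coeFn_toL2 (hφ.memLp 2 volume),
    coeFn_toL2 ((hφ.fderiv_apply (1, 0)).memLp 2 volume)] with p h1 h2 h3
  rw [h1, magX, weakDeriv_comp_one, comp_one_ofTest, h3, comp_zero_ofTest, h2]

theorem covY_ofTest_ae (hA : MapsH1ToL2 A) {φ : Plane → ℂ} (hφ : IsTest φ) :
    covY hA (ofTest φ hφ) =ᵐ[volume]
      fun p => Complex.I * fderiv ℝ φ p (0, 1) + ((A p).2 : ℂ) * φ p := by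
  filter_upwards [covY_ae hA (ofTest φ hφ), coeFn_toL2 (hφ.memLp 2 volume),
    coeFn_toL2 ((hφ.fderiv_apply (0, 1)).memLp 2 volume)] with p h1 h2 h3
  rw [h1, magY, weakDeriv_comp_two, comp_two_ofTest, h3, comp_zero_ofTest, h2]

theorem norm_sq_of_ae {u : L2} {f : Plane → ℂ} (h : u =ᵐ[volume] f) :
    MemLp f 2 volume ∧ ‖u‖ ^ 2 = ∫ p, ‖f p‖ ^ 2 := by
  have hf : MemLp f 2 volume := (Lp.memLp u).ae_eq h
  refine ⟨hf, ?_⟩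
  rw [← norm_toL2_sq hf, ← toL2_congr h, toL2_coe]

/-- The bounded operator on `H¹(ℝ²)` that represents the form. -/
def formBdd (hA : MapsH1ToL2 A) (α : ℝ) (τ : Sob →L[ℂ] Lp ℂ 2 (arcLength γ)) : Sob →L[ℂ] Sob :=
  (covX hA).adjoint ∘L covX hA + (covY hA).adjoint ∘L covY hA - (α : ℂ) • (τ.adjoint ∘L τ)

variable (hA : MapsH1ToL2 A) (α : ℝ) (τ : Sob →L[ℂ] Lp ℂ 2 (arcLength γ))

theorem inner_formBdd (W U : Sob) : inner ℂ W (formBdd hA α τ U) =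
    inner ℂ (covX hA W) (covX hA U) + inner ℂ (covY hA W) (covY hA U) -
      α * inner ℂ (τ W) (τ U) := by
  simp [formBdd, ContinuousLinearMap.adjoint_inner_right]

theorem re_inner_formBdd (U : Sob) : (inner ℂ U (formBdd hA α τ U)).re =
    ‖covX hA U‖ ^ 2 + ‖covY hA U‖ ^ 2 - α * ‖τ U‖ ^ 2 := by
  rw [inner_formBdd]
  simp only [inner_self_eq_norm_sq_to_K, Complex.coe_algebraMap]
  norm_cast

theorem isSelfAdjoint_formBdd : IsSelfAdjoint (formBdd hA α τ) := by
  rw [ContinuousLinearMap.isSelfAdjoint_iff_isSymmetric]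
  intro U W
  change inner ℂ (formBdd hA α τ U) W = inner ℂ U (formBdd hA α τ W)
  have h := inner_conj_symm (𝕜 := ℂ) (formBdd hA α τ U) W
  rw [← h, inner_formBdd, inner_formBdd]
  simp only [map_sub, map_add, map_mul, inner_conj_symm, Complex.conj_ofReal]

theorem form_eq_inner (hτ : ∀ U, trace γ (comp 0 U) = τ U) (W U : Sob) :
    form A α γ (comp 0 W) (comp 0 U) = inner ℂ W (formBdd hA α τ U) := by
  rw [inner_formBdd, form, hτ, hτ]
  congr 1
  · rw [L2.inner_def, L2.inner_def, ← integral_add (L2.integrable_inner _ _)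
      (L2.integrable_inner _ _)]
    refine integral_congr_ae ?_
    filter_upwards [covX_ae hA W, covX_ae hA U, covY_ae hA W, covY_ae hA U] with p h1 h2 h3 h4
    rw [h1, h2, h3, h4, RCLike.inner_apply, RCLike.inner_apply]
    ring
  · rw [L2.inner_def]
    congr 1
    refine integral_congr_ae (Eventually.of_forall fun p => ?_)
    simp only [RCLike.inner_apply]
    ring

theorem isAssociated_formOp (hτ : ∀ U, trace γ (comp 0 U) = τ U) :
    IsAssociated A α γ (formOp (comp 0) (formBdd hA α τ)) := by
  intro ψ f
  rw [mem_graph_formOp comp_zero_injective denseRange_comp_zero]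
  constructor
  · rintro ⟨U, rfl, hU⟩
    refine ⟨mem_H1_iff.2 ⟨U, rfl⟩, fun φ hφ => ?_⟩
    obtain ⟨W, rfl⟩ := mem_H1_iff.1 hφ
    rw [form_eq_inner hA α τ hτ, hU]
  · rintro ⟨hψ, h⟩
    obtain ⟨U, rfl⟩ := mem_H1_iff.1 hψ
    refine ⟨U, rfl, fun W => ?_⟩
    rw [← form_eq_inner hA α τ hτ]
    exact h _ (mem_H1_iff.2 ⟨W, rfl⟩)

/-- The magnetic Sobolev norm controls the Sobolev norm. -/
theorem exists_norm_sq_le_magnetic : ∃ K : ℝ, 0 < K ∧ ∀ U : Sob,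
    ‖U‖ ^ 2 ≤ K * (‖comp 0 U‖ ^ 2 + ‖covX hA U‖ ^ 2 + ‖covY hA U‖ ^ 2) := by
  set K₁ := ‖mulOp (fun p => (A p).1) hA.fst‖ ^ 2
  set K₂ := ‖mulOp (fun p => (A p).2) hA.snd‖ ^ 2
  have hK₁ : 0 ≤ K₁ := sq_nonneg _
  have hK₂ : 0 ≤ K₂ := sq_nonneg _
  refine ⟨3 + 2 * K₁ + 2 * K₂, by positivity, ?_⟩
  refine Sob_induction (isClosed_le (by fun_prop) (by fun_prop)) fun φ hφ => ?_
  obtain ⟨hX, hXn⟩ := norm_sq_of_ae (covX_ofTest_ae hA hφ)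
  obtain ⟨hY, hYn⟩ := norm_sq_of_ae (covY_ofTest_ae hA hφ)
  -- The boundedness of `mulOp` in the norm of H¹ would be circular here. Its diamagnetic version
  -- bounds the potential term by the magnetic norm itself.
  have h1 := norm_mulOp_sq_le _ _ _ hA.fst hφ hX hY
  have h2 := norm_mulOp_sq_le _ _ _ hA.snd hφ hX hY
  rw [← hXn, ← hYn, ← norm_toL2_sq (hφ.memLp 2 volume), ← comp_zero_ofTest hφ] at h1 h2
  have key : ∀ (D g m : L2), D = Complex.I • g + m → ‖g‖ ^ 2 ≤ 2 * ‖D‖ ^ 2 + 2 * ‖m‖ ^ 2 := by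
    intro D g m h
    have h3 : ‖g‖ ≤ ‖D‖ + ‖m‖ := by
      have : Complex.I • g = D - m := by rw [h]; simp
      calc ‖g‖ = ‖Complex.I • g‖ := by rw [norm_smul, Complex.norm_I, one_mul]
        _ ≤ ‖D‖ + ‖m‖ := by rw [this]; exact norm_sub_le _ _
    nlinarith [sq_nonneg (‖D‖ - ‖m‖), norm_nonneg g]
  have hX2 := key (covX hA (ofTest φ hφ)) (comp 1 (ofTest φ hφ))
    (mulOp (fun p => (A p).1) hA.fst (ofTest φ hφ)) rfl
  have hY2 := key (covY hA (ofTest φ hφ)) (comp 2 (ofTest φ hφ))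
    (mulOp (fun p => (A p).2) hA.snd (ofTest φ hφ)) rfl
  rw [norm_sq_Sob]
  nlinarith [sq_nonneg ‖comp 0 (ofTest φ hφ)‖, sq_nonneg ‖covX hA (ofTest φ hφ)‖,
    sq_nonneg ‖covY hA (ofTest φ hφ)‖]

end MagneticForm

/-! ### Poincaré's inequality and finite rank control on the box -/

section Poincare

/-- Cauchy–Schwarz for the integral over an interval. -/
theorem sq_norm_setIntegral_le {g : ℝ → ℂ} (hg : Continuous g) {b h : ℝ} (hh : 0 < h) :
    ‖∫ t in Icc b (b + h), g t‖ ^ 2 ≤ h * ∫ t in Icc b (b + h), ‖g t‖ ^ 2 := by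
  have hio : ∀ {f : ℝ → ℝ}, Continuous f → IntegrableOn f (Icc b (b + h)) := fun hf =>
    hf.integrableOn_Icc
  have h1 : ‖∫ t in Icc b (b + h), g t‖ ≤ ∫ t in Icc b (b + h), ‖g t‖ :=
    norm_integral_le_integral_norm _
  set m := ∫ t in Icc b (b + h), ‖g t‖ with hm
  -- Nonnegativity of the variance of `‖g‖` is the Cauchy–Schwarz inequality.
  have h2 : 0 ≤ ∫ t in Icc b (b + h), (‖g t‖ - m / h) ^ 2 := integral_nonneg fun t => sq_nonneg _
  have h3 : ∫ t in Icc b (b + h), (‖g t‖ - m / h) ^ 2 =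
      (∫ t in Icc b (b + h), ‖g t‖ ^ 2) - m ^ 2 / h := by
    have : ∀ t, (‖g t‖ - m / h) ^ 2 = ‖g t‖ ^ 2 - 2 * (m / h) * ‖g t‖ + (m / h) ^ 2 := fun t => by
      ring
    simp_rw [this]
    rw [integral_add (hio (by fun_prop)) (hio (by fun_prop)),
      integral_sub (hio (by fun_prop)) (hio (by fun_prop)), integral_const_mul, ← hm,
      setIntegral_const, Real.volume_real_Icc_of_le (by linarith), smul_eq_mul]
    field_simp
    ring
  rw [h3, sub_nonneg, div_le_iff₀ hh] at h2
  calc ‖∫ t in Icc b (b + h), g t‖ ^ 2 ≤ m ^ 2 := pow_le_pow_left₀ (norm_nonneg _) h1 2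
    _ ≤ _ := by rw [mul_comm]; exact h2

/-- One-dimensional Poincaré inequality. -/
theorem setIntegral_norm_sq_le {g d : ℝ → ℂ} (hg : ∀ t, HasDerivAt g (d t) t) (hd : Continuous d)
    {b h : ℝ} (hh : 0 < h) :
    ∫ t in Icc b (b + h), ‖g t‖ ^ 2 ≤ 2 * h ^ 2 * (∫ t in Icc b (b + h), ‖d t‖ ^ 2) +
      2 * h⁻¹ * ‖∫ t in Icc b (b + h), g t‖ ^ 2 := by
  have hgc : Continuous g := continuous_iff_continuousAt.2 fun t => (hg t).continuousAt
  have hio : ∀ {E : Type} [NormedAddCommGroup E] {f : ℝ → E}, Continuous f →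
      IntegrableOn f (Icc b (b + h)) := fun hf => hf.integrableOn_Icc
  set E := ∫ t in Icc b (b + h), ‖d t‖ ^ 2 with hE
  set D := ∫ t in Icc b (b + h), ‖d t‖ with hD
  have hDE : D ^ 2 ≤ h * E := by
    have := sq_norm_setIntegral_le (g := fun t => ((‖d t‖ : ℝ) : ℂ)) (by fun_prop) (b := b) hh
    rw [integral_complex_ofReal] at this
    simpa using this
  -- The oscillation of `g` is at most `D`, the integral of `‖d‖`; hence so is the distance to the
  -- mean `m`, and `D² ≤ h E`.
  have hosc : ∀ x ∈ Icc b (b + h), ∀ y ∈ Icc b (b + h), ‖g x - g y‖ ≤ D := by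
    intro x hx y hy
    have hftc := intervalIntegral.integral_eq_sub_of_hasDerivAt (a := y) (b := x)
      (fun t _ => hg t) (hd.intervalIntegrable _ _)
    rw [← hftc]
    refine intervalIntegral.norm_integral_le_integral_norm_uIoc.trans ?_
    refine setIntegral_mono_set (hio hd.norm) (Eventually.of_forall fun t => norm_nonneg _)
      (LE.le.eventuallyLE ?_)
    exact uIoc_subset_uIcc.trans (uIcc_subset_Icc hy hx)
  set m : ℂ := (h : ℂ)⁻¹ * ∫ t in Icc b (b + h), g t with hm
  have hhc : (h : ℂ) ≠ 0 := by exact_mod_cast hh.ne'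
  have hdev : ∀ x ∈ Icc b (b + h), ‖g x - m‖ ≤ D := by
    intro x hx
    have h1 : g x - m = (h : ℂ)⁻¹ * ∫ t in Icc b (b + h), (g x - g t) := by
      rw [integral_sub (hio continuous_const) (hio hgc), setIntegral_const,
        Real.volume_real_Icc_of_le (by linarith), hm, mul_sub, add_sub_cancel_left,
        Complex.real_smul, inv_mul_cancel_left₀ hhc]
    have h2 : ‖∫ t in Icc b (b + h), (g x - g t)‖ ≤ D * h := by
      have := norm_setIntegral_le_of_norm_le_const (μ := volume) (s := Icc b (b + h))
        (f := fun t => g x - g t) (C := D) (by simp) (fun t ht => hosc x hx t ht)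
      rwa [Real.volume_real_Icc_of_le (by linarith), add_sub_cancel_left] at this
    rw [h1, norm_mul, norm_inv, Complex.norm_real, Real.norm_of_nonneg hh.le, inv_mul_eq_div,
      div_le_iff₀ hh]
    exact h2
  have hpt : ∀ x ∈ Icc b (b + h), ‖g x‖ ^ 2 ≤ 2 * (h * E) + 2 * ‖m‖ ^ 2 := by
    intro x hx
    have h1 : ‖g x‖ ≤ ‖g x - m‖ + ‖m‖ := by
      have := norm_add_le (g x - m) m
      rwa [sub_add_cancel] at this
    have h2 : ‖g x - m‖ ^ 2 ≤ h * E :=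
      (pow_le_pow_left₀ (norm_nonneg _) (hdev x hx) 2).trans hDE
    nlinarith [sq_nonneg (‖g x - m‖ - ‖m‖), norm_nonneg (g x)]
  have hfin := setIntegral_mono_on (hio (hgc.norm.pow 2)) (hio continuous_const)
    measurableSet_Icc hpt
  rw [setIntegral_const, Real.volume_real_Icc_of_le (by linarith), add_sub_cancel_left,
    smul_eq_mul] at hfin
  refine hfin.trans (le_of_eq ?_)
  rw [hm, norm_mul, norm_inv, Complex.norm_real, Real.norm_of_nonneg hh.le]
  field_simp

/-- Poincaré inequality on a square. -/
theorem setIntegral_square_le {f : Plane → ℂ} (hf : IsTest f) {b c h : ℝ} (hh : 0 < h) :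
    ∫ p in Icc b (b + h) ×ˢ Icc c (c + h), ‖f p‖ ^ 2 ≤
      4 * h ^ 2 * (∫ p in Icc b (b + h) ×ˢ Icc c (c + h),
        (‖fderiv ℝ f p (1, 0)‖ ^ 2 + ‖fderiv ℝ f p (0, 1)‖ ^ 2)) +
      4 * (h ^ 2)⁻¹ * ‖∫ p in Icc b (b + h) ×ˢ Icc c (c + h), f p‖ ^ 2 := by
  set I := Icc b (b + h)
  set J := Icc c (c + h)
  have hIc : IsCompact I := isCompact_Icc
  have hJc : IsCompact J := isCompact_Icc
  have hfc := hf.continuous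
  set d₁ : Plane → ℂ := fun p => fderiv ℝ f p (1, 0) with hd₁
  set d₂ : Plane → ℂ := fun p => fderiv ℝ f p (0, 1) with hd₂
  have h1c : Continuous d₁ := (hf.fderiv_apply (1, 0)).continuous
  have h2c : Continuous d₂ := (hf.fderiv_apply (0, 1)).continuous
  have nf : Continuous fun p => ‖f p‖ ^ 2 := by fun_prop
  have n1 : Continuous fun p => ‖d₁ p‖ ^ 2 := by fun_prop
  have n2 : Continuous fun p => ‖d₂ p‖ ^ 2 := by fun_prop
  have hd1 : ∀ x y, HasDerivAt (fun x => f (x, y)) (d₁ (x, y)) x := fun x y =>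
    (hf.differentiable (x, y)).hasFDerivAt.comp_hasDerivAt x
      ((hasDerivAt_id x).prodMk (hasDerivAt_const x y))
  have hd2 : ∀ x y, HasDerivAt (fun y => f (x, y)) (d₂ (x, y)) y := fun x y =>
    (hf.differentiable (x, y)).hasFDerivAt.comp_hasDerivAt y
      ((hasDerivAt_const y x).prodMk (hasDerivAt_id y))
  have hprod : ∀ {E : Type} [NormedAddCommGroup E] [NormedSpace ℝ E] {u : Plane → E},
      Continuous u → ∫ p in I ×ˢ J, u p = ∫ y in J, ∫ x in I, u (x, y) := by
    intro E _ _ u hu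
    have hi : IntegrableOn u (I ×ˢ J) (volume.prod volume) := by
      rw [← Measure.volume_eq_prod]
      exact hu.continuousOn.integrableOn_compact (hIc.prod hJc)
    have hi' : Integrable (Function.uncurry fun x y => u (x, y))
        ((volume.restrict I).prod (volume.restrict J)) := by
      rw [Measure.prod_restrict]; exact hi
    rw [Measure.volume_eq_prod, setIntegral_prod _ hi, integral_integral_swap hi']
  have hpar : ∀ {E : Type} [NormedAddCommGroup E] [NormedSpace ℝ E] {u : Plane → E},
      Continuous u → Continuous fun y => ∫ x in I, u (x, y) := fun {E} _ _ {u} hu =>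
    continuous_parametric_integral_of_continuous (f := fun y x => u (x, y)) (by fun_prop) hIc
  have hioJ : ∀ {E : Type} [NormedAddCommGroup E] {u : ℝ → E}, Continuous u → IntegrableOn u J :=
    fun hu => hu.integrableOn_Icc
  -- The inequality on the line is used on every row and then for the row integrals `G`. Their
  -- derivative is the row integral of `d₂`, bounded by Cauchy–Schwarz.
  set G : ℝ → ℂ := fun y => ∫ x in I, f (x, y) with hG
  have hGd : ∀ y, HasDerivAt G (∫ x in I, d₂ (x, y)) y := by
    intro y
    obtain ⟨C, hC⟩ := (hf.fderiv_apply (0, 1)).2.exists_bound_of_continuous h2c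
    refine (hasDerivAt_integral_of_dominated_loc_of_deriv_le (μ := volume.restrict I)
      (F := fun y x => f (x, y)) (F' := fun y x => d₂ (x, y)) (bound := fun _ => C) (s := univ)
      univ_mem (Eventually.of_forall fun y => ?_) ?_ ?_ ?_ ?_ ?_).2
    · exact (Continuous.aestronglyMeasurable (by fun_prop))
    · exact (Continuous.integrableOn_Icc (by fun_prop))
    · exact (Continuous.aestronglyMeasurable (by fun_prop))
    · exact Eventually.of_forall fun x y _ => hC _
    · exact (continuous_const.integrableOn_Icc)
    · exact Eventually.of_forall fun x y _ => hd2 x y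
  have hcs : ∀ y, ‖∫ x in I, d₂ (x, y)‖ ^ 2 ≤ h * ∫ x in I, ‖d₂ (x, y)‖ ^ 2 := fun y =>
    sq_norm_setIntegral_le (by fun_prop) hh
  have hGP := setIntegral_norm_sq_le hGd (hpar h2c) (b := c) hh
  have hGP2 : ∫ y in J, ‖∫ x in I, d₂ (x, y)‖ ^ 2 ≤ h * ∫ y in J, ∫ x in I, ‖d₂ (x, y)‖ ^ 2 := by
    rw [← integral_const_mul]
    exact integral_mono (hioJ ((hpar h2c).norm.pow 2))
      (hioJ (continuous_const.mul (hpar n2))) hcs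
  have hrow : ∀ y, ∫ x in I, ‖f (x, y)‖ ^ 2 ≤ 2 * h ^ 2 * (∫ x in I, ‖d₁ (x, y)‖ ^ 2) +
      2 * h⁻¹ * ‖G y‖ ^ 2 := fun y =>
    setIntegral_norm_sq_le (fun x => hd1 x y) (by fun_prop) hh
  have hrow2 : ∫ y in J, ∫ x in I, ‖f (x, y)‖ ^ 2 ≤
      2 * h ^ 2 * (∫ y in J, ∫ x in I, ‖d₁ (x, y)‖ ^ 2) + 2 * h⁻¹ * ∫ y in J, ‖G y‖ ^ 2 := by
    have hGc : Continuous G := hpar hfc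
    have c1 : Continuous fun y => 2 * h ^ 2 * ∫ x in I, ‖d₁ (x, y)‖ ^ 2 :=
      continuous_const.mul (hpar n1)
    have c2 : Continuous fun y => 2 * h⁻¹ * ‖G y‖ ^ 2 := by fun_prop
    rw [← integral_const_mul, ← integral_const_mul, ← integral_add (hioJ c1) (hioJ c2)]
    exact integral_mono (hioJ (hpar nf)) (hioJ (c1.add c2)) hrow
  rw [hprod nf, hprod hfc]
  have hsum : ∫ p in I ×ˢ J, (‖d₁ p‖ ^ 2 + ‖d₂ p‖ ^ 2) =
      (∫ y in J, ∫ x in I, ‖d₁ (x, y)‖ ^ 2) + ∫ y in J, ∫ x in I, ‖d₂ (x, y)‖ ^ 2 := by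
    rw [← hprod n1, ← hprod n2]
    exact integral_add (n1.continuousOn.integrableOn_compact (hIc.prod hJc))
      (n2.continuousOn.integrableOn_compact (hIc.prod hJc))
  rw [hsum]
  have hA0 : 0 ≤ ∫ y in J, ∫ x in I, ‖d₁ (x, y)‖ ^ 2 :=
    integral_nonneg fun y => integral_nonneg fun x => sq_nonneg _
  set X := ∫ y in J, ∫ x in I, ‖d₁ (x, y)‖ ^ 2
  set Y := ∫ y in J, ∫ x in I, ‖d₂ (x, y)‖ ^ 2
  set Z := ‖∫ y in J, G y‖ ^ 2
  have hh2 : 2 * h⁻¹ * (∫ y in J, ‖G y‖ ^ 2) ≤ 2 * h⁻¹ * (2 * h ^ 2 * (h * Y) + 2 * h⁻¹ * Z) := by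
    refine mul_le_mul_of_nonneg_left (hGP.trans (add_le_add ?_ le_rfl)) (by positivity)
    exact mul_le_mul_of_nonneg_left hGP2 (by positivity)
  have hh3 : 2 * h⁻¹ * (2 * h ^ 2 * (h * Y) + 2 * h⁻¹ * Z) = 4 * h ^ 2 * Y + 4 * (h ^ 2)⁻¹ * Z := by
    field_simp
    ring
  have hh4 : 0 ≤ h ^ 2 * X := by positivity
  linarith

/-- On a bounded box, the `L²` norm is bounded by a small multiple of the gradient, up to a form
of finite rank. -/
theorem exists_finiteRank_box {a : ℝ} (ha : 0 < a) {ε : ℝ} (hε : 0 < ε) :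
    ∃ (n : ℕ) (e : Fin n → L2), ∀ f : Plane → ℂ, IsTest f →
      ∫ p in Icc (-a) a ×ˢ Icc (-a) a, ‖f p‖ ^ 2 ≤
        ε * (∫ p, (‖fderiv ℝ f p (1, 0)‖ ^ 2 + ‖fderiv ℝ f p (0, 1)‖ ^ 2)) +
        ∑ j, ‖(inner ℂ (e j) (toL2 f) : ℂ)‖ ^ 2 := by
  obtain ⟨N, hN⟩ := exists_nat_gt (2 * a / Real.sqrt (ε / 4))
  have hsq : 0 < Real.sqrt (ε / 4) := Real.sqrt_pos.2 (by positivity)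
  have hN0 : (0 : ℝ) < N := lt_of_le_of_lt (by positivity) hN
  set h : ℝ := 2 * a / N with hh
  have hh0 : 0 < h := by positivity
  have hhε : 4 * h ^ 2 ≤ ε := by
    have h1 : h ≤ Real.sqrt (ε / 4) := by
      rw [hh, div_le_iff₀ hN0, mul_comm _ (N : ℝ)]
      exact ((div_lt_iff₀ hsq).1 hN).le
    have h2 : h ^ 2 ≤ ε / 4 := by
      have := pow_le_pow_left₀ hh0.le h1 2
      rwa [Real.sq_sqrt (by positivity)] at this
    linarith
  -- Half-open squares of side `h` are disjoint. There are `N + 1` of them in each direction, one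
  -- more than the length requires, so that the end point `a` is covered as well.
  set b : Fin (N + 1) → ℝ := fun i => -a + i * h with hb
  set Q : Fin (N + 1) × Fin (N + 1) → Set Plane := fun q =>
    Ico (b q.1) (b q.1 + h) ×ˢ Ico (b q.2) (b q.2 + h) with hQ
  set Q' : Fin (N + 1) × Fin (N + 1) → Set Plane := fun q =>
    Icc (b q.1) (b q.1 + h) ×ˢ Icc (b q.2) (b q.2 + h) with hQ'
  have hQm : ∀ q, MeasurableSet (Q q) := fun q => measurableSet_Ico.prod measurableSet_Ico
  have hQae : ∀ q, Q q =ᵐ[volume] Q' q := fun q =>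
    Measure.set_prod_ae_eq Ico_ae_eq_Icc Ico_ae_eq_Icc
  have hQfin : ∀ q, volume (Q q) ≠ ⊤ := fun q => by
    rw [measure_congr (hQae q)]
    exact ((isCompact_Icc.prod isCompact_Icc).measure_lt_top).ne
  have hdisj1 : ∀ i j : Fin (N + 1), i ≠ j → Disjoint (Ico (b i) (b i + h)) (Ico (b j) (b j + h)) := by
    have aux : ∀ i j : Fin (N + 1), i < j →
        Disjoint (Ico (b i) (b i + h)) (Ico (b j) (b j + h)) := by
      intro i j hij
      rw [Set.disjoint_left]
      rintro x ⟨_, hx2⟩ ⟨hx3, _⟩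
      have : ((i : ℕ) : ℝ) + 1 ≤ ((j : ℕ) : ℝ) := by exact_mod_cast hij
      simp only [hb] at hx2 hx3
      nlinarith
    intro i j hij
    rcases lt_or_gt_of_ne hij with h | h
    · exact aux i j h
    · exact (aux j i h).symm
  have hdisj : Pairwise (Function.onFun Disjoint Q) := by
    intro q r hqr
    by_cases h1 : q.1 = r.1
    · have h2 : q.2 ≠ r.2 := fun h2 => hqr (Prod.ext h1 h2)
      exact Disjoint.set_prod_right (hdisj1 _ _ h2) _ _
    · exact Disjoint.set_prod_left (hdisj1 _ _ h1) _ _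
  have hcover1 : ∀ x ∈ Icc (-a) a, ∃ i : Fin (N + 1), x ∈ Ico (b i) (b i + h) := by
    intro x hx
    have hx0 : 0 ≤ (x + a) / h := div_nonneg (by linarith [hx.1]) hh0.le
    have hfl := Nat.floor_le hx0
    have hlt := Nat.lt_floor_add_one ((x + a) / h)
    have hxN : (x + a) / h ≤ N := by
      rw [div_le_iff₀ hh0, hh, mul_div_cancel₀ _ hN0.ne']
      linarith [hx.2]
    have hle : ⌊(x + a) / h⌋₊ < N + 1 := by
      have : ((⌊(x + a) / h⌋₊ : ℕ) : ℝ) ≤ N := hfl.trans hxN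
      have : ⌊(x + a) / h⌋₊ ≤ N := by exact_mod_cast this
      omega
    rw [le_div_iff₀ hh0] at hfl
    rw [div_lt_iff₀ hh0] at hlt
    refine ⟨⟨_, hle⟩, ?_, ?_⟩
    · simp only [hb]; linarith
    · simp only [hb]; linarith
  have hcover : Icc (-a) a ×ˢ Icc (-a) a ⊆ ⋃ q, Q q := by
    rintro p ⟨hp1, hp2⟩
    obtain ⟨i, hi⟩ := hcover1 _ hp1
    obtain ⟨j, hj⟩ := hcover1 _ hp2
    exact mem_iUnion.2 ⟨(i, j), hi, hj⟩
  -- The factor `2 / h` makes `‖⟨e q, f⟩‖²` equal to the mean value term `4 h⁻² ‖∫ f‖²` of the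
  -- inequality on a square.
  set e : Fin (N + 1) × Fin (N + 1) → L2 := fun q =>
    toL2 ((Q q).indicator fun _ => ((2 * h⁻¹ : ℝ) : ℂ)) with he
  refine ⟨(N + 1) * (N + 1), fun j => e (finProdFinEquiv.symm j), fun f hf => ?_⟩
  have hfi : Integrable fun p => ‖f p‖ ^ 2 := integrable_norm_sq (hf.memLp 2 volume)
  have hgi : Integrable fun p => ‖fderiv ℝ f p (1, 0)‖ ^ 2 + ‖fderiv ℝ f p (0, 1)‖ ^ 2 :=
    (integrable_norm_sq ((hf.fderiv_apply _).memLp 2 volume)).fun_add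
      (integrable_norm_sq ((hf.fderiv_apply _).memLp 2 volume))
  have hsum : ∀ {u : Plane → ℝ}, Integrable u → ∫ p in ⋃ q, Q q, u p = ∑ q, ∫ p in Q q, u p :=
    fun hu => integral_iUnion_fintype hQm hdisj fun q => hu.integrableOn
  have hein : ∀ q, (inner ℂ (e q) (toL2 f) : ℂ) = ((2 * h⁻¹ : ℝ) : ℂ) * ∫ p in Q q, f p := by
    intro q
    have hm : MemLp ((Q q).indicator fun _ => ((2 * h⁻¹ : ℝ) : ℂ)) 2 volume :=
      memLp_indicator_const 2 (hQm q) _ (Or.inr (hQfin q))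
    rw [he, inner_toL2 hm (hf.memLp 2 volume), ← integral_const_mul, ← integral_indicator (hQm q)]
    refine integral_congr_ae (Eventually.of_forall fun p => ?_)
    by_cases hp : p ∈ Q q
    · simp only [indicator_of_mem hp, Complex.conj_ofReal]
    · simp only [indicator_of_notMem hp, map_zero, zero_mul]
  have hsq' : ∀ q, ∫ p in Q q, ‖f p‖ ^ 2 ≤
      ε * (∫ p in Q q, (‖fderiv ℝ f p (1, 0)‖ ^ 2 + ‖fderiv ℝ f p (0, 1)‖ ^ 2)) +
        ‖(inner ℂ (e q) (toL2 f) : ℂ)‖ ^ 2 := by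
    intro q
    have h1 := setIntegral_square_le hf (b := b q.1) (c := b q.2) hh0
    rw [← setIntegral_congr_set (hQae q), ← setIntegral_congr_set (hQae q),
      ← setIntegral_congr_set (hQae q)] at h1
    refine h1.trans (add_le_add ?_ (le_of_eq ?_))
    · refine mul_le_mul_of_nonneg_right hhε (integral_nonneg fun p => by positivity)
    · rw [hein, norm_mul, Complex.norm_real, mul_pow, Real.norm_eq_abs, sq_abs, mul_pow, inv_pow]
      norm_num
  calc ∫ p in Icc (-a) a ×ˢ Icc (-a) a, ‖f p‖ ^ 2 ≤ ∫ p in ⋃ q, Q q, ‖f p‖ ^ 2 :=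
        setIntegral_mono_set hfi.integrableOn (Eventually.of_forall fun p => sq_nonneg _)
          hcover.eventuallyLE
    _ = ∑ q, ∫ p in Q q, ‖f p‖ ^ 2 := hsum hfi
    _ ≤ ∑ q, (ε * (∫ p in Q q, (‖fderiv ℝ f p (1, 0)‖ ^ 2 + ‖fderiv ℝ f p (0, 1)‖ ^ 2)) +
        ‖(inner ℂ (e q) (toL2 f) : ℂ)‖ ^ 2) := Finset.sum_le_sum fun q _ => hsq' q
    _ = ε * (∫ p in ⋃ q, Q q, (‖fderiv ℝ f p (1, 0)‖ ^ 2 + ‖fderiv ℝ f p (0, 1)‖ ^ 2)) +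
        ∑ q, ‖(inner ℂ (e q) (toL2 f) : ℂ)‖ ^ 2 := by
        rw [Finset.sum_add_distrib, ← Finset.mul_sum, hsum hgi]
    _ ≤ _ := by
        refine add_le_add (mul_le_mul_of_nonneg_left ?_ hε.le) (le_of_eq ?_)
        · exact setIntegral_le_integral hgi (Eventually.of_forall fun p => by positivity)
        · exact (Equiv.sum_comp finProdFinEquiv.symm
            fun q => ‖(inner ℂ (e q) (toL2 f) : ℂ)‖ ^ 2).symm

end Poincare

/-! ### Coercivity and the lower bound up to finite rank -/

section LowerBounds

variable {γ : ℝ → ℝ} {a : ℝ} {A : Plane → ℝ × ℝ}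

/-- The trace operator on the graph of `γ`. -/
theorem exists_traceOp_graph (ha : 0 < a) (hγ : Continuous γ) (hout : ∀ x, a ≤ |x| → γ x = x)
    (hin : ∀ x, |x| < a → |γ x| ≤ a) {L : ℝ} (hL : ∀ x, |deriv γ x| ≤ L) :
    ∃ τ : Sob →L[ℂ] Lp ℂ 2 (arcLength γ), (∀ U, trace γ (comp 0 U) = τ U) ∧
      ∀ φ hφ, τ (ofTest φ hφ) =ᵐ[arcLength γ] φ := by
  have hfin := isFiniteMeasureOnCompacts_arcLength hγ hL
  -- For mere boundedness of the trace, `α = 1` and zero potential are enough; the constant `2 + C`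
  -- below is generous.
  obtain ⟨C, hC0, hC⟩ := trace_le ha hγ hout hin hL zero_le_one
  have hbound : ∀ (φ : Plane → ℂ) (hφ : IsTest φ),
      ‖(hφ.memLp 2 (arcLength γ)).toLp φ‖ ≤ (2 + C) * ‖ofTest φ hφ‖ := by
    intro φ hφ
    have hm1 := (hφ.fderiv_apply (1, 0)).memLp 2 volume
    have hm2 := (hφ.fderiv_apply (0, 1)).memLp 2 volume
    have h := hC 0 0 φ hφ (by simpa using hm1.const_mul Complex.I)
      (by simpa using hm2.const_mul Complex.I)
    simp only [Pi.zero_apply, Complex.ofReal_zero, zero_mul, add_zero, norm_mul, Complex.norm_I,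
      one_mul] at h
    rw [← norm_toL2_sq hm1, ← norm_toL2_sq hm2, ← norm_toL2_sq (hφ.memLp 2 volume),
      ← norm_toLp_sq (hφ.memLp 2 (arcLength γ))] at h
    have hbox : ∫ p in Icc (-a) a ×ˢ Icc (-a) a, ‖φ p‖ ^ 2 ≤ ‖toL2 φ‖ ^ 2 := by
      rw [norm_toL2_sq (hφ.memLp 2 volume)]
      exact setIntegral_le_integral (integrable_norm_sq (hφ.memLp 2 volume))
        (Eventually.of_forall fun p => sq_nonneg _)
    have hn := norm_sq_Sob (ofTest φ hφ)
    rw [comp_zero_ofTest, comp_one_ofTest, comp_two_ofTest] at hn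
    refine le_of_sq_le_sq ?_ (by positivity)
    rw [mul_pow]
    have h1 := mul_le_mul_of_nonneg_left hbox hC0
    have h2 : ‖toL2 φ‖ ^ 2 ≤ ‖ofTest φ hφ‖ ^ 2 := by
      rw [hn]
      linarith [sq_nonneg (‖toL2 (fun p => fderiv ℝ φ p (1, 0))‖),
        sq_nonneg (‖toL2 (fun p => fderiv ℝ φ p (0, 1))‖)]
    have h3 := mul_le_mul_of_nonneg_left h2 hC0
    have h4 : 0 ≤ (C ^ 2 + 3 * C + 2) * ‖ofTest φ hφ‖ ^ 2 := by positivity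
    nlinarith
  obtain ⟨τ, h1, h2⟩ := exists_traceOp hbound
  refine ⟨τ, h1, fun φ hφ => ?_⟩
  rw [h2]
  exact MemLp.coeFn_toLp _

variable (hA : MapsH1ToL2 A) {τ : Sob →L[ℂ] Lp ℂ 2 (arcLength γ)}

theorem trace_le_ofTest (ha : 0 < a) (hγ : Continuous γ) (hout : ∀ x, a ≤ |x| → γ x = x)
    (hin : ∀ x, |x| < a → |γ x| ≤ a) {L : ℝ} (hL : ∀ x, |deriv γ x| ≤ L)
    (hτ : ∀ φ hφ, τ (ofTest φ hφ) =ᵐ[arcLength γ] φ) {α : ℝ} (hα : 0 ≤ α) :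
    ∃ C, 0 ≤ C ∧ ∀ φ hφ, α * ‖τ (ofTest φ hφ)‖ ^ 2 ≤ ‖covX hA (ofTest φ hφ)‖ ^ 2 +
      ‖covY hA (ofTest φ hφ)‖ ^ 2 + α ^ 2 / 4 * ‖toL2 φ‖ ^ 2 +
        C * ∫ p in Icc (-a) a ×ˢ Icc (-a) a, ‖φ p‖ ^ 2 := by
  obtain ⟨C, hC0, hC⟩ := trace_le ha hγ hout hin hL hα
  refine ⟨C, hC0, fun φ hφ => ?_⟩
  have hfin := isFiniteMeasureOnCompacts_arcLength hγ hL
  obtain ⟨hX, hXn⟩ := norm_sq_of_ae (covX_ofTest_ae hA hφ)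
  obtain ⟨hY, hYn⟩ := norm_sq_of_ae (covY_ofTest_ae hA hφ)
  have h := hC _ _ φ hφ hX hY
  have hτ2 : τ (ofTest φ hφ) = (hφ.memLp 2 (arcLength γ)).toLp φ :=
    Lp.ext ((hτ φ hφ).trans (MemLp.coeFn_toLp _).symm)
  rw [hτ2, norm_toLp_sq, hXn, hYn, norm_toL2_sq (hφ.memLp 2 volume)]
  exact h

/-- The trace is bounded with respect to the magnetic Sobolev norm. -/
theorem exists_trace_le (ha : 0 < a) (hγ : Continuous γ) (hout : ∀ x, a ≤ |x| → γ x = x)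
    (hin : ∀ x, |x| < a → |γ x| ≤ a) {L : ℝ} (hL : ∀ x, |deriv γ x| ≤ L)
    (hτ : ∀ φ hφ, τ (ofTest φ hφ) =ᵐ[arcLength γ] φ) {α : ℝ} (hα : 0 ≤ α) :
    ∃ C, 0 ≤ C ∧ ∀ U, α * ‖τ U‖ ^ 2 ≤ ‖covX hA U‖ ^ 2 + ‖covY hA U‖ ^ 2 + C * ‖comp 0 U‖ ^ 2 := by
  obtain ⟨C, hC0, hC⟩ := trace_le_ofTest hA ha hγ hout hin hL hτ hα
  refine ⟨α ^ 2 / 4 + C, by positivity, ?_⟩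
  refine Sob_induction (isClosed_le (by fun_prop) (by fun_prop)) fun φ hφ => ?_
  have hbox : ∫ p in Icc (-a) a ×ˢ Icc (-a) a, ‖φ p‖ ^ 2 ≤ ‖toL2 φ‖ ^ 2 := by
    rw [norm_toL2_sq (hφ.memLp 2 volume)]
    exact setIntegral_le_integral (integrable_norm_sq (hφ.memLp 2 volume))
      (Eventually.of_forall fun p => sq_nonneg _)
  have h1 := mul_le_mul_of_nonneg_left hbox hC0
  have h2 := hC φ hφ
  rw [comp_zero_ofTest]
  linarith

/-- The sharp trace inequality, up to a small error and a form of finite rank. -/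
theorem exists_trace_le_finiteRank (ha : 0 < a) (hγ : Continuous γ)
    (hout : ∀ x, a ≤ |x| → γ x = x)
    (hin : ∀ x, |x| < a → |γ x| ≤ a) {L : ℝ} (hL : ∀ x, |deriv γ x| ≤ L)
    (hτ : ∀ φ hφ, τ (ofTest φ hφ) =ᵐ[arcLength γ] φ) {α : ℝ} (hα : 0 ≤ α) {ε : ℝ} (hε : 0 < ε) :
    ∃ (n : ℕ) (e : Fin n → L2), ∀ U, α * ‖τ U‖ ^ 2 ≤ ‖covX hA U‖ ^ 2 + ‖covY hA U‖ ^ 2 +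
      α ^ 2 / 4 * ‖comp 0 U‖ ^ 2 + ε * ‖U‖ ^ 2 + ∑ j, ‖(inner ℂ (e j) (comp 0 U) : ℂ)‖ ^ 2 := by
  obtain ⟨C, hC0, hC⟩ := trace_le_ofTest hA ha hγ hout hin hL hτ hα
  -- The box term carries the factor `C`, possibly zero: `C (ε / (C + 1)) ≤ ε` serves the gradient,
  -- and `√C` goes into the vectors `e j`.
  obtain ⟨n, e, he⟩ := exists_finiteRank_box ha (ε := ε / (C + 1)) (by positivity)
  refine ⟨n, fun j => ((Real.sqrt C : ℝ) : ℂ) • e j, ?_⟩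
  refine Sob_induction (isClosed_le (by fun_prop) ?_) fun φ hφ => ?_
  · refine Continuous.add (by fun_prop) (continuous_finsetSum _ fun j _ => ?_)
    exact ((continuous_const.inner (comp 0).continuous).norm).pow 2
  have h1 := mul_le_mul_of_nonneg_left (he φ hφ) hC0
  have h2 := hC φ hφ
  have hsum : ∑ j, ‖(inner ℂ (((Real.sqrt C : ℝ) : ℂ) • e j) (comp 0 (ofTest φ hφ)) : ℂ)‖ ^ 2 =
      C * ∑ j, ‖(inner ℂ (e j) (toL2 φ) : ℂ)‖ ^ 2 := by
    rw [Finset.mul_sum]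
    refine Finset.sum_congr rfl fun j _ => ?_
    rw [inner_smul_left, norm_mul, mul_pow, Complex.norm_conj, Complex.norm_real,
      Real.norm_of_nonneg (Real.sqrt_nonneg _), Real.sq_sqrt hC0, comp_zero_ofTest]
  rw [hsum, comp_zero_ofTest]
  have hm1 := (hφ.fderiv_apply (1, 0)).memLp 2 volume
  have hm2 := (hφ.fderiv_apply (0, 1)).memLp 2 volume
  have hg : ∫ p, (‖fderiv ℝ φ p (1, 0)‖ ^ 2 + ‖fderiv ℝ φ p (0, 1)‖ ^ 2) ≤ ‖ofTest φ hφ‖ ^ 2 := by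
    rw [integral_add (integrable_norm_sq hm1) (integrable_norm_sq hm2), ← norm_toL2_sq hm1,
      ← norm_toL2_sq hm2, norm_sq_Sob, comp_one_ofTest, comp_two_ofTest]
    linarith [sq_nonneg ‖comp 0 (ofTest φ hφ)‖]
  have h3 : C * (ε / (C + 1) *
      ∫ p, (‖fderiv ℝ φ p (1, 0)‖ ^ 2 + ‖fderiv ℝ φ p (0, 1)‖ ^ 2)) ≤ ε * ‖ofTest φ hφ‖ ^ 2 := by
    have hc : C * (ε / (C + 1)) ≤ ε := by
      rw [mul_div_assoc', div_le_iff₀ (by positivity)]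
      nlinarith
    rw [← mul_assoc]
    exact mul_le_mul hc hg (integral_nonneg fun p => by positivity) hε.le
  rw [mul_add] at h1
  linarith

/-- Coercivity of the form. -/
theorem exists_coercive (ha : 0 < a) (hγ : Continuous γ) (hout : ∀ x, a ≤ |x| → γ x = x)
    (hin : ∀ x, |x| < a → |γ x| ≤ a) {L : ℝ} (hL : ∀ x, |deriv γ x| ≤ L)
    (hτ : ∀ φ hφ, τ (ofTest φ hφ) =ᵐ[arcLength γ] φ) {α : ℝ} (hα : 0 ≤ α) :
    ∃ δ > 0, ∃ c ≥ 0, ∀ U,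
      δ * ‖U‖ ^ 2 ≤ (inner ℂ U (formBdd hA α τ U)).re + c * ‖comp 0 U‖ ^ 2 := by
  obtain ⟨K, hK0, hK⟩ := exists_norm_sq_le_magnetic hA
  -- With `2α` in place of `α`, half of the magnetic energy absorbs the trace term and the other
  -- half remains to control the H¹ norm.
  obtain ⟨C, hC0, hC⟩ := exists_trace_le hA ha hγ hout hin hL hτ (α := 2 * α) (by positivity)
  refine ⟨(2 * K)⁻¹, by positivity, C / 2 + 1 / 2, by positivity, fun U => ?_⟩
  rw [re_inner_formBdd, inv_mul_le_iff₀ (by positivity)]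
  have h1 := hK U
  have h2 := hC U
  have h3 : K * (‖comp 0 U‖ ^ 2 + ‖covX hA U‖ ^ 2 + ‖covY hA U‖ ^ 2) ≤
      K * (2 * (‖covX hA U‖ ^ 2 + ‖covY hA U‖ ^ 2 - α * ‖τ U‖ ^ 2 +
        (C / 2 + 1 / 2) * ‖comp 0 U‖ ^ 2)) := by
    refine mul_le_mul_of_nonneg_left ?_ hK0.le
    linarith
  linarith

/-- The form is bounded below by any `μ < -α² / 4` up to a form of finite rank. -/
theorem exists_lower_bound_finiteRank (ha : 0 < a) (hγ : Continuous γ)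
    (hout : ∀ x, a ≤ |x| → γ x = x)
    (hin : ∀ x, |x| < a → |γ x| ≤ a) {L : ℝ} (hL : ∀ x, |deriv γ x| ≤ L)
    (hτ : ∀ φ hφ, τ (ofTest φ hφ) =ᵐ[arcLength γ] φ) {α : ℝ} (hα : 0 ≤ α) {μ : ℝ}
    (hμ : μ < -(α ^ 2 / 4)) :
    ∃ (n : ℕ) (e : Fin n → L2), ∀ U, μ * ‖comp 0 U‖ ^ 2 ≤
      (inner ℂ U (formBdd hA α τ U)).re + ∑ j, ‖(inner ℂ (e j) (comp 0 U) : ℂ)‖ ^ 2 := by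
  obtain ⟨δ, hδ, c, hc, hcoer⟩ := exists_coercive hA ha hγ hout hin hL hτ hα
  -- The error `ηδ ‖U‖²` of the sharp trace inequality is absorbed by the form itself through
  -- coercivity, at the cost of `η (q + c ‖u‖²)`. The choice makes `η (c + 1)` equal to the gap
  -- between `μ` and the threshold.
  set η : ℝ := (-(α ^ 2 / 4) - μ) / (c + 1) with hη
  have hη0 : 0 < η := div_pos (by linarith) (by linarith)
  obtain ⟨n, e, he⟩ := exists_trace_le_finiteRank hA ha hγ hout hin hL hτ hα
    (ε := η * δ) (by positivity)
  refine ⟨n, e, fun U => ?_⟩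
  have h1 := he U
  have h2 := hcoer U
  rw [re_inner_formBdd] at h2 ⊢
  set q := ‖covX hA U‖ ^ 2 + ‖covY hA U‖ ^ 2 - α * ‖τ U‖ ^ 2
  set s := ∑ j, ‖(inner ℂ (e j) (comp 0 U) : ℂ)‖ ^ 2 with hs
  have hs0 : 0 ≤ s := Finset.sum_nonneg fun j _ => sq_nonneg _
  have h3 : η * δ * ‖U‖ ^ 2 ≤ η * (q + c * ‖comp 0 U‖ ^ 2) := by
    rw [mul_assoc]; exact mul_le_mul_of_nonneg_left h2 hη0.le
  have h4 : η * (c + 1) = -(α ^ 2 / 4) - μ := by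
    rw [hη, div_mul_cancel₀]; positivity
  have hx0 : 0 ≤ ‖comp 0 U‖ ^ 2 := sq_nonneg _
  set x := ‖comp 0 U‖ ^ 2
  -- `(1 + η) q ≥ -(α²/4 + η c) x - s`
  have h5 : -(α ^ 2 / 4 + η * c) * x - s ≤ (1 + η) * q := by
    have : q = ‖covX hA U‖ ^ 2 + ‖covY hA U‖ ^ 2 - α * ‖τ U‖ ^ 2 := rfl
    nlinarith
  have h6 : (1 + η) * (μ * x - s) ≤ (1 + η) * q := by
    refine le_trans ?_ h5
    have e1 : η * c = -(α ^ 2 / 4) - μ - η := by linarith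
    have e2 : 0 ≤ η * s := by positivity
    have e3 : 0 ≤ η * x := by positivity
    have e4 : η * (μ * x) ≤ 0 := by
      have : μ ≤ 0 := by nlinarith [sq_nonneg α]
      exact mul_nonpos_of_nonneg_of_nonpos hη0.le (mul_nonpos_of_nonpos_of_nonneg this hx0)
    rw [e1]
    nlinarith
  have h7 := le_of_mul_le_mul_left h6 (by positivity)
  linarith

end LowerBounds

/-! ### Removing the potential where the field vanishes -/

section Gauge

variable {A : Plane → ℝ × ℝ} {B : Plane → ℝ}

/-- The vector potential is square integrable on balls. -/
theorem MapsH1ToL2.memLp_cutoff (hA : MapsH1ToL2 A) {θ : Plane → ℝ} (hθ : IsTest θ) :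
    MemLp (fun p => (A p).1 * θ p) 2 volume ∧ MemLp (fun p => (A p).2 * θ p) 2 volume := by
  have hc := coeFn_toL2 (hθ.ofReal.memLp 2 volume)
  -- A cut-off function belongs to H¹, so the hypothesis on the potential applies to it directly.
  have h1 := hA.fst (ofTest _ hθ.ofReal)
  have h2 := hA.snd (ofTest _ hθ.ofReal)
  rw [comp_zero_ofTest] at h1 h2
  constructor
  · refine h1.re.ae_eq ?_
    filter_upwards [hc] with p hp
    rw [hp, ← Complex.ofReal_mul]; rfl
  · refine h2.re.ae_eq ?_
    filter_upwards [hc] with p hp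
    rw [hp, ← Complex.ofReal_mul]; rfl

/-- The mollified potential is curl free away from the support of the field. -/
theorem fderiv_moll_eq_of_isRot (hrot : IsRot A B) {θ ρ : Plane → ℝ} (hρ : IsTest ρ)
    (h1 : LocallyIntegrable (fun p => (A p).1 * θ p) volume)
    (h2 : LocallyIntegrable (fun p => (A p).2 * θ p) volume) {p : Plane}
    (hp : ∀ q, p - q ∈ tsupport ρ → θ q = 1 ∧ B q = 0) :
    fderiv ℝ (moll ρ fun q => (A q).2 * θ q) p (1, 0) =
      fderiv ℝ (moll ρ fun q => (A q).1 * θ q) p (0, 1) := by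
  rw [fderiv_moll hρ h2, fderiv_moll hρ h1, ← sub_eq_zero]
  have hi : ∀ (w : Plane → ℝ) (e : Plane), LocallyIntegrable w volume →
      Integrable fun q => (fderiv ℝ ρ (p - q) e) • w q := by
    intro w e hw
    have := isTest_comp_sub (hρ.fderiv_apply e) p
    exact hw.integrable_smul_left_of_hasCompactSupport this.continuous this.2
  rw [← integral_sub (hi _ _ h2) (hi _ _ h1)]
  -- The curl of the mollification at `p` is the distributional curl tested with `q ↦ ρ (p - q)`. On
  -- the support of this function the cut-off equals 1 and the field vanishes.
  have h := hrot _ (isTest_comp_sub hρ p)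
  have hB : ∫ q, B q * ρ (p - q) = 0 := by
    rw [← integral_zero Plane ℝ]
    refine integral_congr_ae (Eventually.of_forall fun q => ?_)
    by_cases hq : p - q ∈ tsupport ρ
    · simp [(hp q hq).2]
    · simp [image_eq_zero_of_notMem_tsupport hq]
  refine Eq.trans ?_ (h.trans hB)
  refine integral_congr_ae (Eventually.of_forall fun q => ?_)
  simp only [fderiv_comp_sub hρ, smul_eq_mul]
  by_cases hq : p - q ∈ tsupport ρ
  · rw [(hp q hq).1]; ring
  · have : fderiv ℝ ρ (p - q) = 0 :=
      image_eq_zero_of_notMem_tsupport fun h => hq (tsupport_fderiv_subset ℝ h)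
    simp [this]

/-- The one-form with the given coefficients. -/
def oneForm (c₁ c₂ : Plane → ℝ) (p : Plane) : Plane →L[ℝ] ℝ :=
  c₁ p • ContinuousLinearMap.fst ℝ ℝ ℝ + c₂ p • ContinuousLinearMap.snd ℝ ℝ ℝ

/-- A smooth closed one-form on a convex open set is the differential of a smooth function. -/
theorem exists_potential {c₁ c₂ : Plane → ℝ} (hc₁ : ContDiff ℝ ∞ c₁) (hc₂ : ContDiff ℝ ∞ c₂)
    {s : Set Plane} (hs : Convex ℝ s) (hso : IsOpen s)
    (hcl : ∀ p ∈ s, fderiv ℝ c₂ p (1, 0) = fderiv ℝ c₁ p (0, 1)) :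
    ∃ χ : Plane → ℝ, ContDiffOn ℝ ∞ χ s ∧ ∀ p ∈ s, HasFDerivAt χ (oneForm c₁ c₂ p) p := by
  have hω : ContDiff ℝ ∞ (oneForm c₁ c₂) :=
    (hc₁.smul contDiff_const).add (hc₂.smul contDiff_const)
  have hd₁ : Differentiable ℝ c₁ := hc₁.differentiable (by simp)
  have hd₂ : Differentiable ℝ c₂ := hc₂.differentiable (by simp)
  have hder : ∀ p x y, fderiv ℝ (oneForm c₁ c₂) p x y =
      fderiv ℝ c₁ p x * y.1 + fderiv ℝ c₂ p x * y.2 := by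
    intro p x y
    have h := ((hd₁ p).hasFDerivAt.smul_const (ContinuousLinearMap.fst ℝ ℝ ℝ)).add
      ((hd₂ p).hasFDerivAt.smul_const (ContinuousLinearMap.snd ℝ ℝ ℝ))
    have h' : fderiv ℝ (oneForm c₁ c₂) p = _ := h.fderiv
    rw [h']
    simp
  have hlin : ∀ (ℓ : Plane →L[ℝ] ℝ) (x : Plane), ℓ x = x.1 * ℓ (1, 0) + x.2 * ℓ (0, 1) := by
    intro ℓ x
    conv_lhs => rw [show x = x.1 • ((1 : ℝ), (0 : ℝ)) + x.2 • ((0 : ℝ), (1 : ℝ)) by ext <;> simp]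
    rw [map_add, map_smul, map_smul, smul_eq_mul, smul_eq_mul]
  -- Poincaré's lemma: `hcl` says that the derivative of the one-form is symmetric, because a
  -- bilinear form on the plane is symmetric as soon as its two off-diagonal entries agree.
  obtain ⟨χ, hχ⟩ := hs.exists_forall_hasFDerivAt_of_fderiv_symmetric hso
    (hω.differentiable (by simp)).differentiableOn (fun p hp x y => by
      rw [hder, hder, hlin (fderiv ℝ c₁ p) x, hlin (fderiv ℝ c₂ p) x, hlin (fderiv ℝ c₁ p) y,
        hlin (fderiv ℝ c₂ p) y, hcl p hp]
      ring)
  refine ⟨χ, (contDiffOn_infty_iff_fderiv_of_isOpen hso).2 ⟨fun p hp =>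
    (hχ p hp).differentiableAt.differentiableWithinAt, ?_⟩, hχ⟩
  exact hω.contDiffOn.congr fun p hp => (hχ p hp).fderiv

/-- A smooth compactly supported function that equals `exp (iχ)` on a ball. -/
theorem exists_gauge_function {c₁ c₂ : Plane → ℝ} {χ : Plane → ℝ} {c : Plane} {r : ℝ} (hr : 0 < r)
    (hsm : ContDiffOn ℝ ∞ χ (Metric.ball c (r + 1)))
    (hχ : ∀ p ∈ Metric.ball c (r + 1), HasFDerivAt χ (oneForm c₁ c₂ p) p) :
    ∃ g : Plane → ℂ, IsTest g ∧ (∀ p, ‖g p‖ ≤ 1) ∧ ∀ p ∈ Metric.closedBall c r, ‖g p‖ = 1 ∧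
      fderiv ℝ g p (1, 0) = Complex.I * c₁ p * g p ∧
      fderiv ℝ g p (0, 1) = Complex.I * c₂ p * g p := by
  -- The cut-off is 1 on a neighbourhood of the closed ball of radius `r`, so derivatives there are
  -- those of `exp (iχ)`, and its support stays in the ball of radius `r + 1` where `χ` is smooth.
  let θ : ContDiffBump c := ⟨r + 1 / 3, r + 2 / 3, by linarith, by linarith⟩
  have hθ : IsTest (θ : Plane → ℝ) := ⟨θ.contDiff, θ.hasCompactSupport⟩
  set g : Plane → ℂ := fun p => (θ p : ℂ) * Complex.exp ((χ p : ℂ) * Complex.I) with hg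
  have hts : tsupport g ⊆ Metric.ball c (r + 1) := by
    refine (tsupport_mul_subset_left (f := fun p => (θ p : ℂ))).trans ?_
    have h1 : tsupport (fun p => (θ p : ℂ)) ⊆ tsupport θ :=
      tsupport_comp_subset Complex.ofReal_zero (θ : Plane → ℝ)
    refine h1.trans ?_
    rw [θ.tsupport_eq]
    exact Metric.closedBall_subset_ball (by change r + 2 / 3 < r + 1; linarith)
  have hopen : ∀ p ∈ Metric.ball c (r + 1), Metric.ball c (r + 1) ∈ 𝓝 p :=
    fun p hp => Metric.isOpen_ball.mem_nhds hp
  refine ⟨g, ⟨contDiff_iff_contDiffAt.2 fun p => ?_, hθ.ofReal.2.mul_right⟩, fun p => ?_,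
    fun p hp => ?_⟩
  · by_cases hp : p ∈ tsupport g
    swap
    · exact contDiffAt_const.congr_of_eventuallyEq (notMem_tsupport_iff_eventuallyEq.1 hp)
    have h1 : ContDiffAt ℝ ∞ χ p := hsm.contDiffAt (hopen p (hts hp))
    have h2 : ContDiffAt ℝ ∞ (fun p => (χ p : ℂ)) p := Complex.ofRealCLM.contDiff.contDiffAt.comp p h1
    exact hθ.ofReal.1.contDiffAt.mul (h2.mul contDiffAt_const).cexp
  · rw [hg]
    simp only [norm_mul, Complex.norm_exp_ofReal_mul_I, mul_one, Complex.norm_real,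
      Real.norm_of_nonneg θ.nonneg]
    exact θ.le_one
  · have hp1 : p ∈ Metric.ball c (r + 1 / 3) := Metric.closedBall_subset_ball (by linarith) hp
    have hp2 : p ∈ Metric.ball c (r + 1) := Metric.ball_subset_ball (by linarith) hp1
    have hgp : g =ᶠ[𝓝 p] fun p => Complex.exp ((χ p : ℂ) * Complex.I) := by
      filter_upwards [Metric.isOpen_ball.mem_nhds hp1] with q hq
      rw [hg]
      simp only
      rw [θ.one_of_mem_closedBall (Metric.ball_subset_closedBall hq), Complex.ofReal_one, one_mul]
    have hd : HasFDerivAt (fun p => Complex.exp ((χ p : ℂ) * Complex.I)) _ p :=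
      ((Complex.ofRealCLM.hasFDerivAt.comp p (hχ p hp2)).mul_const Complex.I).cexp
    refine ⟨?_, ?_, ?_⟩
    · rw [hgp.eq_of_nhds, Complex.norm_exp_ofReal_mul_I]
    · rw [hgp.fderiv_eq, hd.fderiv, hgp.eq_of_nhds]
      simp [oneForm]; ring
    · rw [hgp.fderiv_eq, hd.fderiv, hgp.eq_of_nhds]
      simp [oneForm]; ring

/-- Up to a small error in `L²`, the vector potential is a pure gauge on balls away from the
support of the field. -/
theorem exists_gauge (hA : MapsH1ToL2 A) (hrot : IsRot A B) {c : Plane} {r : ℝ} (hr : 0 < r)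
    (hB : ∀ p ∈ Metric.ball c (r + 2), B p = 0) {ε : ℝ} (hε : 0 < ε) :
    ∃ (g : Plane → ℂ) (c₁ c₂ : Plane → ℝ), IsTest g ∧ (∀ p, ‖g p‖ ≤ 1) ∧
      (∀ p ∈ Metric.closedBall c r, ‖g p‖ = 1 ∧
        fderiv ℝ g p (1, 0) = Complex.I * c₁ p * g p ∧
        fderiv ℝ g p (0, 1) = Complex.I * c₂ p * g p) ∧
      (MemLp (fun p => (A p).1 - c₁ p) 2 (volume.restrict (Metric.closedBall c r)) ∧
        eLpNorm (fun p => (A p).1 - c₁ p) 2 (volume.restrict (Metric.closedBall c r)) ≤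
          ENNReal.ofReal ε) ∧
      MemLp (fun p => (A p).2 - c₂ p) 2 (volume.restrict (Metric.closedBall c r)) ∧
        eLpNorm (fun p => (A p).2 - c₂ p) 2 (volume.restrict (Metric.closedBall c r)) ≤
          ENNReal.ofReal ε := by
  -- The mollification radius will be below 1, so on the ball of radius `r + 1` the mollified
  -- potential sees only the ball of radius `r + 2`, where the cut-off is 1 and the field is zero.
  let θ : ContDiffBump c := ⟨r + 2, r + 3, by linarith, by linarith⟩
  have hθ : IsTest (θ : Plane → ℝ) := ⟨θ.contDiff, θ.hasCompactSupport⟩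
  have hθ1 : ∀ q ∈ Metric.ball c (r + 2), θ q = 1 := fun q hq =>
    θ.one_of_mem_closedBall (Metric.ball_subset_closedBall hq)
  obtain ⟨hm1, hm2⟩ := hA.memLp_cutoff hθ
  have hl1 := hm1.locallyIntegrable (by norm_num)
  have hl2 := hm2.locallyIntegrable (by norm_num)
  obtain ⟨b, hb⟩ := exists_contDiffBump_rOut_lt
  have hε' : 0 < ENNReal.ofReal ε := by simpa using hε
  obtain ⟨n, hn1, hn2, hn3⟩ := ((hb.eventually (gt_mem_nhds one_pos)).and
    (((tendsto_eLpNorm_moll hm1 hb).eventually (ge_mem_nhds hε')).and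
    ((tendsto_eLpNorm_moll hm2 hb).eventually (ge_mem_nhds hε')))).exists
  set ρ : Plane → ℝ := (b n).normed volume with hρdef
  have hρ : IsTest ρ := isTest_normed (b n)
  have hs1 := contDiff_moll hρ hl1
  have hs2 := contDiff_moll hρ hl2
  obtain ⟨χ, hχs, hχ⟩ := exists_potential hs1 hs2 (convex_ball c (r + 1)) Metric.isOpen_ball
    fun p hp => fderiv_moll_eq_of_isRot hrot hρ hl1 hl2 fun q hq => by
      rw [hρdef, (b n).tsupport_normed_eq, mem_closedBall_zero_iff] at hq
      have hq2 : q ∈ Metric.ball c (r + 2) := by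
        rw [Metric.mem_ball] at hp ⊢
        have := dist_triangle q p c
        rw [dist_comm q p, dist_eq_norm p q] at this
        linarith
      exact ⟨hθ1 q hq2, hB q hq2⟩
  obtain ⟨g, hg, hg1, hgK⟩ := exists_gauge_function hr hχs hχ
  have hsub : Metric.closedBall c r ⊆ Metric.ball c (r + 2) :=
    Metric.closedBall_subset_ball (by linarith)
  have key : ∀ w : Plane → ℝ, MemLp (fun p => w p * θ p) 2 volume →
      eLpNorm (fun p => moll ρ (fun q => w q * θ q) p - w p * θ p) 2 volume ≤ ENNReal.ofReal ε →
      MemLp (fun p => w p - moll ρ (fun q => w q * θ q) p) 2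
        (volume.restrict (Metric.closedBall c r)) ∧
      eLpNorm (fun p => w p - moll ρ (fun q => w q * θ q) p) 2
        (volume.restrict (Metric.closedBall c r)) ≤ ENNReal.ofReal ε := by
    intro w hw hle
    have hae : (fun p => w p - moll ρ (fun q => w q * θ q) p) =ᵐ[volume.restrict
        (Metric.closedBall c r)]
          fun p => -(moll ρ (fun q => w q * θ q) p - w p * θ p) := by
      filter_upwards [ae_restrict_mem Metric.isClosed_closedBall.measurableSet] with p hp
      rw [hθ1 p (hsub hp)]; ring
    have hsm : AEStronglyMeasurable (fun p => moll ρ (fun q => w q * θ q) p - w p * θ p) volume :=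
      (contDiff_moll hρ (hw.locallyIntegrable (by norm_num))).continuous.aestronglyMeasurable.sub
        hw.1
    have hle2 : eLpNorm (fun p => w p - moll ρ (fun q => w q * θ q) p) 2
        (volume.restrict (Metric.closedBall c r)) ≤ ENNReal.ofReal ε := by
      rw [eLpNorm_congr_ae hae]
      change eLpNorm (-fun p => (moll ρ (fun q => w q * θ q) p - w p * θ p)) 2 _ ≤ _
      rw [eLpNorm_neg]
      exact (eLpNorm_restrict_le _ _ _ _).trans hle
    exact ⟨⟨(hsm.restrict.neg).congr hae.symm, hle2.trans_lt ENNReal.ofReal_lt_top⟩, hle2⟩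
  exact ⟨g, _, _, hg, hg1, hgK, key _ hm1 hn2, key _ hm2 hn3⟩

end Gauge

/-! ### Cut-offs and the sign function on the line -/

section Profiles

/-- Cut-off functions on the line at scale `N`. -/
theorem exists_cutoff_line : ∃ C : ℝ, 0 < C ∧ ∀ N : ℝ, 1 ≤ N → ∃ z : ℝ → ℝ, ContDiff ℝ ∞ z ∧
    (∀ t, |z t| ≤ 1) ∧ (∀ t, |t| ≤ N → z t = 1) ∧
    (∀ t, 2 * N < |t| → z t = 0 ∧ deriv z t = 0 ∧ deriv (deriv z) t = 0) ∧
    ∀ t, |deriv z t| ≤ C / N ∧ |deriv (deriv z) t| ≤ C / N := by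
  let ζ : ContDiffBump (0 : ℝ) := ⟨1, 2, by norm_num, by norm_num⟩
  have hs0 : ContDiff ℝ ∞ (ζ : ℝ → ℝ) := ζ.contDiff
  have hs1 : ContDiff ℝ ∞ (deriv (ζ : ℝ → ℝ)) := (contDiff_infty_iff_deriv.1 hs0).2
  have hs2 : ContDiff ℝ ∞ (deriv (deriv (ζ : ℝ → ℝ))) := (contDiff_infty_iff_deriv.1 hs1).2
  have hc0 : HasCompactSupport (ζ : ℝ → ℝ) := ζ.hasCompactSupport
  obtain ⟨C1, hC1⟩ := hc0.deriv.exists_bound_of_continuous hs1.continuous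
  obtain ⟨C2, hC2⟩ := hc0.deriv.deriv.exists_bound_of_continuous hs2.continuous
  have hts : ∀ s : ℝ, 2 < |s| → s ∉ tsupport (ζ : ℝ → ℝ) := by
    intro s hs h
    rw [ζ.tsupport_eq, mem_closedBall_zero_iff, Real.norm_eq_abs] at h
    exact absurd h (not_le.2 hs)
  refine ⟨max 1 (max C1 C2), by positivity, fun N hN => ?_⟩
  have hN0 : 0 < N := by linarith
  have hd : ∀ (f : ℝ → ℝ), ContDiff ℝ ∞ f → ∀ t,
      deriv (fun t => f (t / N)) t = deriv f (t / N) / N := by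
    intro f hf t
    have h1 : HasDerivAt (fun t : ℝ => t / N) (1 / N) t := (hasDerivAt_id t).div_const N
    have := ((hf.differentiable (by simp) (t / N)).hasDerivAt.comp t h1).deriv
    rw [mul_one_div] at this
    exact this
  have hd1 : deriv (fun t => ζ (t / N)) = fun t => deriv ζ (t / N) / N := funext (hd _ hs0)
  have hd2 : ∀ t, deriv (deriv (fun t => ζ (t / N))) t = deriv (deriv ζ) (t / N) / N / N := by
    intro t
    rw [hd1, deriv_div_const, hd _ hs1]
  have hinv : 1 / N ≤ 1 := by rw [div_le_one hN0]; exact hN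
  refine ⟨fun t => ζ (t / N), hs0.comp (contDiff_id.div_const N), fun t => ?_, fun t ht => ?_,
    fun t ht => ?_, fun t => ?_⟩
  · rw [abs_of_nonneg ζ.nonneg]; exact ζ.le_one
  · apply ζ.one_of_mem_closedBall
    rw [mem_closedBall_zero_iff, Real.norm_eq_abs, abs_div, abs_of_pos hN0]
    exact (div_le_one hN0).2 ht
  · have h2 : 2 < |t / N| := by rwa [abs_div, abs_of_pos hN0, lt_div_iff₀ hN0]
    have h3 := hts _ h2
    have h4 : t / N ∉ tsupport (deriv ζ) := fun h => h3 (tsupport_deriv_subset h)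
    have h5 : t / N ∉ tsupport (deriv (deriv ζ)) := fun h => h4 (tsupport_deriv_subset h)
    rw [hd2, hd1]
    simp only
    rw [image_eq_zero_of_notMem_tsupport h3, image_eq_zero_of_notMem_tsupport h4,
      image_eq_zero_of_notMem_tsupport h5]
    simp
  · rw [hd2, hd1]
    simp only
    have e1 := hC1 (t / N)
    have e2 := hC2 (t / N)
    rw [Real.norm_eq_abs] at e1 e2
    constructor
    · rw [abs_div, abs_of_pos hN0]
      gcongr
      exact e1.trans ((le_max_left _ _).trans (le_max_right _ _))
    · rw [abs_div, abs_div, abs_of_pos hN0]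
      gcongr
      -- The second derivative is of order `N⁻²`; as `N ≥ 1`, one factor may be given away.
      rw [div_le_iff₀ hN0]
      have := e2.trans ((le_max_right C1 _).trans (le_max_right 1 _))
      have h1 : 0 ≤ max 1 (max C1 C2) := by positivity
      nlinarith

theorem hasCompactSupport_of_abs_lt {F : Type*} [Zero F] {f : ℝ → F} {R : ℝ}
    (h : ∀ t, R < |t| → f t = 0) : HasCompactSupport f := by
  refine HasCompactSupport.intro (isCompact_closedBall (0 : ℝ) R) fun t ht => h t ?_
  rw [mem_closedBall_zero_iff, Real.norm_eq_abs, not_le] at ht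
  exact ht

theorem integrable_of_bounded_support {F : Type*} [NormedAddCommGroup F] {f : ℝ → F} {M R : ℝ}
    (hm : AEStronglyMeasurable f volume) (hM : ∀ t, ‖f t‖ ≤ M) (hR : ∀ t, R < |t| → f t = 0) :
    Integrable f := by
  have h : IntegrableOn f (Metric.closedBall 0 R) :=
    Measure.integrableOn_of_bounded (measure_closedBall_lt_top.ne) hm (M := M)
      (Eventually.of_forall hM)
  rwa [integrableOn_iff_integrable_of_support_subset] at h
  intro t ht
  by_contra hn
  rw [mem_closedBall_zero_iff, Real.norm_eq_abs, not_le] at hn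
  exact ht (hR t hn)

theorem integral_le_of_bounded_support {f : ℝ → ℝ} {M R : ℝ} (hR0 : 0 ≤ R)
    (hm : AEStronglyMeasurable f volume) (h0 : ∀ t, 0 ≤ f t) (hM : ∀ t, f t ≤ M)
    (hR : ∀ t, R < |t| → f t = 0) : ∫ t, f t ≤ 2 * R * M := by
  have hi := integrable_of_bounded_support hm
    (fun t => by rw [Real.norm_of_nonneg (h0 t)]; exact hM t) hR
  have hsub : Function.support f ⊆ Metric.closedBall 0 R := by
    intro t ht
    by_contra hn
    rw [mem_closedBall_zero_iff, Real.norm_eq_abs, not_le] at hn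
    exact ht (hR t hn)
  rw [← setIntegral_eq_integral_of_forall_compl_eq_zero (s := Metric.closedBall 0 R)
    (fun t ht => by by_contra h; exact ht (hsub h))]
  calc ∫ t in Metric.closedBall 0 R, f t ≤ ∫ _ in Metric.closedBall (0 : ℝ) R, M :=
        setIntegral_mono hi.integrableOn (integrableOn_const measure_closedBall_lt_top.ne) hM
    _ = 2 * R * M := by
        rw [setIntegral_const, Measure.real, Real.volume_closedBall,
          ENNReal.toReal_ofReal (by positivity), smul_eq_mul]

/-- The sign of a real number, with value `-1` at `0`. -/
def sgn (t : ℝ) : ℝ := if 0 < t then 1 else -1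

theorem sgn_sq (t : ℝ) : sgn t ^ 2 = 1 := by unfold sgn; split <;> norm_num

theorem abs_sgn (t : ℝ) : |sgn t| = 1 := by unfold sgn; split <;> norm_num

theorem sgn_mul_self (t : ℝ) : sgn t * t = |t| := by
  unfold sgn
  split
  · rw [one_mul, abs_of_pos ‹_›]
  · rw [neg_one_mul, abs_of_nonpos (not_lt.1 ‹_›)]

theorem measurable_sgn : Measurable sgn :=
  Measurable.ite measurableSet_Ioi measurable_const measurable_const

/-- The jump of `sgn` at the origin contributes twice the value of `f`. This is the source of the
point interaction in the transversal problem. -/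
theorem integral_sgn_mul_deriv {f : ℝ → ℂ} (hf : ContDiff ℝ 1 f) (hc : HasCompactSupport f) :
    ∫ t, (sgn t : ℂ) * deriv f t = -2 * f 0 := by
  have hi : Integrable (deriv f) :=
    (hf.continuous_deriv le_rfl).integrable_of_hasCompactSupport hc.deriv
  have e1 : ∫ t in Iic 0, (sgn t : ℂ) * deriv f t = -f 0 := by
    rw [← hc.integral_Iic_deriv_eq hf 0, ← integral_neg]
    refine setIntegral_congr_fun measurableSet_Iic fun t ht => ?_
    simp [sgn, not_lt.2 (mem_Iic.1 ht)]
  have e2 : ∫ t in Ioi 0, (sgn t : ℂ) * deriv f t = -f 0 := by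
    rw [← hc.integral_Ioi_deriv_eq hf 0]
    refine setIntegral_congr_fun measurableSet_Ioi fun t ht => ?_
    simp [sgn, mem_Ioi.1 ht]
  have hi2 : Integrable fun t => (sgn t : ℂ) * deriv f t := by
    refine hi.norm.mono' ((Complex.measurable_ofReal.comp measurable_sgn).aestronglyMeasurable.mul
      hi.1) (Eventually.of_forall fun t => ?_)
    rw [norm_mul, Complex.norm_real, Real.norm_eq_abs, abs_sgn, one_mul]
  rw [← intervalIntegral.integral_Iic_add_Ioi (b := 0) hi2.integrableOn hi2.integrableOn, e1, e2]
  ring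

theorem integral_deriv_mul_line {h f : ℝ → ℂ} (hh : ContDiff ℝ 1 h) (hf : ContDiff ℝ 1 f)
    (hc : HasCompactSupport f) : ∫ t, deriv h t * f t = -∫ t, h t * deriv f t := by
  have hi : ∀ {u v : ℝ → ℂ}, Continuous u → Continuous v → HasCompactSupport v →
      Integrable (u * v) := fun hu hv hcs =>
    (hu.mul hv).integrable_of_hasCompactSupport hcs.mul_left
  have := integral_mul_deriv_eq_deriv_mul_of_integrable (u := h) (v := f) (u' := deriv h)
    (v' := deriv f) (fun t _ => (hh.differentiable (by simp) t).hasDerivAt)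
    (fun t _ => (hf.differentiable (by simp) t).hasDerivAt)
    (hi hh.continuous (hf.continuous_deriv le_rfl) hc.deriv)
    (hi (hh.continuous_deriv le_rfl) hf.continuous hc)
    (hi hh.continuous hf.continuous hc)
  rw [this, neg_neg]

end Profiles

/-! ### Transversal quasi-modes for a point interaction -/

section Transversal

/-- For `s ∈ [0, 1]` one has `(1 - s)² ≤ 1 - s²`. The right side is a Lorentz profile of width `k`
and integral `kπ`, so smoothing the sign at scale `k` costs little in L². -/
theorem sq_one_sub_sgn_le {k : ℝ} (hk : 0 < k) (t : ℝ) :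
    (1 - sgn t * (t / √(t ^ 2 + k ^ 2))) ^ 2 ≤ (1 + (t / k) ^ 2)⁻¹ := by
  set s := √(t ^ 2 + k ^ 2) with hs
  have hs0 : 0 < s := Real.sqrt_pos.2 (by positivity)
  have hs2 : s ^ 2 = t ^ 2 + k ^ 2 := Real.sq_sqrt (by positivity)
  have h1 : sgn t * (t / s) = |t| / s := by rw [← mul_div_assoc, sgn_mul_self]
  have h2 : |t| / s ≤ 1 := by
    rw [div_le_one hs0]
    exact abs_le_of_sq_le_sq (by nlinarith) hs0.le
  have h3 : (1 + (t / k) ^ 2)⁻¹ = 1 - (|t| / s) ^ 2 := by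
    rw [div_pow, div_pow, sq_abs, hs2]
    field_simp
    ring
  rw [h1, h3]
  have h4 : 0 ≤ |t| / s := by positivity
  nlinarith

theorem integrable_mul_of_bounded_support {u f : ℝ → ℂ} {R : ℝ} (hu : Continuous u)
    (hf : Integrable f) (hR : ∀ t, R < |t| → f t = 0) : Integrable fun t => u t * f t := by
  have h : IntegrableOn (fun t => u t * f t) (Metric.closedBall 0 R) :=
    hf.integrableOn.continuousOn_mul hu.continuousOn (isCompact_closedBall _ _)
  rwa [integrableOn_iff_integrable_of_support_subset] at h
  intro t ht
  by_contra hn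
  rw [mem_closedBall_zero_iff, Real.norm_eq_abs, not_le] at hn
  exact ht (by simp [hR t hn])

theorem integral_lorentz {k : ℝ} (hk : 0 < k) :
    Integrable (fun t : ℝ => (1 + (t / k) ^ 2)⁻¹) ∧ ∫ t : ℝ, (1 + (t / k) ^ 2)⁻¹ = k * Real.pi := by
  refine ⟨integrable_inv_one_add_sq.comp_div hk.ne', ?_⟩
  rw [Measure.integral_comp_div (fun t : ℝ => (1 + t ^ 2)⁻¹) k, integral_univ_inv_one_add_sq,
    abs_of_pos hk, smul_eq_mul]

/-- Smooth approximations of `exp (-b|t|)` as weak quasi-modes of `-d²/dt² - 2bδ₀`, with bounds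
in terms of the smoothing scale `k` and the cut-off scale `N`. -/
theorem exists_transversal_bounds {b : ℝ} (hb : 0 < b) : ∃ C : ℝ, 0 < C ∧
    ∀ k : ℝ, 0 < k → ∀ N : ℝ, 1 ≤ N → ∃ P Q r : ℝ → ℝ, ContDiff ℝ ∞ P ∧ Measurable Q ∧
      Measurable r ∧ (∀ t, 2 * N < |t| → P t = 0 ∧ Q t = 0 ∧ r t = 0) ∧
      (∃ M, ∀ t, |Q t| ≤ M ∧ |r t| ≤ M) ∧
      Real.exp (-2 * b) ≤ ∫ t, P t ^ 2 ∧
      (∫ t, (deriv P t - Q t) ^ 2 ≤ C * (k + 1 / N)) ∧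
      (∫ t, r t ^ 2 ≤ C * (k + 1 / N)) ∧
      ∀ h : ℝ → ℂ, ContDiff ℝ 1 h → ∫ t, deriv h t * Q t =
        2 * b * (h 0 * P 0) - b ^ 2 * (∫ t, h t * P t) + ∫ t, h t * r t := by
  obtain ⟨C, hC0, hC⟩ := exists_cutoff_line
  refine ⟨b ^ 2 * Real.pi + 3 * b ^ 4 * Real.pi + 16 * (4 * b ^ 2 * C ^ 2 + C ^ 2),
    by positivity, fun k hk N hN => ?_⟩
  have hN0 : 0 < N := by linarith
  obtain ⟨z, hz, hz1, hzN, hz0, hzC⟩ := hC N hN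
  have hz' : ContDiff ℝ ∞ (deriv z) := (contDiff_infty_iff_deriv.1 hz).2
  have hz'' : ContDiff ℝ ∞ (deriv (deriv z)) := (contDiff_infty_iff_deriv.1 hz').2
  have hpos : ∀ t : ℝ, t ^ 2 + k ^ 2 ≠ 0 := fun t => by positivity
  -- A smooth replacement for `exp (-b|t|)` with `E 0 = 1`; its logarithmic derivative is `-b w`,
  -- where `w` is a smoothed sign.
  set E : ℝ → ℝ := fun t => Real.exp (-b * (√(t ^ 2 + k ^ 2) - k)) with hE
  set w : ℝ → ℝ := fun t => t / √(t ^ 2 + k ^ 2) with hw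
  have hsq : ContDiff ℝ ∞ fun t : ℝ => √(t ^ 2 + k ^ 2) :=
    ((contDiff_id.pow 2).add contDiff_const).sqrt hpos
  have hEs : ContDiff ℝ ∞ E := (contDiff_const.mul (hsq.sub contDiff_const)).exp
  have hws : ContDiff ℝ ∞ w := contDiff_id.div hsq fun t => (Real.sqrt_pos.2 (by positivity)).ne'
  have hEd : ∀ t, HasDerivAt E (-b * w t * E t) t := by
    intro t
    have h1 : HasDerivAt (fun t : ℝ => t ^ 2 + k ^ 2) (2 * t) t := by
      simpa using ((hasDerivAt_id t).fun_pow 2).add_const (k ^ 2)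
    have h2 := (((h1.sqrt (hpos t)).sub_const k).const_mul (-b)).exp
    convert h2 using 1
    simp only [hE, hw]
    field_simp
  have hE0 : ∀ t, 0 < E t := fun t => Real.exp_pos _
  have hE1 : ∀ t, E t ≤ 1 := by
    intro t
    rw [hE]
    simp only
    rw [Real.exp_le_one_iff]
    have : k ≤ √(t ^ 2 + k ^ 2) := Real.le_sqrt_of_sq_le (by nlinarith)
    nlinarith
  have hw1 : ∀ t, |w t| ≤ 1 := by
    intro t
    have hs0 : 0 < √(t ^ 2 + k ^ 2) := Real.sqrt_pos.2 (by positivity)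
    rw [hw]
    simp only
    rw [abs_div, abs_of_pos hs0, div_le_one hs0]
    exact Real.abs_le_sqrt (by nlinarith)
  set P : ℝ → ℝ := fun t => E t * z t with hP
  set S : ℝ → ℝ := fun t => E t * deriv z t with hS
  have hPs : ContDiff ℝ ∞ P := hEs.mul hz
  have hSs : ContDiff ℝ ∞ S := hEs.mul hz'
  have hPd : ∀ t, deriv P t = -b * w t * P t + S t := by
    intro t
    have := ((hEd t).mul (hz.differentiable (by simp) t).hasDerivAt).deriv
    change deriv (fun t => E t * z t) t = _
    change deriv (fun t => E t * z t) t = _ at this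
    rw [this]; simp only [hP, hS]; ring
  have hSd : ∀ t, deriv S t = -b * w t * S t + E t * deriv (deriv z) t := by
    intro t
    have := ((hEd t).mul (hz'.differentiable (by simp) t).hasDerivAt).deriv
    change deriv (fun t => E t * deriv z t) t = _
    change deriv (fun t => E t * deriv z t) t = _ at this
    rw [this]; simp only [hS]; ring
  have hP1 : ∀ t, |P t| ≤ 1 := fun t => by
    rw [hP]; simp only; rw [abs_mul, abs_of_pos (hE0 t)]
    exact mul_le_one₀ (hE1 t) (abs_nonneg _) (hz1 t)
  have hS1 : ∀ t, |S t| ≤ C / N := fun t => by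
    rw [hS]; simp only; rw [abs_mul, abs_of_pos (hE0 t)]
    exact (mul_le_of_le_one_left (abs_nonneg _) (hE1 t)).trans (hzC t).1
  have hS2 : ∀ t, |E t * deriv (deriv z) t| ≤ C / N := fun t => by
    rw [abs_mul, abs_of_pos (hE0 t)]
    exact (mul_le_of_le_one_left (abs_nonneg _) (hE1 t)).trans (hzC t).2
  have hP0 : ∀ t, 2 * N < |t| → P t = 0 := fun t ht => by simp [hP, (hz0 t ht).1]
  have hS0 : ∀ t, 2 * N < |t| → S t = 0 := fun t ht => by simp [hS, (hz0 t ht).2.1]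
  have hT0 : ∀ t, 2 * N < |t| → E t * deriv (deriv z) t = 0 := fun t ht => by
    simp [(hz0 t ht).2.2]
  set d : ℝ → ℝ := fun t => 1 - sgn t * w t with hd
  have hdm : Measurable d := measurable_const.sub (measurable_sgn.mul hws.continuous.measurable)
  -- `Q` is `deriv P` with the smoothed sign `w` replaced by the true sign. It jumps at the origin
  -- and so yields the point interaction exactly, while `P` stays smooth; `r` collects the smoothing
  -- error and the cut-off error.
  set Q : ℝ → ℝ := fun t => -b * sgn t * P t + S t with hQ
  set r₀ : ℝ → ℝ := fun t => b * sgn t * S t + b * w t * S t - E t * deriv (deriv z) t with hr₀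
  set r : ℝ → ℝ := fun t => b ^ 2 * (d t * P t) + r₀ t with hr
  have hQm : Measurable Q := ((measurable_const.mul measurable_sgn).mul
    hPs.continuous.measurable).add hSs.continuous.measurable
  have hr₀m : Measurable r₀ := (((measurable_const.mul measurable_sgn).mul
    hSs.continuous.measurable).add ((continuous_const.mul hws.continuous).mul
      hSs.continuous).measurable).sub (hEs.continuous.mul hz''.continuous).measurable
  have hrm : Measurable r :=
    (measurable_const.mul (hdm.mul hPs.continuous.measurable)).add hr₀m
  have hr₀b : ∀ t, |r₀ t| ≤ (2 * b + 1) * (C / N) := by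
    intro t
    have h1 : |b * sgn t * S t| ≤ b * (C / N) := by
      rw [abs_mul, abs_mul, abs_of_pos hb, abs_sgn, mul_one]
      exact mul_le_mul_of_nonneg_left (hS1 t) hb.le
    have h2 : |b * w t * S t| ≤ b * (C / N) := by
      rw [abs_mul, abs_mul, abs_of_pos hb]
      exact mul_le_mul (mul_le_of_le_one_right hb.le (hw1 t)) (hS1 t) (abs_nonneg _) hb.le
    have h3 := hS2 t
    have h4 := abs_sub (b * sgn t * S t + b * w t * S t) (E t * deriv (deriv z) t)
    have h5 := abs_add_le (b * sgn t * S t) (b * w t * S t)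
    simp only [hr₀]
    linarith
  have hd2 : ∀ t, |d t| ≤ 2 := by
    intro t
    have h1 := abs_sub 1 (sgn t * w t)
    rw [abs_mul, abs_sgn, one_mul, abs_one] at h1
    simp only [hd]; linarith [hw1 t]
  have hCN : 0 ≤ C / N := by positivity
  have hi1 := (integral_lorentz hk).1
  have hdP : ∀ t, (d t * P t) ^ 2 ≤ (1 + (t / k) ^ 2)⁻¹ := by
    intro t
    have h1 := sq_one_sub_sgn_le hk t
    have h2 : P t ^ 2 ≤ 1 := by rw [← sq_abs]; exact pow_le_one₀ (abs_nonneg _) (hP1 t)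
    rw [mul_pow]
    exact (mul_le_of_le_one_right (sq_nonneg _) h2).trans h1
  have hdPi : Integrable fun t => (d t * P t) ^ 2 := by
    refine hi1.mono' ((hdm.mul hPs.continuous.measurable).pow_const 2).aestronglyMeasurable
      (Eventually.of_forall fun t => ?_)
    rw [Real.norm_of_nonneg (sq_nonneg _)]
    exact hdP t
  have hdPle : ∫ t, (d t * P t) ^ 2 ≤ k * Real.pi := by
    rw [← (integral_lorentz hk).2]
    exact integral_mono hdPi hi1 hdP
  have hQb : ∀ t, |Q t| ≤ b + C / N := by
    intro t
    have h1 := abs_add_le (-b * sgn t * P t) (S t)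
    rw [abs_mul, abs_mul, abs_neg, abs_of_pos hb, abs_sgn, mul_one] at h1
    have h2 : b * |P t| ≤ b := mul_le_of_le_one_right hb.le (hP1 t)
    simp only [hQ]
    linarith [hS1 t]
  have hrb : ∀ t, |r t| ≤ 2 * b ^ 2 + (2 * b + 1) * (C / N) := by
    intro t
    have h1 := abs_add_le (b ^ 2 * (d t * P t)) (r₀ t)
    rw [abs_mul, abs_mul, abs_of_pos (by positivity : 0 < b ^ 2)] at h1
    have h2 : |d t| * |P t| ≤ 2 :=
      (mul_le_of_le_one_right (abs_nonneg _) (hP1 t)).trans (hd2 t)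
    have h3 : b ^ 2 * (|d t| * |P t|) ≤ b ^ 2 * 2 := mul_le_mul_of_nonneg_left h2 (sq_nonneg b)
    simp only [hr]
    linarith [hr₀b t]
  have hQ0 : ∀ t, 2 * N < |t| → Q t = 0 := fun t ht => by simp [hQ, hP0 t ht, hS0 t ht]
  have hr0 : ∀ t, 2 * N < |t| → r t = 0 := fun t ht => by
    simp [hr, hr₀, hP0 t ht, hS0 t ht, hT0 t ht]
  have hkN : 0 ≤ 1 / N := by positivity
  refine ⟨P, Q, r, hPs, hQm, hrm, fun t ht => ⟨hP0 t ht, hQ0 t ht, hr0 t ht⟩,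
    ⟨max (b + C / N) (2 * b ^ 2 + (2 * b + 1) * (C / N)), fun t => ⟨?_, ?_⟩⟩, ?_, ?_, ?_, ?_⟩
  · exact (hQb t).trans (le_max_left _ _)
  · exact (hrb t).trans (le_max_right _ _)
  · have hPi : Integrable fun t => P t ^ 2 :=
      integrable_of_bounded_support (M := 1) (R := 2 * N)
        (hPs.continuous.pow 2).aestronglyMeasurable
        (fun t => by
          rw [norm_pow, Real.norm_eq_abs]; exact pow_le_one₀ (abs_nonneg _) (hP1 t))
        (fun t ht => by rw [hP0 t ht]; norm_num)
    have h1 : ∫ t in Icc (0 : ℝ) 1, P t ^ 2 ≤ ∫ t, P t ^ 2 :=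
      setIntegral_le_integral hPi (Eventually.of_forall fun t => sq_nonneg _)
    refine le_trans ?_ h1
    -- On `[0, 1]` the cut-off is 1 and `√(t² + k²) - k ≤ t`, so the lower bound is uniform in `k`
    -- and `N`.
    have h2 : ∫ t in Icc (0 : ℝ) 1, Real.exp (-2 * b) ≤ ∫ t in Icc (0 : ℝ) 1, P t ^ 2 := by
      refine setIntegral_mono_on (integrableOn_const (by simp)) hPi.integrableOn
        measurableSet_Icc fun t ht => ?_
      have hz : z t = 1 := hzN t (by rw [abs_of_nonneg ht.1]; linarith [ht.2])
      have hs : √(t ^ 2 + k ^ 2) ≤ t + k := by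
        rw [Real.sqrt_le_iff]
        exact ⟨by linarith [ht.1], by nlinarith [ht.1, mul_nonneg ht.1 hk.le]⟩
      have : P t ^ 2 = Real.exp (2 * (-b * (√(t ^ 2 + k ^ 2) - k))) := by
        simp only [hP, hE, hz, mul_one]
        rw [← Real.exp_nat_mul]; norm_num
      rw [this, Real.exp_le_exp]
      nlinarith [ht.2]
    rw [setIntegral_const, Real.volume_real_Icc_of_le zero_le_one] at h2
    simpa using h2
  -- Since `sgn² = 1`, the square of `sgn - w` is that of `d = 1 - sgn * w`.
  · have h1 : ∀ t, (deriv P t - Q t) ^ 2 = b ^ 2 * (d t * P t) ^ 2 := by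
      intro t
      rw [hPd]
      simp only [hQ, hd]
      linear_combination (b ^ 2 * P t ^ 2) * (1 - w t ^ 2) * sgn_sq t
    simp_rw [h1]
    rw [integral_const_mul]
    have h2 : b ^ 2 * ∫ t, (d t * P t) ^ 2 ≤ b ^ 2 * (k * Real.pi) :=
      mul_le_mul_of_nonneg_left hdPle (sq_nonneg b)
    have h3 : 0 ≤ b ^ 2 * Real.pi * (1 / N) := by positivity
    have h4 : 0 ≤ (3 * b ^ 4 * Real.pi + 16 * (4 * b ^ 2 * C ^ 2 + C ^ 2)) * (k + 1 / N) := by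
      positivity
    nlinarith
  · have hr₀i : Integrable fun t => r₀ t ^ 2 :=
      integrable_of_bounded_support (M := ((2 * b + 1) * (C / N)) ^ 2) (R := 2 * N)
        (hr₀m.pow_const 2).aestronglyMeasurable
        (fun t => by rw [norm_pow, Real.norm_eq_abs]; gcongr; exact hr₀b t)
        (fun t ht => by simp [hr₀, hS0 t ht, hT0 t ht])
    -- The cut-off error has size of order `1 / N` on an interval of length `4 N`, so its squared
    -- norm is of order `1 / N`.
    have h0 : ∫ t, r₀ t ^ 2 ≤ 2 * (2 * N) * ((2 * b + 1) * (C / N)) ^ 2 :=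
      integral_le_of_bounded_support (by positivity) (hr₀m.pow_const 2).aestronglyMeasurable
        (fun t => sq_nonneg _)
        (fun t => by rw [← sq_abs]; gcongr; exact hr₀b t)
        (fun t ht => by simp [hr₀, hS0 t ht, hT0 t ht])
    have h1 : ∫ t, r t ^ 2 ≤ ∫ t, (2 * b ^ 4 * (d t * P t) ^ 2 + 2 * r₀ t ^ 2) := by
      refine integral_mono_of_nonneg (Eventually.of_forall fun t => sq_nonneg _)
        ((hdPi.const_mul _).fun_add (hr₀i.const_mul _)) (Eventually.of_forall fun t => ?_)
      simp only [hr]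
      nlinarith [sq_nonneg (b ^ 2 * (d t * P t) - r₀ t)]
    rw [integral_add (hdPi.const_mul _) (hr₀i.const_mul _), integral_const_mul,
      integral_const_mul] at h1
    have h2 : 2 * (2 * (2 * N) * ((2 * b + 1) * (C / N)) ^ 2) =
        8 * (2 * b + 1) ^ 2 * C ^ 2 * (1 / N) := by
      field_simp; ring
    have h3 : b ^ 4 * ∫ t, (d t * P t) ^ 2 ≤ b ^ 4 * (k * Real.pi) :=
      mul_le_mul_of_nonneg_left hdPle (by positivity)
    have h4 : 8 * (2 * b + 1) ^ 2 * C ^ 2 * (1 / N) ≤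
        16 * (4 * b ^ 2 * C ^ 2 + C ^ 2) * (1 / N) := by
      refine mul_le_mul_of_nonneg_right ?_ hkN
      nlinarith [sq_nonneg (2 * b * C - C)]
    have h5 : 0 ≤ (b ^ 2 * Real.pi + b ^ 4 * Real.pi) * k := by positivity
    have h6 : 0 ≤ (b ^ 2 * Real.pi + 3 * b ^ 4 * Real.pi) * (1 / N) := by positivity
    have h7 : 0 ≤ 16 * (4 * b ^ 2 * C ^ 2 + C ^ 2) * k := by positivity
    linarith
  · intro h hh
    have hh' : Continuous (deriv h) := hh.continuous_deriv le_rfl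
    have hi : ∀ {u : ℝ → ℂ} {f : ℝ → ℝ} {M : ℝ}, Continuous u → Measurable f →
        (∀ t, |f t| ≤ M) → (∀ t, 2 * N < |t| → f t = 0) → Integrable fun t => u t * (f t : ℂ) :=
      fun hu hf hM h0 => integrable_mul_of_bounded_support hu
        (integrable_of_bounded_support hf.aestronglyMeasurable hM h0).ofReal fun t ht => by
          rw [h0 t ht, Complex.ofReal_zero]
    have i1 := hi hh' hQm hQb hQ0
    have i2 := (hi hh.continuous hPs.continuous.measurable hP1 hP0).const_mul ((b : ℂ) ^ 2)
    have i3 := hi hh.continuous hrm hrb hr0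
    have hof : ∀ {f : ℝ → ℝ}, ContDiff ℝ ∞ f → ContDiff ℝ 1 fun t => (f t : ℂ) := fun hf =>
      Complex.ofRealCLM.contDiff.comp (hf.of_le (by simp))
    have hcs : ∀ {f : ℝ → ℝ}, (∀ t, 2 * N < |t| → f t = 0) →
        HasCompactSupport fun t => h t * (f t : ℂ) := fun h0 =>
      hasCompactSupport_of_abs_lt (R := 2 * N) fun t ht => by simp [h0 t ht]
    have hdm : ∀ {f : ℝ → ℝ}, ContDiff ℝ ∞ f → ∀ t, deriv (fun t => h t * (f t : ℂ)) t =
        deriv h t * f t + h t * ((deriv f t : ℝ) : ℂ) := by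
      intro f hf t
      have h1 : HasDerivAt (fun t => (f t : ℂ)) ((deriv f t : ℝ) : ℂ) t :=
        (hf.differentiable (by simp) t).hasDerivAt.ofReal_comp
      exact ((hh.differentiable (by simp) t).hasDerivAt.mul h1).deriv
    have j1 := integral_sgn_mul_deriv (hh.mul (hof hPs)) (hcs hP0)
    have j2 : ∫ t, deriv (fun t => h t * (S t : ℂ)) t = 0 :=
      integral_eq_zero_of_hasDerivAt_of_integrable
        (fun t => ((hh.mul (hof hSs)).differentiable (by simp) t).hasDerivAt)
        (((hh.mul (hof hSs)).continuous_deriv le_rfl).integrable_of_hasCompactSupport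
          (hcs hS0).deriv)
        ((hh.mul (hof hSs)).continuous.integrable_of_hasCompactSupport (hcs hS0))
    have i4 : Integrable fun t => (sgn t : ℂ) * deriv (fun t => h t * (P t : ℂ)) t := by
      have : Integrable (deriv fun t => h t * (P t : ℂ)) :=
        ((hh.mul (hof hPs)).continuous_deriv le_rfl).integrable_of_hasCompactSupport
          (hcs hP0).deriv
      refine this.norm.mono' ((Complex.measurable_ofReal.comp
        measurable_sgn).aestronglyMeasurable.mul this.1) (Eventually.of_forall fun t => ?_)
      rw [norm_mul, Complex.norm_real, Real.norm_eq_abs, abs_sgn, one_mul]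
    have i5 : Integrable fun t => deriv (fun t => h t * (S t : ℂ)) t :=
      ((hh.mul (hof hSs)).continuous_deriv le_rfl).integrable_of_hasCompactSupport (hcs hS0).deriv
    have hpt : ∀ t, deriv h t * Q t + (b : ℂ) ^ 2 * (h t * P t) - h t * r t =
        (-b : ℂ) * ((sgn t : ℂ) * deriv (fun t => h t * (P t : ℂ)) t) +
          deriv (fun t => h t * (S t : ℂ)) t := by
      intro t
      rw [hdm hPs, hdm hSs, hPd, hSd]
      simp only [hQ, hr, hr₀, hd]
      push_cast
      ring
    have e1 := integral_congr_ae (μ := volume) (Eventually.of_forall hpt)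
    rw [integral_sub (i1.fun_add i2) i3, integral_add i1 i2, integral_add (i4.const_mul _) i5,
      integral_const_mul, integral_const_mul, j1, j2] at e1
    linear_combination e1

/-- Smooth compactly supported weak quasi-modes of `-d²/dt² - 2bδ₀` at the energy `-b²`. -/
theorem exists_transversal {b : ℝ} (hb : 0 < b) {ε : ℝ} (hε : 0 < ε) :
    ∃ (P Q r : ℝ → ℂ) (R M : ℝ), 0 < R ∧ ContDiff ℝ ∞ P ∧ Measurable Q ∧ Measurable r ∧
      (∀ t, R < |t| → P t = 0 ∧ Q t = 0 ∧ r t = 0) ∧ (∀ t, ‖Q t‖ ≤ M ∧ ‖r t‖ ≤ M) ∧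
      0 < ∫ t, ‖P t‖ ^ 2 ∧
      (∫ t, ‖deriv P t - Q t‖ ^ 2 ≤ ε * ∫ t, ‖P t‖ ^ 2) ∧
      (∫ t, ‖r t‖ ^ 2 ≤ ε * ∫ t, ‖P t‖ ^ 2) ∧
      ∀ h : ℝ → ℂ, ContDiff ℝ 1 h → ∫ t, deriv h t * Q t =
        2 * b * (h 0 * P 0) - b ^ 2 * (∫ t, h t * P t) + ∫ t, h t * r t := by
  obtain ⟨C, hC0, hC⟩ := exists_transversal_bounds hb
  -- Both scales are tied to one parameter, `k = δ` and `N = 1 / δ`. Then `k + 1 / N = 2δ`, and the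
  -- second entry makes `2Cδ` at most `ε` times the lower bound for the squared norm of `P`.
  set δ : ℝ := min 1 (ε * Real.exp (-2 * b) / (2 * C)) with hδ
  have hδ0 : 0 < δ := by positivity
  obtain ⟨P, Q, r, hP, hQ, hr, h0, ⟨M, hM⟩, h1, h2, h3, h4⟩ := hC δ hδ0 (1 / δ)
    (by rw [one_le_div hδ0]; exact min_le_left _ _)
  have hsmall : C * (δ + 1 / (1 / δ)) ≤ ε * ∫ t, P t ^ 2 := by
    have h5 : δ ≤ ε * Real.exp (-2 * b) / (2 * C) := min_le_right _ _
    rw [le_div_iff₀ (by positivity)] at h5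
    rw [one_div_one_div]
    have := mul_le_mul_of_nonneg_left h1 hε.le
    linarith
  have hn : ∀ x : ℝ, ‖(x : ℂ)‖ ^ 2 = x ^ 2 := fun x => by
    rw [Complex.norm_real, Real.norm_eq_abs, sq_abs]
  have hd : ∀ t, deriv (fun t => (P t : ℂ)) t = ((deriv P t : ℝ) : ℂ) := fun t =>
    ((hP.differentiable (by simp) t).hasDerivAt.ofReal_comp).deriv
  refine ⟨fun t => P t, fun t => Q t, fun t => r t, 2 * (1 / δ), M, by positivity,
    Complex.ofRealCLM.contDiff.comp hP, Complex.measurable_ofReal.comp hQ,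
    Complex.measurable_ofReal.comp hr, fun t ht => ?_, fun t => ?_, ?_, ?_, ?_, h4⟩
  · simp [h0 t ht]
  · simpa using hM t
  · simp_rw [hn]
    exact (Real.exp_pos _).trans_le h1
  · simp_rw [hd, ← Complex.ofReal_sub, hn]
    exact h2.trans hsmall
  · simp_rw [hn]
    exact h3.trans hsmall

end Transversal

/-! ### Longitudinal quasi-modes: cut-off plane waves -/

section Longitudinal

/-- Smooth compactly supported quasi-modes of `-d²/dt²` at the energy `κ²`. -/
theorem exists_longitudinal (κ : ℝ) {ε : ℝ} (hε : 0 < ε) : ∃ R : ℝ, 0 < R ∧ ∀ x₀ : ℝ,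
    ∃ F : ℝ → ℂ, ContDiff ℝ ∞ F ∧ (∀ t, R < |t - x₀| → F t = 0) ∧ 0 < ∫ t, ‖F t‖ ^ 2 ∧
      ∫ t, ‖deriv (deriv F) t + κ ^ 2 * F t‖ ^ 2 ≤ ε * ∫ t, ‖F t‖ ^ 2 := by
  obtain ⟨C, hC0, hC⟩ := exists_cutoff_line
  set D : ℝ := (2 * |κ| + 1) * C with hD
  have hD0 : 0 ≤ D := by positivity
  -- The error comes from derivatives of the cut-off: at most `D / N` on an interval of length `4
  -- N`, hence `4 D² / N` in squared norm, against a squared norm of at least `N`.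
  obtain ⟨N, hN1, hN2⟩ : ∃ N : ℝ, 1 ≤ N ∧ 4 * D ^ 2 ≤ ε * N := by
    refine ⟨max 1 (4 * D ^ 2 / ε), le_max_left _ _, ?_⟩
    have := le_max_right 1 (4 * D ^ 2 / ε)
    rw [div_le_iff₀ hε] at this
    linarith
  have hN0 : 0 < N := by linarith
  obtain ⟨z, hz, hz1, hzN, hz0, hzC⟩ := hC N hN1
  have hz' : ContDiff ℝ ∞ (deriv z) := (contDiff_infty_iff_deriv.1 hz).2
  have hz'' : ContDiff ℝ ∞ (deriv (deriv z)) := (contDiff_infty_iff_deriv.1 hz').2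
  set e : ℝ → ℂ := fun t => Complex.exp ((κ * t : ℝ) * Complex.I) with he
  have hes : ContDiff ℝ ∞ e :=
    ((Complex.ofRealCLM.contDiff.comp (contDiff_const.mul contDiff_id)).mul contDiff_const).cexp
  have hed : ∀ t, HasDerivAt e (κ * Complex.I * e t) t := by
    intro t
    have h1 : HasDerivAt (fun t : ℝ => κ * t) κ t := by
      simpa using (hasDerivAt_id t).const_mul κ
    have h2 := (h1.ofReal_comp.mul_const Complex.I).cexp
    convert h2 using 1
    simp only [he]; ring
  have hen : ∀ t, ‖e t‖ = 1 := fun t => Complex.norm_exp_ofReal_mul_I _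
  have hof : ∀ {f : ℝ → ℝ}, ContDiff ℝ ∞ f → ∀ t,
      HasDerivAt (fun t => (f t : ℂ)) ((deriv f t : ℝ) : ℂ) t := fun hf t =>
    (hf.differentiable (by simp) t).hasDerivAt.ofReal_comp
  set G : ℝ → ℂ := fun t => e t * z t with hG
  have hGs : ContDiff ℝ ∞ G := hes.mul (Complex.ofRealCLM.contDiff.comp hz)
  have hd1 : deriv G = fun t => κ * Complex.I * (e t * z t) + e t * (deriv z t : ℝ) := by
    funext t
    have := ((hed t).mul (hof hz t)).deriv
    change deriv (fun t => e t * (z t : ℂ)) t = _ at this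
    rw [hG, this]; ring
  have hd2 : ∀ t, deriv (deriv G) t + κ ^ 2 * G t =
      e t * (2 * κ * Complex.I * (deriv z t : ℝ) + (deriv (deriv z) t : ℝ)) := by
    intro t
    have := ((((hed t).mul (hof hz t)).const_mul (κ * Complex.I)).add
      ((hed t).mul (hof hz' t))).deriv
    change deriv (fun t => κ * Complex.I * (e t * z t) + e t * (deriv z t : ℝ)) t = _ at this
    rw [hd1, this, hG]
    linear_combination (κ ^ 2 * e t * z t) * Complex.I_sq
  have hb : ∀ t, ‖deriv (deriv G) t + κ ^ 2 * G t‖ ≤ D / N := by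
    intro t
    rw [hd2, norm_mul, hen, one_mul]
    refine (norm_add_le _ _).trans ?_
    rw [norm_mul, norm_mul, norm_mul, Complex.norm_I, Complex.norm_real, Complex.norm_real,
      Complex.norm_real, RCLike.norm_two, mul_one]
    simp only [Real.norm_eq_abs]
    have h1 := mul_le_mul_of_nonneg_left (hzC t).1 (by positivity : 0 ≤ 2 * |κ|)
    have h2 : D / N = 2 * |κ| * (C / N) + C / N := by rw [hD]; ring
    rw [h2]
    exact add_le_add h1 (hzC t).2
  have hcd : Continuous fun t => deriv (deriv G) t + κ ^ 2 * G t := by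
    have := (contDiff_infty_iff_deriv.1 (contDiff_infty_iff_deriv.1 hGs).2).2.continuous
    exact this.add (continuous_const.mul hGs.continuous)
  have hup : ∫ t, ‖deriv (deriv G) t + κ ^ 2 * G t‖ ^ 2 ≤ 2 * (2 * N) * (D / N) ^ 2 := by
    refine integral_le_of_bounded_support (by positivity)
      (hcd.norm.pow 2).aestronglyMeasurable (fun t => sq_nonneg _) (fun t => ?_) (fun t ht => ?_)
    · gcongr; exact hb t
    · rw [hd2]; simp [hz0 t ht]
  have hGi : Integrable fun t => ‖G t‖ ^ 2 :=
    integrable_of_bounded_support (M := 1) (R := 2 * N)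
      (hGs.continuous.norm.pow 2).aestronglyMeasurable
      (fun t => by
        rw [norm_pow, norm_norm, hG]
        simp only
        rw [norm_mul, hen, one_mul, Complex.norm_real]
        exact pow_le_one₀ (norm_nonneg _) (hz1 t))
      (fun t ht => by simp [hG, hz0 t ht])
  have hlow : N ≤ ∫ t, ‖G t‖ ^ 2 := by
    refine le_trans ?_ (setIntegral_le_integral (s := Icc 0 N) hGi
      (Eventually.of_forall fun t => sq_nonneg _))
    have h2 : ∫ _ in Icc (0 : ℝ) N, (1 : ℝ) ≤ ∫ t in Icc (0 : ℝ) N, ‖G t‖ ^ 2 := by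
      refine setIntegral_mono_on (integrableOn_const (by simp)) hGi.integrableOn
        measurableSet_Icc fun t ht => ?_
      rw [hG]
      simp only
      rw [norm_mul, hen, one_mul, hzN t (by rw [abs_of_nonneg ht.1]; exact ht.2)]
      simp
    rw [setIntegral_const, Real.volume_real_Icc_of_le hN0.le] at h2
    simpa using h2
  have hfin : ∫ t, ‖deriv (deriv G) t + κ ^ 2 * G t‖ ^ 2 ≤ ε * ∫ t, ‖G t‖ ^ 2 := by
    refine hup.trans ?_
    have h1 : 2 * (2 * N) * (D / N) ^ 2 = 4 * D ^ 2 / N := by field_simp; ring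
    rw [h1, div_le_iff₀ hN0]
    have h2 := mul_le_mul_of_nonneg_left hlow hε.le
    have h3 : 0 < ε * ∫ t, ‖G t‖ ^ 2 := by have := hN0.trans_le hlow; positivity
    nlinarith
  -- Translation does not change the estimates. The radius is fixed before the centre, so that the
  -- centre can later be chosen in terms of it.
  refine ⟨2 * N, by positivity, fun x₀ => ⟨fun t => G (t - x₀),
    hGs.comp (contDiff_id.sub contDiff_const), fun t ht => ?_, ?_, ?_⟩⟩
  · simp [hG, hz0 _ ht]
  · rw [integral_sub_right_eq_self (fun t => ‖G t‖ ^ 2)]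
    exact hN0.trans_le hlow
  · have h1 : deriv (fun t => G (t - x₀)) = fun t => deriv G (t - x₀) :=
      funext fun t => deriv_comp_sub_const _ _ _
    have h2 : ∀ t, deriv (fun t => deriv G (t - x₀)) t = deriv (deriv G) (t - x₀) :=
      fun t => deriv_comp_sub_const _ _ _
    simp_rw [h1, h2]
    rw [integral_sub_right_eq_self (fun t => ‖G t‖ ^ 2),
      integral_sub_right_eq_self (fun t => ‖deriv (deriv G) t + κ ^ 2 * G t‖ ^ 2)]
    exact hfin

end Longitudinal

/-! ### Product functions in the rotated coordinates -/

section Tensor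

/-- The product of a function of the position along the diagonal and a function of the position
transversal to it. -/
def tens (u w : ℝ → ℂ) (p : Plane) : ℂ := u ((p.1 + p.2) / 2) * w ((p.1 - p.2) / 2)

variable {u w : ℝ → ℂ}

theorem tens_diag (x t : ℝ) : tens u w (diag (x, t)) = u x * w t := by
  rw [tens, diag_apply]
  simp only
  rw [show (x + t + (x - t)) / 2 = x by ring, show (x + t - (x - t)) / 2 = t by ring]

theorem integrable_of_comp_diag {E : Type*} [NormedAddCommGroup E] {f : Plane → E}
    (hf : Integrable fun p => f (diag p)) : Integrable f := by
  have h : Integrable f ((volume : Measure Plane).map diag) :=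
    (measurableEmbedding_diag.integrable_map_iff).2 hf
  rw [map_diag_volume] at h
  exact (integrable_smul_measure (by simp) (by simp)).1 h

theorem measurable_tens (hu : Measurable u) (hw : Measurable w) : Measurable (tens u w) := by
  unfold tens
  fun_prop

theorem memLp_tens (hu : MemLp u 2 volume) (hw : MemLp w 2 volume) (hum : Measurable u)
    (hwm : Measurable w) : MemLp (tens u w) 2 volume := by
  rw [memLp_two_iff_integrable_sq_norm (measurable_tens hum hwm).aestronglyMeasurable]
  apply integrable_of_comp_diag
  have h := (hu.integrable_norm_pow (p := 2) (by norm_num)).mul_prod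
    (hw.integrable_norm_pow (p := 2) (by norm_num))
  rw [← Measure.volume_eq_prod] at h
  refine h.congr (Eventually.of_forall fun p => ?_)
  obtain ⟨x, t⟩ := p
  simp only [tens_diag, norm_mul, mul_pow]

/-- The factor 2 is the Jacobian of `diag`. -/
theorem integral_norm_sq_tens :
    ∫ p, ‖tens u w p‖ ^ 2 = 2 * ((∫ x, ‖u x‖ ^ 2) * ∫ t, ‖w t‖ ^ 2) := by
  have h := integral_diag fun p => ‖tens u w p‖ ^ 2
  have h2 : ∫ p, ‖tens u w (diag p)‖ ^ 2 = (∫ x, ‖u x‖ ^ 2) * ∫ t, ‖w t‖ ^ 2 := by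
    rw [← integral_prod_mul, ← Measure.volume_eq_prod]
    refine integral_congr_ae (Eventually.of_forall fun p => ?_)
    obtain ⟨x, t⟩ := p
    simp only [tens_diag, norm_mul, mul_pow]
  rw [h2, smul_eq_mul] at h
  linarith

theorem integrable_mul_tens {η : Plane → ℂ} (hη : IsTest η) (h : MemLp (tens u w) 2 volume) :
    Integrable fun p => η p * tens u w p := (hη.memLp 2 volume).integrable_mul h

theorem integrable_mul_tens_diag {η : Plane → ℂ} (hη : IsTest η)
    (h : MemLp (tens u w) 2 volume) :
    Integrable (fun p : ℝ × ℝ => η (p.1 + p.2, p.1 - p.2) * (u p.1 * w p.2))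
      (volume.prod volume) := by
  have := integrable_comp_diag (integrable_mul_tens hη h)
  rw [Measure.volume_eq_prod] at this
  refine this.congr (Eventually.of_forall fun p => ?_)
  obtain ⟨x, t⟩ := p
  simp only [tens_diag]
  rw [diag_apply]

theorem integral_mul_tens_eq {η : Plane → ℂ} : ∫ p, η p * tens u w p =
    2 * ∫ p : ℝ × ℝ, η (p.1 + p.2, p.1 - p.2) * (u p.1 * w p.2) ∂(volume.prod volume) := by
  have h := integral_diag fun p => η p * tens u w p
  rw [← Measure.volume_eq_prod]
  have h2 : ∫ p, η (diag p) * tens u w (diag p) =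
      ∫ p : ℝ × ℝ, η (p.1 + p.2, p.1 - p.2) * (u p.1 * w p.2) := by
    refine integral_congr_ae (Eventually.of_forall fun p => ?_)
    obtain ⟨x, t⟩ := p
    simp only [tens_diag]
    rw [diag_apply]
  rw [← h2, h, Complex.real_smul]
  push_cast
  ring

theorem integral_mul_tens {η : Plane → ℂ} (hη : IsTest η) (h : MemLp (tens u w) 2 volume) :
    ∫ p, η p * tens u w p = 2 * ∫ x, u x * ∫ t, η (x + t, x - t) * w t := by
  rw [integral_mul_tens_eq, integral_prod _ (integrable_mul_tens_diag hη h)]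
  congr 1
  refine integral_congr_ae (Eventually.of_forall fun x => ?_)
  simp only
  rw [← integral_const_mul]
  refine integral_congr_ae (Eventually.of_forall fun t => ?_)
  simp only
  ring

theorem integrable_mul_integral {η : Plane → ℂ} (hη : IsTest η) (h : MemLp (tens u w) 2 volume) :
    Integrable fun x => u x * ∫ t, η (x + t, x - t) * w t := by
  refine (integrable_mul_tens_diag hη h).integral_prod_left.congr (Eventually.of_forall fun x => ?_)
  simp only
  rw [← integral_const_mul]
  refine integral_congr_ae (Eventually.of_forall fun t => ?_)
  simp only
  ring

theorem integral_mul_tens_symm {η : Plane → ℂ} (hη : IsTest η) (h : MemLp (tens u w) 2 volume) :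
    ∫ p, η p * tens u w p = 2 * ∫ t, w t * ∫ x, η (x + t, x - t) * u x := by
  rw [integral_mul_tens_eq, integral_prod_symm _ (integrable_mul_tens_diag hη h)]
  congr 1
  refine integral_congr_ae (Eventually.of_forall fun x => ?_)
  simp only
  rw [← integral_const_mul]
  refine integral_congr_ae (Eventually.of_forall fun t => ?_)
  simp only
  ring

theorem contDiff_tens (hu : ContDiff ℝ ∞ u) (hw : ContDiff ℝ ∞ w) : ContDiff ℝ ∞ (tens u w) :=
  (hu.comp ((contDiff_fst.add contDiff_snd).div_const 2)).mul
    (hw.comp ((contDiff_fst.sub contDiff_snd).div_const 2))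

theorem fderiv_tens (hu : ContDiff ℝ ∞ u) (hw : ContDiff ℝ ∞ w) (p e : Plane) :
    fderiv ℝ (tens u w) p e =
      (((e.1 + e.2) / 2 : ℝ) : ℂ) * tens (deriv u) w p +
        (((e.1 - e.2) / 2 : ℝ) : ℂ) * tens u (deriv w) p := by
  have hl : ∀ (f : ℝ → ℂ) (ℓ : Plane →L[ℝ] ℝ), ContDiff ℝ ∞ f →
      HasFDerivAt (fun p => f (ℓ p)) (ℓ.smulRight (deriv f (ℓ p))) p := fun f ℓ hf => by
    refine HasFDerivAt.congr_fderiv ((hf.differentiable (by simp)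
      (ℓ p)).hasDerivAt.hasFDerivAt.comp p ℓ.hasFDerivAt) ?_
    refine ContinuousLinearMap.ext fun q => ?_
    simp
  let ℓ₁ : Plane →L[ℝ] ℝ :=
    (1 / 2 : ℝ) • (ContinuousLinearMap.fst ℝ ℝ ℝ + ContinuousLinearMap.snd ℝ ℝ ℝ)
  let ℓ₂ : Plane →L[ℝ] ℝ :=
    (1 / 2 : ℝ) • (ContinuousLinearMap.fst ℝ ℝ ℝ - ContinuousLinearMap.snd ℝ ℝ ℝ)
  have h1 : ∀ q : Plane, ℓ₁ q = (q.1 + q.2) / 2 := fun q => by simp [ℓ₁]; ring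
  have h2 : ∀ q : Plane, ℓ₂ q = (q.1 - q.2) / 2 := fun q => by simp [ℓ₂]; ring
  have h := ((hl u ℓ₁ hu).mul (hl w ℓ₂ hw)).fderiv
  have he : tens u w = fun p => u (ℓ₁ p) * w (ℓ₂ p) := by
    funext q; rw [h1, h2, tens]
  rw [he]
  change fderiv ℝ (fun p => u (ℓ₁ p) * w (ℓ₂ p)) p = _ at h
  rw [h]
  simp only [add_apply, smul_apply, ContinuousLinearMap.smulRight_apply, h1, h2, smul_eq_mul,
    Complex.real_smul, tens]
  ring

theorem deriv_comp_diag {η : Plane → ℂ} (hη : IsTest η) (x t : ℝ) :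
    deriv (fun t => η (x + t, x - t)) t =
      fderiv ℝ η (x + t, x - t) (1, 0) - fderiv ℝ η (x + t, x - t) (0, 1) ∧
    deriv (fun x => η (x + t, x - t)) x =
      fderiv ℝ η (x + t, x - t) (1, 0) + fderiv ℝ η (x + t, x - t) (0, 1) := by
  have hd := (hη.differentiable (x + t, x - t)).hasFDerivAt
  constructor
  · have h1 : HasDerivAt (fun t : ℝ => (x + t, x - t)) ((1 : ℝ), (-1 : ℝ)) t :=
      ((hasDerivAt_id t).const_add x).prodMk ((hasDerivAt_id t).const_sub x)
    have h2 := (hd.comp_hasDerivAt t h1).deriv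
    change deriv (fun t => η (x + t, x - t)) t = _ at h2
    rw [h2, ← map_sub]; simp
  · have h1 : HasDerivAt (fun x : ℝ => (x + t, x - t)) ((1 : ℝ), (1 : ℝ)) x :=
      ((hasDerivAt_id x).add_const t).prodMk ((hasDerivAt_id x).sub_const t)
    have h2 := (hd.comp_hasDerivAt x h1).deriv
    change deriv (fun x => η (x + t, x - t)) x = _ at h2
    rw [h2, ← map_add]; simp

end Tensor

/-! ### Quasi-modes without magnetic field -/

section Quasimode

theorem memLp_of_bounded_support {f : ℝ → ℂ} {M R : ℝ} (hm : Measurable f)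
    (hM : ∀ t, ‖f t‖ ≤ M) (hR : ∀ t, R < |t| → f t = 0) : MemLp f 2 volume := by
  rw [memLp_two_iff_integrable_sq_norm hm.aestronglyMeasurable]
  refine integrable_of_bounded_support (M := M ^ 2) (R := R)
    (hm.norm.pow_const 2).aestronglyMeasurable (fun t => ?_) (fun t ht => by simp [hR t ht])
  rw [norm_pow, norm_norm]
  gcongr
  exact hM t

/-- Weak form of `-Δ` on tensor products of the two profiles. -/
theorem integral_fderiv_mul_tens {b κ : ℝ} {F P Q r : ℝ → ℂ} (hF : ContDiff ℝ ∞ F)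
    (hFc : HasCompactSupport F) (hP : ContDiff ℝ ∞ P) (hPc : HasCompactSupport P)
    (hQ : Measurable Q) (hQ2 : MemLp Q 2 volume) (hr : Measurable r) (hr2 : MemLp r 2 volume)
    (hid : ∀ h : ℝ → ℂ, ContDiff ℝ 1 h → ∫ t, deriv h t * Q t =
        2 * b * (h 0 * P 0) - b ^ 2 * (∫ t, h t * P t) + ∫ t, h t * r t)
    {η : Plane → ℂ} (hη : IsTest η) :
    ∫ p, (fderiv ℝ η p (1, 0) * ((1 / 2 : ℂ) * (tens (deriv F) P p + tens F Q p)) +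
        fderiv ℝ η p (0, 1) * ((1 / 2 : ℂ) * (tens (deriv F) P p - tens F Q p))) =
      2 * b * (∫ x, F x * (η (x, x) * P 0)) + (κ ^ 2 - b ^ 2) / 2 * (∫ p, η p * tens F P p) +
        ∫ p, η p * ((1 / 2 : ℂ) * (tens F r p -
          tens (fun x => deriv (deriv F) x + κ ^ 2 * F x) P p)) := by
  have hF' : ContDiff ℝ ∞ (deriv F) := (contDiff_infty_iff_deriv.1 hF).2
  have hF'' : ContDiff ℝ ∞ (deriv (deriv F)) := (contDiff_infty_iff_deriv.1 hF').2
  have hL : ∀ {f : ℝ → ℂ}, ContDiff ℝ ∞ f → HasCompactSupport f → MemLp f 2 volume :=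
    fun hf hc => hf.continuous.memLp_of_hasCompactSupport hc
  have hm : ∀ {f : ℝ → ℂ}, ContDiff ℝ ∞ f → Measurable f := fun hf => hf.continuous.measurable
  have mFP := memLp_tens (hL hF hFc) (hL hP hPc) (hm hF) (hm hP)
  have mF'P := memLp_tens (hL hF' hFc.deriv) (hL hP hPc) (hm hF') (hm hP)
  have mF''P := memLp_tens (hL hF'' hFc.deriv.deriv) (hL hP hPc) (hm hF'') (hm hP)
  have mFQ := memLp_tens (hL hF hFc) hQ2 (hm hF) hQ
  have mFr := memLp_tens (hL hF hFc) hr2 (hm hF) hr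
  have hη1 := hη.fderiv_apply (1, 0)
  have hη2 := hη.fderiv_apply (0, 1)
  have hηs := hη1.sub hη2
  have hηa := hη1.add hη2
  -- the transversal direction
  have e1 : ∫ p, (fderiv ℝ η p (1, 0) - fderiv ℝ η p (0, 1)) * tens F Q p =
      4 * b * (∫ x, F x * (η (x, x) * P 0)) - b ^ 2 * (∫ p, η p * tens F P p) +
        ∫ p, η p * tens F r p := by
    rw [integral_mul_tens hηs mFQ, integral_mul_tens hη mFP, integral_mul_tens hη mFr]
    have hx : ∀ x, F x * ∫ t, (fderiv ℝ η (x + t, x - t) (1, 0) -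
        fderiv ℝ η (x + t, x - t) (0, 1)) * Q t =
        2 * b * (F x * (η (x, x) * P 0)) - b ^ 2 * (F x * ∫ t, η (x + t, x - t) * P t) +
          F x * ∫ t, η (x + t, x - t) * r t := by
      intro x
      have h1 := hid (fun t => η (x + t, x - t)) ((hη.1.of_le (by simp)).comp
        ((contDiff_const.add contDiff_id).prodMk (contDiff_const.sub contDiff_id)))
      simp_rw [(deriv_comp_diag hη x _).1] at h1
      rw [h1]
      simp only [add_zero, sub_zero]
      ring
    simp_rw [hx]
    have i1 : Integrable fun x => F x * (η (x, x) * P 0) := by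
      refine Continuous.integrable_of_hasCompactSupport ?_ hFc.mul_right
      exact hF.continuous.mul ((hη.continuous.comp (continuous_id.prodMk continuous_id)).mul
        continuous_const)
    have i2 := integrable_mul_integral hη mFP
    have i3 := integrable_mul_integral hη mFr
    have i12 : Integrable fun x => 2 * b * (F x * (η (x, x) * P 0)) -
        b ^ 2 * (F x * ∫ t, η (x + t, x - t) * P t) := (i1.const_mul _).sub (i2.const_mul _)
    rw [integral_add i12 i3,
      integral_sub (i1.const_mul _) (i2.const_mul _), integral_const_mul, integral_const_mul]
    ring
  -- the longitudinal direction
  have e2 : ∫ p, (fderiv ℝ η p (1, 0) + fderiv ℝ η p (0, 1)) * tens (deriv F) P p =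
      -∫ p, η p * tens (deriv (deriv F)) P p := by
    rw [integral_mul_tens_symm hηa mF'P, integral_mul_tens_symm hη mF''P, ← mul_neg, ← integral_neg]
    congr 1
    refine integral_congr_ae (Eventually.of_forall fun t => ?_)
    simp only
    rw [← mul_neg, ← integral_deriv_mul_line (h := fun x => η (x + t, x - t))
      ((hη.1.of_le (by simp)).comp
        ((contDiff_id.add contDiff_const).prodMk (contDiff_id.sub contDiff_const)))
      (hF'.of_le (by simp)) hFc.deriv]
    simp_rw [(deriv_comp_diag hη _ t).2]
  have j1 := integrable_mul_tens hηs mFQ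
  have j2 := integrable_mul_tens hηa mF'P
  -- The difference and the sum of the partial derivatives of `η` are its derivatives in `t` and in
  -- `x`, so the pairing is half a transversal plus half a longitudinal one.
  have hl : ∫ p, (fderiv ℝ η p (1, 0) * ((1 / 2 : ℂ) * (tens (deriv F) P p + tens F Q p)) +
        fderiv ℝ η p (0, 1) * ((1 / 2 : ℂ) * (tens (deriv F) P p - tens F Q p))) =
      1 / 2 * (∫ p, (fderiv ℝ η p (1, 0) - fderiv ℝ η p (0, 1)) * tens F Q p) +
      1 / 2 * ∫ p, (fderiv ℝ η p (1, 0) + fderiv ℝ η p (0, 1)) * tens (deriv F) P p := by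
    rw [← integral_const_mul, ← integral_const_mul, ← integral_add (j1.const_mul _) (j2.const_mul _)]
    refine integral_congr_ae (Eventually.of_forall fun p => ?_)
    simp only
    ring
  have k1 := integrable_mul_tens hη mFr
  have k2 := integrable_mul_tens hη mF''P
  have k3 := integrable_mul_tens hη mFP
  have hR : ∫ p, η p * ((1 / 2 : ℂ) * (tens F r p -
          tens (fun x => deriv (deriv F) x + κ ^ 2 * F x) P p)) =
      1 / 2 * (∫ p, η p * tens F r p) - (1 / 2 * (∫ p, η p * tens (deriv (deriv F)) P p) +
        κ ^ 2 / 2 * ∫ p, η p * tens F P p) := by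
    rw [← integral_const_mul, ← integral_const_mul, ← integral_const_mul,
      ← integral_add (k2.const_mul _) (k3.const_mul _),
      ← integral_sub (k1.const_mul _) ((k2.const_mul _).fun_add (k3.const_mul _))]
    refine integral_congr_ae (Eventually.of_forall fun p => ?_)
    simp only [tens]
    ring
  rw [hl, hR, e1, e2]
  ring

variable {γ : ℝ → ℝ} {a : ℝ}

/-- Smooth compactly supported approximate solutions of `(-Δ - αδ)v = lv` far out on the
straight part of the curve. -/
theorem exists_quasimode (hγ : Continuous γ) (hout : ∀ x, a ≤ |x| → γ x = x)
    {α : ℝ} (hα : 0 < α) {l : ℝ} (hl : -(α ^ 2 / 4) ≤ l) {ε : ℝ} (hε : 0 < ε) :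
    ∃ (c : Plane) (ρ : ℝ) (v G₁ G₂ s : Plane → ℂ) (M : ℝ), 0 < ρ ∧
      (∀ p ∈ Metric.ball c (ρ + 2), a < p.1) ∧ IsTest v ∧
      MemLp G₁ 2 volume ∧ MemLp G₂ 2 volume ∧ MemLp s 2 volume ∧
      (∀ p ∉ Metric.closedBall c ρ, v p = 0 ∧ G₁ p = 0 ∧ G₂ p = 0 ∧ s p = 0) ∧
      (∀ p, ‖v p‖ ≤ M ∧ ‖G₁ p‖ ≤ M ∧ ‖G₂ p‖ ≤ M) ∧ 0 < ‖toL2 v‖ ∧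
      ‖toL2 (fun p => fderiv ℝ v p (1, 0) - G₁ p)‖ ≤ ε * ‖toL2 v‖ ∧
      ‖toL2 (fun p => fderiv ℝ v p (0, 1) - G₂ p)‖ ≤ ε * ‖toL2 v‖ ∧
      ‖toL2 s‖ ≤ ε * ‖toL2 v‖ ∧
      ∀ η, IsTest η → ∫ p, (fderiv ℝ η p (1, 0) * G₁ p + fderiv ℝ η p (0, 1) * G₂ p) =
        α * (∫ p, η p * v p ∂(arcLength γ)) + l * (∫ p, η p * v p) + ∫ p, η p * s p := by
  -- In the coordinates of `diag` the Laplacian is half the sum of the two second derivatives, the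
  -- Jacobian is 2 and arc length is `√2 dx`. Matching the delta term requires `2b = √2 α`, and the
  -- energy `l = (κ² - b²) / 2` then requires the `κ` below.
  set b : ℝ := α * √2 / 2 with hb
  have h2 : √2 ^ 2 = 2 := Real.sq_sqrt zero_le_two
  have hb0 : 0 < b := by positivity
  have hb2 : b ^ 2 = α ^ 2 / 2 := by rw [hb, div_pow, mul_pow, h2]; ring
  set κ : ℝ := √(2 * (l + α ^ 2 / 4)) with hκ
  have hκ2 : κ ^ 2 = 2 * (l + α ^ 2 / 4) := Real.sq_sqrt (by linarith)
  obtain ⟨P, Q, r, RP, M, hRP, hP, hQ, hr, h0, hM, hP1, hPQ, hr1, hid⟩ :=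
    exists_transversal hb0 (ε := ε ^ 2) (by positivity)
  obtain ⟨RF, hRF, hFex⟩ := exists_longitudinal κ (ε := ε ^ 2) (by positivity)
  set ρ : ℝ := RF + RP with hρ
  -- Far enough out for the ball of radius `ρ + 2` about `(x₀, x₀)` to lie in the half-plane to the
  -- right of `a`.
  set x₀ : ℝ := a + ρ + 3 with hx₀
  obtain ⟨F, hF, hF0, hF1, hFs⟩ := hFex x₀
  set S : ℝ → ℂ := fun x => deriv (deriv F) x + κ ^ 2 * F x with hS
  have hF' : ContDiff ℝ ∞ (deriv F) := (contDiff_infty_iff_deriv.1 hF).2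
  have hF'' : ContDiff ℝ ∞ (deriv (deriv F)) := (contDiff_infty_iff_deriv.1 hF').2
  have hP' : ContDiff ℝ ∞ (deriv P) := (contDiff_infty_iff_deriv.1 hP).2
  have hSs : ContDiff ℝ ∞ S := hF''.add (contDiff_const.mul hF)
  have hFt : ∀ x, RF < |x - x₀| → x ∉ tsupport F := by
    intro x hx
    rw [notMem_tsupport_iff_eventuallyEq]
    filter_upwards [(isOpen_lt continuous_const
      (continuous_id.sub continuous_const).abs).mem_nhds hx] with y hy
    exact hF0 y hy
  have hF'0 : ∀ x, RF < |x - x₀| → deriv F x = 0 := fun x hx =>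
    image_eq_zero_of_notMem_tsupport fun h => hFt x hx (tsupport_deriv_subset h)
  have hF''0 : ∀ x, RF < |x - x₀| → deriv (deriv F) x = 0 := fun x hx =>
    image_eq_zero_of_notMem_tsupport fun h =>
      hFt x hx (tsupport_deriv_subset (tsupport_deriv_subset h))
  have hS0 : ∀ x, RF < |x - x₀| → S x = 0 := fun x hx => by
    simp only [hS, hF''0 x hx, hF0 x hx, mul_zero, add_zero]
  have hcs : ∀ {f : ℝ → ℂ}, (∀ x, RF < |x - x₀| → f x = 0) → HasCompactSupport f := fun hf => by
    refine HasCompactSupport.intro (isCompact_closedBall x₀ RF) fun t ht => hf t ?_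
    rw [Metric.mem_closedBall, Real.dist_eq, not_le] at ht
    exact ht
  have hFc := hcs hF0
  have hPc : HasCompactSupport P := hasCompactSupport_of_abs_lt fun t ht => (h0 t ht).1
  have hQ2 : MemLp Q 2 volume :=
    memLp_of_bounded_support hQ (fun t => (hM t).1) fun t ht => (h0 t ht).2.1
  have hr2 : MemLp r 2 volume :=
    memLp_of_bounded_support hr (fun t => (hM t).2) fun t ht => (h0 t ht).2.2
  have hL : ∀ {f : ℝ → ℂ}, ContDiff ℝ ∞ f → HasCompactSupport f → MemLp f 2 volume :=
    fun hf hc => hf.continuous.memLp_of_hasCompactSupport hc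
  have hm : ∀ {f : ℝ → ℂ}, ContDiff ℝ ∞ f → Measurable f := fun hf => hf.continuous.measurable
  have mF := hL hF hFc
  have mP := hL hP hPc
  have mFP := memLp_tens mF mP (hm hF) (hm hP)
  have mF'P := memLp_tens (hL hF' hFc.deriv) mP (hm hF') (hm hP)
  have mFQ := memLp_tens mF hQ2 (hm hF) hQ
  have mFr := memLp_tens mF hr2 (hm hF) hr
  have mSP := memLp_tens (hL hSs (hcs hS0)) mP (hm hSs) (hm hP)
  have mFD := memLp_tens mF ((hL hP' hPc.deriv).sub hQ2) (hm hF) ((hm hP').sub hQ)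
  have hts : ∀ p ∉ Metric.closedBall ((x₀, x₀) : Plane) ρ, ∀ f g : ℝ → ℂ,
      (∀ x, RF < |x - x₀| → f x = 0) → (∀ t, RP < |t| → g t = 0) → tens f g p = 0 := by
    intro p hp f g hf hg
    by_contra hne
    have h1 : |(p.1 + p.2) / 2 - x₀| ≤ RF := by
      by_contra h; exact hne (by rw [tens, hf _ (not_le.1 h), zero_mul])
    have h2 : |(p.1 - p.2) / 2| ≤ RP := by
      by_contra h; exact hne (by rw [tens, hg _ (not_le.1 h), mul_zero])
    apply hp
    rw [abs_le] at h1 h2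
    rw [Metric.mem_closedBall, Prod.dist_eq, max_le_iff, Real.dist_eq, Real.dist_eq, abs_le, abs_le]
    simp only
    refine ⟨⟨?_, ?_⟩, ?_, ?_⟩ <;> linarith [h1.1, h1.2, h2.1, h2.2]
  obtain ⟨MF, hMF⟩ := hFc.exists_bound_of_continuous hF.continuous
  obtain ⟨MF', hMF'⟩ := hFc.deriv.exists_bound_of_continuous hF'.continuous
  obtain ⟨MP, hMP⟩ := hPc.exists_bound_of_continuous hP.continuous
  have hbt : ∀ {f g : ℝ → ℂ} {m m' : ℝ}, (∀ x, ‖f x‖ ≤ m) → (∀ x, ‖g x‖ ≤ m') →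
      ∀ p, ‖tens f g p‖ ≤ m * m' := by
    intro f g m m' hf hg p
    rw [tens, norm_mul]
    exact mul_le_mul (hf _) (hg _) (norm_nonneg _) ((norm_nonneg _).trans (hf 0))
  have hb1 := hbt hMF hMP
  have hb2' := hbt hMF' hMP
  have hb3 := hbt hMF fun t => (hM t).1
  have hhalf : ∀ z : ℂ, ‖(1 / 2 : ℂ) * z‖ = 1 / 2 * ‖z‖ := fun z => by
    rw [norm_mul]; norm_num
  have hvn : ‖toL2 (tens F P)‖ ^ 2 = 2 * ((∫ x, ‖F x‖ ^ 2) * ∫ t, ‖P t‖ ^ 2) := by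
    rw [norm_toL2_sq mFP, integral_norm_sq_tens]
  have hsmall : ∀ {f g : ℝ → ℂ}, MemLp (tens f g) 2 volume →
      (∫ x, ‖f x‖ ^ 2) * (∫ t, ‖g t‖ ^ 2) ≤ ε ^ 2 * ((∫ x, ‖F x‖ ^ 2) * ∫ t, ‖P t‖ ^ 2) →
      ‖toL2 (tens f g)‖ ≤ ε * ‖toL2 (tens F P)‖ := by
    intro f g hfg hle
    refine le_of_sq_le_sq ?_ (by positivity)
    rw [mul_pow, hvn, norm_toL2_sq hfg, integral_norm_sq_tens]
    linarith
  have hs1 : ‖toL2 (tens F r)‖ ≤ ε * ‖toL2 (tens F P)‖ := hsmall mFr (by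
    have := mul_le_mul_of_nonneg_left hr1 hF1.le
    linarith)
  have hs2 : ‖toL2 (tens S P)‖ ≤ ε * ‖toL2 (tens F P)‖ := hsmall mSP (by
    have := mul_le_mul_of_nonneg_right hFs hP1.le
    linarith)
  have hs3 : ‖toL2 (tens F fun t => deriv P t - Q t)‖ ≤ ε * ‖toL2 (tens F P)‖ := hsmall mFD (by
    have := mul_le_mul_of_nonneg_left hPQ hF1.le
    linarith)
  have hc2 : ∀ (z : ℂ) (f : Plane → ℂ), ‖z‖ ≤ 1 → MemLp f 2 volume →
      ‖toL2 (fun p => z * f p)‖ ≤ ‖toL2 f‖ := by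
    intro z f hz hf
    rw [toL2_const_mul hf, norm_smul]
    exact mul_le_of_le_one_left (norm_nonneg _) hz
  -- `G₁` and `G₂` are the partial derivatives of `v` with `deriv P` replaced by the discontinuous
  -- `Q`.
  refine ⟨(x₀, x₀), ρ, tens F P, fun p => (1 / 2 : ℂ) * (tens (deriv F) P p + tens F Q p),
    fun p => (1 / 2 : ℂ) * (tens (deriv F) P p - tens F Q p),
    fun p => (1 / 2 : ℂ) * (tens F r p - tens S P p), max (MF * MP) (MF' * MP + MF * M),
    by positivity, fun p hp => ?_, ⟨contDiff_tens hF hP, ?_⟩, (mF'P.add mFQ).const_mul _,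
    (mF'P.sub mFQ).const_mul _, (mFr.sub mSP).const_mul _, fun p hp => ?_, fun p => ⟨?_, ?_, ?_⟩,
    ?_, ?_, ?_, ?_, fun η hη => ?_⟩
  · rw [Metric.mem_ball, Prod.dist_eq, max_lt_iff, Real.dist_eq, abs_lt] at hp
    have := hp.1.1
    simp only at this
    linarith
  · exact HasCompactSupport.intro (isCompact_closedBall _ _) fun p hp =>
      hts p hp F P hF0 fun t ht => (h0 t ht).1
  · have z1 := hts p hp F P hF0 fun t ht => (h0 t ht).1
    have z2 := hts p hp (deriv F) P hF'0 fun t ht => (h0 t ht).1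
    have z3 := hts p hp F Q hF0 fun t ht => (h0 t ht).2.1
    have z4 := hts p hp F r hF0 fun t ht => (h0 t ht).2.2
    have z5 := hts p hp S P hS0 fun t ht => (h0 t ht).1
    simp [z1, z2, z3, z4, z5]
  · exact (hb1 p).trans (le_max_left _ _)
  · refine le_trans ?_ (le_max_right _ _)
    rw [hhalf]
    linarith [norm_add_le (tens (deriv F) P p) (tens F Q p), hb2' p, hb3 p,
      norm_nonneg (tens (deriv F) P p), norm_nonneg (tens F Q p)]
  · refine le_trans ?_ (le_max_right _ _)
    rw [hhalf]
    linarith [norm_sub_le (tens (deriv F) P p) (tens F Q p), hb2' p, hb3 p,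
      norm_nonneg (tens (deriv F) P p), norm_nonneg (tens F Q p)]
  · have : 0 < ‖toL2 (tens F P)‖ ^ 2 := by rw [hvn]; positivity
    exact (sq_pos_iff.1 this).lt_of_le' (norm_nonneg _)
  · have he : (fun p => fderiv ℝ (tens F P) p (1, 0) -
        (1 / 2 : ℂ) * (tens (deriv F) P p + tens F Q p)) =
        fun p => (1 / 2 : ℂ) * tens F (fun t => deriv P t - Q t) p := by
      funext p
      rw [fderiv_tens hF hP]
      simp only [tens]
      push_cast
      ring
    rw [he]
    exact (hc2 _ _ (by norm_num) mFD).trans hs3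
  · have he : (fun p => fderiv ℝ (tens F P) p (0, 1) -
        (1 / 2 : ℂ) * (tens (deriv F) P p - tens F Q p)) =
        fun p => (-1 / 2 : ℂ) * tens F (fun t => deriv P t - Q t) p := by
      funext p
      rw [fderiv_tens hF hP]
      simp only [tens]
      push_cast
      ring
    rw [he]
    exact (hc2 _ _ (by norm_num) mFD).trans hs3
  · rw [toL2_const_mul (f := fun p => tens F r p - tens S P p) (mFr.sub mSP), norm_smul,
      toL2_sub mFr mSP]
    have h4 := norm_sub_le (toL2 (tens F r)) (toL2 (tens S P))
    have h5 : ‖(1 / 2 : ℂ)‖ = 1 / 2 := by norm_num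
    rw [h5]
    linarith
  · rw [integral_fderiv_mul_tens (κ := κ) hF hFc hP hPc hQ hQ2 hr hr2 hid hη]
    have hΓ : ∫ p, η p * tens F P p ∂(arcLength γ) =
        (√2 : ℝ) * ∫ x, F x * (η (x, x) * P 0) := by
      rw [integral_arcLength (F := fun p => η p * tens F P p) hγ (hη.continuous.mul
        (contDiff_tens hF hP).continuous).stronglyMeasurable, ← integral_const_mul]
      refine integral_congr_ae (Eventually.of_forall fun x => ?_)
      simp only
      -- To the right of `a` the curve is the diagonal and its density is `√2`; elsewhere both
      -- integrands vanish.
      by_cases hx : a < x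
      · have hx' : a < |x| := hx.trans_le (le_abs_self x)
        rw [deriv_eq_one_of_lt hout hx', hout x hx'.le, tens]
        simp only
        rw [show (x + x) / 2 = x by ring, show (x - x) / 2 = 0 by ring, Complex.real_smul]
        norm_num
        ring
      · have z1 : tens F P (x, γ x) = 0 := by
          refine hts _ (fun h => ?_) F P hF0 fun t ht => (h0 t ht).1
          rw [Metric.mem_closedBall, Prod.dist_eq, max_le_iff, Real.dist_eq, abs_le] at h
          have := h.1.1
          simp only at this
          linarith
        have z2 : F x = 0 := hF0 x (by
          rw [abs_sub_comm]
          exact lt_of_lt_of_le (by linarith) (le_abs_self _))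
        simp [z1, z2]
    rw [hΓ]
    have hc1 : (κ : ℂ) ^ 2 - (b : ℂ) ^ 2 = 2 * l := by
      have : κ ^ 2 - b ^ 2 = 2 * l := by rw [hκ2, hb2]; ring
      exact_mod_cast this
    have hc3 : (2 : ℂ) * b = α * (√2 : ℝ) := by
      have : 2 * b = α * √2 := by rw [hb]; ring
      exact_mod_cast this
    rw [hc1, hc3]
    ring

end Quasimode

/-! ### Quasi-modes with magnetic field and the theorem -/

section WeylSequence

theorem norm_toL2_le_of_norm_le {f g : Plane → ℂ} (hf : AEStronglyMeasurable f volume)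
    (hg : MemLp g 2 volume) (h : ∀ p, ‖f p‖ ≤ ‖g p‖) : MemLp f 2 volume ∧ ‖toL2 f‖ ≤ ‖toL2 g‖ := by
  have hfm : MemLp f 2 volume := hg.mono hf (Eventually.of_forall h)
  refine ⟨hfm, ?_⟩
  rw [← enorm_le_iff_norm_le, enorm_toL2 hfm, enorm_toL2 hg]
  exact eLpNorm_mono h

/-- The product of a function that is small in `L²(K)` and of a bounded function supported
in `K`. -/
theorem norm_toL2_mul_le {K : Set Plane} (hK : MeasurableSet K) {β : Plane → ℝ} {m : Plane → ℂ}
    {M δ : ℝ} (hδ : 0 ≤ δ) (hβ : MemLp β 2 (volume.restrict K))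
    (hβδ : eLpNorm β 2 (volume.restrict K) ≤ ENNReal.ofReal δ)
    (hm : AEStronglyMeasurable m volume) (hM : ∀ p, ‖m p‖ ≤ M) (hmK : ∀ p ∉ K, m p = 0) :
    MemLp (fun p => (β p : ℂ) * m p) 2 volume ∧ ‖toL2 (fun p => (β p : ℂ) * m p)‖ ≤ M * δ := by
  have hM0 : 0 ≤ M := (norm_nonneg _).trans (hM 0)
  have hind : (fun p => (β p : ℂ) * m p) = K.indicator fun p => (β p : ℂ) * m p := by
    funext p
    by_cases hp : p ∈ K
    · rw [indicator_of_mem hp]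
    · rw [indicator_of_notMem hp, hmK p hp, mul_zero]
  have hle : ∀ p, ‖(β p : ℂ) * m p‖ ≤ M * ‖β p‖ := fun p => by
    rw [norm_mul, Complex.norm_real, mul_comm]
    exact mul_le_mul_of_nonneg_right (hM p) (norm_nonneg _)
  have hsm : AEStronglyMeasurable (fun p => (β p : ℂ) * m p) (volume.restrict K) :=
    (Complex.continuous_ofReal.comp_aestronglyMeasurable hβ.1).mul hm.restrict
  have h1 : MemLp (fun p => (β p : ℂ) * m p) 2 (volume.restrict K) :=
    hβ.of_le_mul hsm (Eventually.of_forall hle)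
  have h2 : MemLp (fun p => (β p : ℂ) * m p) 2 volume := by
    rw [hind, memLp_indicator_iff_restrict hK]; exact h1
  refine ⟨h2, ?_⟩
  have h3 : ‖toL2 (fun p => (β p : ℂ) * m p)‖ₑ ≤ ENNReal.ofReal (M * δ) := by
    rw [enorm_toL2 h2, hind, eLpNorm_indicator_eq_eLpNorm_restrict hK]
    refine (eLpNorm_le_mul_eLpNorm_of_ae_le_mul (Eventually.of_forall hle) 2).trans ?_
    rw [ENNReal.ofReal_mul hM0]
    gcongr
  rw [← ofReal_norm] at h3
  exact (ENNReal.ofReal_le_ofReal_iff (by positivity)).1 h3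

/-- The magnetic gradient of a gauged function, tested against a magnetic gradient. -/
theorem inner_gauged_eq {K : Set Plane} (hK : IsClosed K) {e : Plane} {A c : Plane → ℝ}
    {φ g v G : Plane → ℂ} (hφ : IsTest φ) (hg : IsTest g) (hv : IsTest v)
    (hG : MemLp G 2 volume) (hgK : ∀ p ∈ K, fderiv ℝ g p e = Complex.I * c p * g p)
    (h0 : ∀ p ∉ K, v p = 0 ∧ G p = 0) {Dφ Du : L2}
    (hDφ : Dφ =ᵐ[volume] fun p => Complex.I * fderiv ℝ φ p e + A p * φ p)
    (hDu : Du =ᵐ[volume] fun p => Complex.I * fderiv ℝ (fun p => g p * v p) p e +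
      A p * (g p * v p))
    (hX₁ : MemLp (fun p => Complex.I * g p * (fderiv ℝ v p e - G p)) 2 volume)
    (hX₂ : MemLp (fun p => ((A p - c p : ℝ) : ℂ) * (g p * v p)) 2 volume)
    (hY : MemLp (fun p => ((A p - c p : ℝ) : ℂ) * (Complex.I * g p * G p)) 2 volume) :
    inner ℂ Dφ Du = (∫ p, fderiv ℝ (fun p => conj (φ p) * g p) p e * G p) +
      inner ℂ Dφ (toL2 (fun p => Complex.I * g p * (fderiv ℝ v p e - G p)) +
        toL2 fun p => ((A p - c p : ℝ) : ℂ) * (g p * v p)) +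
      inner ℂ (toL2 φ) (toL2 fun p => ((A p - c p : ℝ) : ℂ) * (Complex.I * g p * G p)) := by
  have hη : IsTest fun p => conj (φ p) * g p := hφ.conj.mul hg
  have hv' : ∀ p ∉ K, fderiv ℝ v p e = 0 := by
    intro p hp
    have : v =ᶠ[𝓝 p] fun _ => 0 := by
      filter_upwards [hK.isOpen_compl.mem_nhds hp] with q hq
      exact (h0 q hq).1
    rw [this.fderiv_eq]; simp
  have hconj : ∀ p, fderiv ℝ (fun p => conj (φ p)) p e = conj (fderiv ℝ φ p e) := by
    intro p
    have h := (Complex.conjCLE.toContinuousLinearMap.hasFDerivAt.comp p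
      (hφ.differentiable p).hasFDerivAt).fderiv
    change fderiv ℝ (fun p => conj (φ p)) p = _ at h
    rw [h]; rfl
  have hηd : ∀ p, fderiv ℝ (fun p => conj (φ p) * g p) p e =
      conj (φ p) * fderiv ℝ g p e + conj (fderiv ℝ φ p e) * g p := by
    intro p
    rw [fderiv_fun_mul (hφ.conj.differentiable p) (hg.differentiable p)]
    simp only [add_apply, smul_apply, smul_eq_mul, hconj]
    ring
  have hud : ∀ p, fderiv ℝ (fun p => g p * v p) p e =
      g p * fderiv ℝ v p e + fderiv ℝ g p e * v p := by
    intro p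
    rw [fderiv_fun_mul (hg.differentiable p) (hv.differentiable p)]
    simp only [add_apply, smul_apply, smul_eq_mul]
    ring
  have i1 : Integrable fun p => fderiv ℝ (fun p => conj (φ p) * g p) p e * G p :=
    ((hη.fderiv_apply e).memLp 2 volume).integrable_mul hG
  rw [inner_add_right]
  have hint : ∀ f h : L2, Integrable fun p => conj (f p) * h p := fun f h => by
    have := L2.integrable_inner (𝕜 := ℂ) f h
    refine this.congr (Eventually.of_forall fun p => ?_)
    simp only [RCLike.inner_apply]
    ring
  simp_rw [inner_eq_integral]
  rw [← integral_add (hint _ _) (hint _ _), ← integral_add i1 ((hint _ _).fun_add (hint _ _)),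
    ← integral_add (i1.fun_add ((hint _ _).fun_add (hint _ _))) (hint _ _)]
  -- The identity holds pointwise. The gauge factor turns `A` into `A - c` in the magnetic
  -- derivative of `g v`. After `∂v` is replaced by `G`, moving `g` to the other side gives `∂(conj
  -- φ g) G` and a second term with `A - c`; all the others are remainders.
  refine integral_congr_ae ?_
  filter_upwards [hDφ, hDu, coeFn_toL2 hX₁, coeFn_toL2 hX₂, coeFn_toL2 hY,
    coeFn_toL2 (hφ.memLp 2 volume)] with p h1 h2 h3 h4 h5 h6
  rw [h1, h2, h3, h4, h5, h6, hηd, hud]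
  simp only [map_add, map_mul, Complex.conj_I, Complex.conj_ofReal]
  by_cases hp : p ∈ K
  · rw [hgK p hp]
    push_cast
    ring_nf
    simp only [Complex.I_sq, Complex.I_pow_three]
    ring
  · rw [(h0 p hp).1, (h0 p hp).2, hv' p hp]
    simp

variable {γ : ℝ → ℝ} {a : ℝ} {A : Plane → ℝ × ℝ} {B : Plane → ℝ}

/-- Approximate eigenfunctions of the form for every energy above the threshold. -/
theorem exists_quasimode_formBdd (hA : MapsH1ToL2 A) (hrot : IsRot A B)
    (hB : ∀ p : Plane, a < p.1 → B p = 0)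
    (hγ : Continuous γ) (hout : ∀ x, a ≤ |x| → γ x = x)
    {τ : Sob →L[ℂ] Lp ℂ 2 (arcLength γ)} (hτ : ∀ φ hφ, τ (ofTest φ hφ) =ᵐ[arcLength γ] φ)
    {α : ℝ} (hα : 0 < α) {l : ℝ} (hl : -(α ^ 2 / 4) ≤ l) {ε : ℝ} (hε : 0 < ε) :
    ∃ U : Sob, 0 < ‖comp 0 U‖ ∧ ∀ W : Sob,
      ‖(inner ℂ W (formBdd hA α τ U) - l * inner ℂ (comp 0 W) (comp 0 U) : ℂ)‖ ≤
        ε * ‖W‖ * ‖comp 0 U‖ := by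
  -- The final remainder has three terms, each paired with `covX hA W`, `covY hA W` or `comp 0 W`
  -- and of norm at most `2 ε₁ ‖toL2 v‖`; `N` collects the three operator bounds.
  set N : ℝ := ‖covX hA‖ + ‖covY hA‖ + 1 with hN
  have hN0 : 0 < N := by positivity
  set ε₁ : ℝ := ε / (2 * N) with hε₁
  have hε₁0 : 0 < ε₁ := by positivity
  obtain ⟨c, ρ, v, G₁, G₂, s, M, hρ, hball, hv, hG₁, hG₂, hs, h0, hM, hvpos, hd1, hd2, hsn, hid⟩ :=
    exists_quasimode hγ hout hα hl hε₁0
  have hM0 : 0 ≤ M := (norm_nonneg _).trans (hM 0).1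
  -- The gauge error is small only in L², so it is multiplied by the supremum `M` of `v` and the
  -- `Gᵢ`. The accuracy of the gauge is therefore chosen after the quasi-mode.
  set δ : ℝ := ε₁ * ‖toL2 v‖ / (2 * M + 1) with hδ
  have hδ0 : 0 < δ := by positivity
  have hMδ : 2 * (M * δ) ≤ ε₁ * ‖toL2 v‖ := by
    have h1 : (2 * M + 1) * δ = ε₁ * ‖toL2 v‖ := by rw [hδ]; field_simp
    linarith
  obtain ⟨g, c₁, c₂, hg, hg1, hgK, ⟨hm1, hn1⟩, hm2, hn2⟩ :=
    exists_gauge hA hrot hρ (fun p hp => hB p (hball p hp)) hδ0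
  set K : Set Plane := Metric.closedBall c ρ with hK
  have hKc : IsClosed K := Metric.isClosed_closedBall
  have hu : IsTest fun p => g p * v p := hg.mul hv
  have hgm : AEStronglyMeasurable g volume := hg.continuous.aestronglyMeasurable
  have hle : ∀ (f : Plane → ℂ) (z : ℂ) p, ‖z‖ = 1 → ‖z * g p * f p‖ ≤ ‖f p‖ := by
    intro f z p hz
    rw [norm_mul, norm_mul, hz, one_mul]
    exact mul_le_of_le_one_left (norm_nonneg _) (hg1 p)
  have hXa : ∀ (e : Plane) (G : Plane → ℂ), MemLp G 2 volume →
      ‖toL2 (fun p => fderiv ℝ v p e - G p)‖ ≤ ε₁ * ‖toL2 v‖ →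
      MemLp (fun p => Complex.I * g p * (fderiv ℝ v p e - G p)) 2 volume ∧
      ‖toL2 (fun p => Complex.I * g p * (fderiv ℝ v p e - G p))‖ ≤ ε₁ * ‖toL2 v‖ := by
    intro e G hG hn
    have hm : MemLp (fun p => fderiv ℝ v p e - G p) 2 volume :=
      ((hv.fderiv_apply e).memLp 2 volume).sub hG
    have := norm_toL2_le_of_norm_le (f := fun p => Complex.I * g p * (fderiv ℝ v p e - G p))
      ((hgm.const_mul _).mul hm.1) hm
      fun p => hle (fun p => fderiv ℝ v p e - G p) Complex.I p Complex.norm_I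
    exact ⟨this.1, this.2.trans hn⟩
  obtain ⟨hXa1, hXa1n⟩ := hXa (1, 0) G₁ hG₁ hd1
  obtain ⟨hXa2, hXa2n⟩ := hXa (0, 1) G₂ hG₂ hd2
  have hgv : ∀ p, ‖g p * v p‖ ≤ M := fun p => by
    have := hle v 1 p norm_one
    rw [one_mul] at this
    exact this.trans (hM p).1
  have hgv0 : ∀ p ∉ K, g p * v p = 0 := fun p hp => by rw [(h0 p hp).1, mul_zero]
  obtain ⟨hXb1, hXb1n⟩ := norm_toL2_mul_le hKc.measurableSet hδ0.le hm1 hn1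
    hu.continuous.aestronglyMeasurable hgv hgv0
  obtain ⟨hXb2, hXb2n⟩ := norm_toL2_mul_le hKc.measurableSet hδ0.le hm2 hn2
    hu.continuous.aestronglyMeasurable hgv hgv0
  obtain ⟨hY1, hY1n⟩ := norm_toL2_mul_le (m := fun p => Complex.I * g p * G₁ p) hKc.measurableSet
    hδ0.le hm1 hn1 ((hgm.const_mul _).mul hG₁.1)
    (fun p => (hle G₁ Complex.I p Complex.norm_I).trans (hM p).2.1)
    (fun p hp => by rw [(h0 p hp).2.1, mul_zero])
  obtain ⟨hY2, hY2n⟩ := norm_toL2_mul_le (m := fun p => Complex.I * g p * G₂ p) hKc.measurableSet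
    hδ0.le hm2 hn2 ((hgm.const_mul _).mul hG₂.1)
    (fun p => (hle G₂ Complex.I p Complex.norm_I).trans (hM p).2.2)
    (fun p hp => by rw [(h0 p hp).2.2.1, mul_zero])
  obtain ⟨hgs, hgsn⟩ := norm_toL2_le_of_norm_le (f := fun p => g p * s p) (hgm.mul hs.1) hs
    fun p => by simpa using hle s 1 p norm_one
  have hun : ‖toL2 (fun p => g p * v p)‖ = ‖toL2 v‖ := by
    have : ‖toL2 (fun p => g p * v p)‖ ^ 2 = ‖toL2 v‖ ^ 2 := by
      rw [norm_toL2_sq (hu.memLp 2 volume), norm_toL2_sq (hv.memLp 2 volume)]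
      refine integral_congr_ae (Eventually.of_forall fun p => ?_)
      by_cases hp : p ∈ K
      · simp only [norm_mul, (hgK p hp).1, one_mul]
      · simp only [(h0 p hp).1, mul_zero]
    exact (sq_eq_sq₀ (norm_nonneg _) (norm_nonneg _)).1 this
  set X₁ : L2 := toL2 (fun p => Complex.I * g p * (fderiv ℝ v p (1, 0) - G₁ p)) +
    toL2 fun p => (((A p).1 - c₁ p : ℝ) : ℂ) * (g p * v p) with hX₁
  set X₂ : L2 := toL2 (fun p => Complex.I * g p * (fderiv ℝ v p (0, 1) - G₂ p)) +
    toL2 fun p => (((A p).2 - c₂ p : ℝ) : ℂ) * (g p * v p) with hX₂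
  set Y₁ : L2 := toL2 fun p => (((A p).1 - c₁ p : ℝ) : ℂ) * (Complex.I * g p * G₁ p) with hY₁
  set Y₂ : L2 := toL2 fun p => (((A p).2 - c₂ p : ℝ) : ℂ) * (Complex.I * g p * G₂ p) with hY₂
  set Z : L2 := toL2 fun p => g p * s p with hZ
  -- An exact formula for the remainder, proved for test functions by inserting `conj φ * g` into
  -- the weak equation of `v` and extended by density.
  have key : ∀ W : Sob, inner ℂ W (formBdd hA α τ (ofTest _ hu)) -
      l * inner ℂ (comp 0 W) (comp 0 (ofTest _ hu)) =
      inner ℂ (covX hA W) X₁ + inner ℂ (covY hA W) X₂ + inner ℂ (comp 0 W) (Y₁ + Y₂ + Z) := by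
    refine Sob_induction (isClosed_eq ?_ ?_) fun φ hφ => ?_
    · exact (continuous_id.inner continuous_const).sub
        (continuous_const.mul ((comp 0).continuous.inner continuous_const))
    · exact (((covX hA).continuous.inner continuous_const).add
        ((covY hA).continuous.inner continuous_const)).add
          ((comp 0).continuous.inner continuous_const)
    have hη : IsTest fun p => conj (φ p) * g p := hφ.conj.mul hg
    have e1 := inner_gauged_eq hKc hφ hg hv hG₁ (fun p hp => (hgK p hp).2.1)
      (fun p hp => ⟨(h0 p hp).1, (h0 p hp).2.1⟩) (covX_ofTest_ae hA hφ) (covX_ofTest_ae hA hu)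
      hXa1 hXb1 hY1
    have e2 := inner_gauged_eq hKc hφ hg hv hG₂ (fun p hp => (hgK p hp).2.2)
      (fun p hp => ⟨(h0 p hp).1, (h0 p hp).2.2.1⟩) (covY_ofTest_ae hA hφ) (covY_ofTest_ae hA hu)
      hXa2 hXb2 hY2
    have e3 := hid _ hη
    have hGi : ∀ (e : Plane) (G : Plane → ℂ), MemLp G 2 volume →
        Integrable fun p => fderiv ℝ (fun p => conj (φ p) * g p) p e * G p := fun e G hG =>
      ((hη.fderiv_apply e).memLp 2 volume).integrable_mul hG
    rw [integral_add (hGi _ _ hG₁) (hGi _ _ hG₂)] at e3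
    have e4 : inner ℂ (τ (ofTest φ hφ)) (τ (ofTest _ hu)) =
        ∫ p, conj (φ p) * g p * v p ∂(arcLength γ) := by
      rw [L2.inner_def]
      refine integral_congr_ae ?_
      filter_upwards [hτ φ hφ, hτ _ hu] with p h1 h2
      rw [h1, h2, RCLike.inner_apply]
      ring
    have e5 : inner ℂ (toL2 φ) (toL2 fun p => g p * v p) = ∫ p, conj (φ p) * g p * v p := by
      rw [inner_toL2 (hφ.memLp 2 volume) (hu.memLp 2 volume)]
      simp_rw [mul_assoc]
    have e6 : inner ℂ (toL2 φ) Z = ∫ p, conj (φ p) * g p * s p := by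
      rw [hZ, inner_toL2 (hφ.memLp 2 volume) hgs]
      simp_rw [mul_assoc]
    have e7 : inner ℂ (toL2 φ) (Y₁ + Y₂ + Z) = inner ℂ (toL2 φ) Y₁ + inner ℂ (toL2 φ) Y₂ +
        ∫ p, conj (φ p) * g p * s p := by rw [inner_add_right, inner_add_right, e6]
    rw [← hX₁, ← hY₁] at e1
    rw [← hX₂, ← hY₂] at e2
    rw [inner_formBdd, comp_zero_ofTest, comp_zero_ofTest, e1, e2, e4, e5, e7]
    linear_combination e3
  refine ⟨ofTest _ hu, by rw [comp_zero_ofTest, hun]; exact hvpos, fun W => ?_⟩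
  rw [key, comp_zero_ofTest, hun]
  have t1 : ‖X₁‖ ≤ 2 * (ε₁ * ‖toL2 v‖) := by
    refine (norm_add_le _ _).trans ?_
    have : 0 ≤ M * δ := by positivity
    linarith
  have t2 : ‖X₂‖ ≤ 2 * (ε₁ * ‖toL2 v‖) := by
    refine (norm_add_le _ _).trans ?_
    have : 0 ≤ M * δ := by positivity
    linarith
  have t3 : ‖Y₁ + Y₂ + Z‖ ≤ 2 * (ε₁ * ‖toL2 v‖) := by
    have := norm_add_le (Y₁ + Y₂) Z
    have := norm_add_le Y₁ Y₂
    linarith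
  have w1 : ‖(inner ℂ (covX hA W) X₁ : ℂ)‖ ≤ ‖covX hA‖ * ‖W‖ * (2 * (ε₁ * ‖toL2 v‖)) :=
    (norm_inner_le_norm _ _).trans
      (mul_le_mul ((covX hA).le_opNorm W) t1 (norm_nonneg _) (by positivity))
  have w2 : ‖(inner ℂ (covY hA W) X₂ : ℂ)‖ ≤ ‖covY hA‖ * ‖W‖ * (2 * (ε₁ * ‖toL2 v‖)) :=
    (norm_inner_le_norm _ _).trans
      (mul_le_mul ((covY hA).le_opNorm W) t2 (norm_nonneg _) (by positivity))
  have w3 : ‖(inner ℂ (comp 0 W) (Y₁ + Y₂ + Z) : ℂ)‖ ≤ ‖W‖ * (2 * (ε₁ * ‖toL2 v‖)) :=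
    (norm_inner_le_norm _ _).trans
      (mul_le_mul (norm_comp_le 0 W) t3 (norm_nonneg _) (norm_nonneg _))
  have w4 := norm_add₃_le (a := (inner ℂ (covX hA W) X₁ : ℂ)) (b := inner ℂ (covY hA W) X₂)
    (c := inner ℂ (comp 0 W) (Y₁ + Y₂ + Z))
  have w5 : ε * ‖W‖ * ‖toL2 v‖ = N * ‖W‖ * (2 * (ε₁ * ‖toL2 v‖)) := by
    rw [hε₁]; field_simp
  rw [w5, hN]
  linarith

end WeylSequence

end LeakyWire

end

theorem theorem1 (a α : ℝ) (ha : 0 < a) (hα : 0 < α)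
    (A : LeakyWire.Plane → ℝ × ℝ) (hA : LeakyWire.MapsH1ToL2 A)
    (B : LeakyWire.Plane → ℝ) (hB : LocallyIntegrable B volume)
    (hrot : LeakyWire.IsRot A B)
    (hsupp : tsupport B ⊆ Ioo (-a) a ×ˢ Ioo (-a) a)
    (γ : ℝ → ℝ) (hγ : Continuous γ) (hγ' : LeakyWire.IsPiecewiseC1 γ)
    (hout : ∀ x, a ≤ |x| → γ x = x) (hin : ∀ x, |x| < a → |γ x| ≤ a) :
    ∃ H : LeakyWire.L2 →ₗ.[ℂ] LeakyWire.L2,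
      LeakyWire.IsAssociated A α γ H ∧ IsSelfAdjoint H ∧
      LeakyWire.essentialSpectrum H = (fun s : ℝ => (s : ℂ)) '' Ici (-(α ^ 2 / 4)) := by
  obtain ⟨L, -, hL⟩ := hγ'.exists_deriv_bound hout
  obtain ⟨τ, hτ, hτ'⟩ := LeakyWire.exists_traceOp_graph ha hγ hout hin hL
  obtain ⟨δ, hδ, c, -, hc⟩ := LeakyWire.exists_coercive hA ha hγ hout hin hL hτ' hα.le
  -- The quasi-modes live to the right of the box that contains the support of the field.
  have hB0 : ∀ p : LeakyWire.Plane, a < p.1 → B p = 0 := fun p hp =>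
    image_eq_zero_of_notMem_tsupport fun h => absurd (hsupp h).1.2 (not_lt.2 hp.le)
  have hT := LeakyWire.isSelfAdjoint_formBdd hA α τ
  refine ⟨LeakyWire.formOp (LeakyWire.comp 0) (LeakyWire.formBdd hA α τ),
    LeakyWire.isAssociated_formOp hA α τ hτ,
    LeakyWire.isSelfAdjoint_formOp LeakyWire.comp_zero_injective LeakyWire.denseRange_comp_zero
      hT hδ hc,
    LeakyWire.essentialSpectrum_formOp LeakyWire.comp_zero_injective
      LeakyWire.denseRange_comp_zero hT hδ hc (fun μ hμ => ?_) fun l hl ε hε => ?_⟩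
  · exact LeakyWire.exists_lower_bound_finiteRank hA ha hγ hout hin hL hτ' hα.le hμ
  · exact LeakyWire.exists_quasimode_formBdd hA hrot hB0 hγ hout hτ' hα hl hε
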